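/- **Conventions.** Graphs are simple graphs $G=([n],E)$ with $[n]=\{1,\dots,n\}$, $n\ge 1$. $G$ is a *natural unit interval graph* if for all $1\le i<j<k\le n$, $\{i,k\}\in E$ implies $\{i,j\}\in E$ and $\{j,k\}\in E$. The *sum* of $G_1=([n_1],E_1)$ and $G_2=([n_2],E_2)$ is $G_1+G_2=([n_1+n_2-1],\,E_1\cup\{\{i+n_1-1,j+n_1-1\}:\{i,j\}\in E_2\})$. For $a\ge1$, $K_a^0$ is the complete graph on $[a]$, and $K_a^1$ is the complete graph on $[a]$ with the edge $\{1,a\}$ removed. A subtree $T$ of $G$ is *decreasing* if every vertex of $T$ except the largest has exactly one larger neighbour in $T$. Then $\mathrm{list}(T)$ is the permutation of $V(T)$ obtained by reading first the smallest vertex and then, at each step, the smallest unread vertex adjacent in $T$ to a read vertex. A *tree triple* of $G$ is $\mathcal T=(T,\alpha,r)$ with $T$ a decreasing subtree of $G$, $\alpha=\alpha_1\cdots\alpha_\ell$ a composition of $|V(T)|$, and $1\le r\le\alpha_1$; it is *breakable* if $\ell(\alpha)\ge2$. A *forest triple* of $G$ is a sequence $\mathcal F=(\mathcal T_t=(T_t,\alpha^{(t)},r_t))_{t=1}^m$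 of tree triples such that each vertex of $G$ lies in exactly one $T_t$ and $\min V(T_1)<\cdots<\min V(T_m)$. Its *type* is the partition obtained by sorting all parts of all $\alpha^{(t)}$; its *sign* is $(-1)^{\sum_t(\ell(\alpha^{(t)})-1)}$; its *weight* is $\mathrm{inv}_G(\sigma)+\sum_t(r_t-1)$, where $\sigma=\mathrm{list}(T_1)\cdots\mathrm{list}(T_m)$ and $\mathrm{inv}_G(\sigma)=|\{(i,j):i<j,\ \sigma_i>\sigma_j,\ \{\sigma_j,\sigma_i\}\in E\}|$. It is an *atom* if no $\mathcal T_t$ is breakable, and *simple* if $r_1=1$; $\mathrm{FT}_{\mathrm{simple}}(G)$ is the set of simple forest triples. A *nice involution* for $G$ is a map $\varphi:\mathrm{FT}_{\mathrm{simple}}(G)\to\mathrm{FT}_{\mathrm{simple}}(G)$ with $\varphi\circ\varphi=\mathrm{id}$ that preserves type, weight and $\alpha^{(1)}_1$, all of whose fixed points are atoms, and with $\mathrm{sign}(\varphi(\mathcal F))=-\mathrm{sign}(\mathcal F)$ whenever $\varphi(\mathcal F)\ne\mathcal F$. Let $\mathcal F$ be a simple forest triple of $G_1+G_2$, let $i$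 be the index with $n_1\in V(T_i)$, and put $\sigma=\mathrm{list}(T_i)$, $k=|V(T_i)\cap[n_1]|$. Let $\mathrm{seg}_{[n_1]}(\mathcal T_i)$ be the $j$ with $\alpha^{(i)}_1+\cdots+\alpha^{(i)}_{j-1}<k\le\alpha^{(i)}_1+\cdots+\alpha^{(i)}_j$. Let $\mathcal T_1,\dots,\mathcal T_{i'}$ be the tree triples whose trees meet $[n_1]$, and put $\mathrm{seg}_{[n_1]}(\mathcal F)=\mathrm{seg}_{[n_1]}(\mathcal T_i)+\sum_{1\le t\le i',\,t\ne i}\ell(\alpha^{(t)})$. The *restriction* $\mathcal F|_{\ge n_1}\in\mathrm{FT}_{\mathrm{simple}}(G_2)$ is obtained from the sequence $(\mathcal T_i|_{\ge n_1},\mathcal T_{i'+1},\dots,\mathcal T_m)$ by subtracting $n_1-1$ from every vertex label; here $\mathcal T_i|_{\ge n_1}$ is the tree triple whose tree has list $n_1\,\sigma_{k+1}\,\sigma_{k+2}\cdots$, with composition $(\alpha^{(i)}_1+\cdots+\alpha^{(i)}_j-k+1)\,\alpha^{(i)}_{j+1}\cdots\alpha^{(i)}_\ell$ and third entry $1$.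 **Theorem.** Let $a\ge1$ and $\epsilon\in\{0,1\}$, and let $\varphi'$ be a nice involution for a natural unit interval graph $G'$. Then there is a nice involution $\varphi$ for $G=K_a^\epsilon+G'$ whose fixed points are exactly the $\mathcal F\in\mathrm{FT}_{\mathrm{simple}}(G)$ such that, with $\mathcal T_i=(T_i,\alpha^{(i)},r_i)$ denoting the tree triple of $\mathcal F$ with $a\in V(T_i)$: - $\mathcal F$ is an atom; - $\mathcal F|_{\ge a}$ is fixed under $\varphi'$; - $\mathrm{seg}_{[a]}(\mathcal F)\le2$; - if $1\notin V(T_i)$, then $r_i\ge a-\epsilon$; - if $1\in V(T_i)$, then $|V(T_i)|\ge a$. -/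

import Mathlib

/-- A graph `([n], E)` with vertex set `[n] = {1, …, n}`, `n ≥ 1`.  The edge set is carried by a
simple graph on `ℕ` all of whose edges lie in `[n]`. -/
structure LabelledGraph where
  n : ℕ
  pos : 1 ≤ n
  graph : SimpleGraph ℕ
  mem_of_adj : ∀ i j, graph.Adj i j → i ∈ Set.Icc 1 n

namespace LabelledGraph

/-- The natural unit interval condition. -/
def IsNaturalUnitInterval (G : LabelledGraph) : Prop :=
  ∀ i j k : ℕ, 1 ≤ i → i < j → j < k → k ≤ G.n →
    G.graph.Adj i k → G.graph.Adj i j ∧ G.graph.Adj j k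

/-- The sum `G₁ + G₂`: vertex `n₁` of `G₁` is glued to vertex `1` of `G₂`, that is, vertex `i` of
`G₂` becomes vertex `i + n₁ - 1`. -/
def sum (G₁ G₂ : LabelledGraph) : LabelledGraph where
  n := G₁.n + G₂.n - 1
  pos := by have h₁ := G₁.pos; have h₂ := G₂.pos; omega
  graph :=
    { Adj := fun x y => G₁.graph.Adj x y ∨
        ∃ i j, G₂.graph.Adj i j ∧ x = i + G₁.n - 1 ∧ y = j + G₁.n - 1
      symm := ⟨by
        rintro x y (h | ⟨i, j, h, hx, hy⟩)
        · exact Or.inl h.symm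
        · exact Or.inr ⟨j, i, h.symm, hy, hx⟩⟩
      loopless := ⟨by
        rintro x (h | ⟨i, j, h, hx, hy⟩)
        · exact h.ne rfl
        · have h₁ := G₁.pos
          exact h.ne (by omega)⟩ }
  mem_of_adj := by
    have h₁ := G₁.pos
    have h₂ := G₂.pos
    rintro x y (h | ⟨i, j, h, hx, hy⟩)
    · have := G₁.mem_of_adj x y h
      simp only [Set.mem_Icc] at this ⊢
      omega
    · have := G₂.mem_of_adj i j h
      simp only [Set.mem_Icc] at this ⊢
      omega

/-- `K_a^ε`: the complete graph on `[a]` if `ε = 0`; the complete graph on `[a]` with the edge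
`{1, a}` removed if `ε = 1`. -/
def almostComplete (a ε : ℕ) (ha : 1 ≤ a) : LabelledGraph where
  n := a
  pos := ha
  graph :=
    { Adj := fun x y => x ≠ y ∧ x ∈ Set.Icc 1 a ∧ y ∈ Set.Icc 1 a ∧
        ¬ (ε = 1 ∧ ((x = 1 ∧ y = a) ∨ (x = a ∧ y = 1)))
      symm := ⟨by
        rintro x y ⟨h, hx, hy, he⟩
        exact ⟨h.symm, hy, hx, fun ⟨h₁, h₂⟩ => he ⟨h₁, by tauto⟩⟩⟩
      loopless := ⟨fun _ h => h.1 rfl⟩ }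
  mem_of_adj := fun _ _ h => h.2.1

/-- `T` is a decreasing subtree of `G`: a subgraph of `G` (with vertices in `[n]`) which is a tree
and in which every vertex except the largest has exactly one larger neighbour. -/
structure IsDecreasingSubtree (G : LabelledGraph) (T : G.graph.Subgraph) : Prop where
  subset : T.verts ⊆ Set.Icc 1 G.n
  isTree : T.coe.IsTree
  decreasing : ∀ v ∈ T.verts, (∃ w ∈ T.verts, v < w) → ∃! w, T.Adj v w ∧ v < w

/-- The first `k` entries of `list(T)`: first the smallest vertex of `T`, then repeatedly the
smallest unread vertex of `T` that is adjacent in `T` to a vertex already read. -/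
noncomputable def readVertices {G : LabelledGraph} (T : G.graph.Subgraph) : ℕ → List ℕ
  | 0 => []
  | 1 => [sInf T.verts]
  | k + 2 => readVertices T (k + 1) ++
      [sInf {v | v ∈ T.verts ∧ v ∉ readVertices T (k + 1) ∧
        ∃ u ∈ readVertices T (k + 1), T.Adj u v}]

/-- The permutation `list(T)` of the vertices of a decreasing subtree `T`. -/
noncomputable def treeList {G : LabelledGraph} (T : G.graph.Subgraph) : List ℕ :=
  readVertices T T.verts.ncard

/-- The number `inv_G(σ)` of `G`-inversions of `σ`: pairs of positions `i < j` with
`σ_i > σ_j` and `{σ_j, σ_i}` an edge of `G`. -/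
noncomputable def inv (G : LabelledGraph) (σ : List ℕ) : ℕ :=
  {p : Fin σ.length × Fin σ.length |
    p.1 < p.2 ∧ σ.get p.2 < σ.get p.1 ∧ G.graph.Adj (σ.get p.2) (σ.get p.1)}.ncard

end LabelledGraph

/-- A tree triple `(T, α, r)` of `G`: a decreasing subtree `T`, a composition `α` of `|V(T)|`
(given by the list of its parts), and an integer `1 ≤ r ≤ α₁`. -/
structure TreeTriple (G : LabelledGraph) where
  tree : G.graph.Subgraph
  isDecreasing : G.IsDecreasingSubtree tree
  comp : List ℕ
  comp_pos : ∀ p ∈ comp, 1 ≤ p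
  comp_sum : comp.sum = tree.verts.ncard
  r : ℕ
  one_le_r : 1 ≤ r
  r_le : r ≤ comp.headD 0

namespace TreeTriple

variable {G : LabelledGraph}

/-- The set `V(T)`. -/
def verts (S : TreeTriple G) : Set ℕ := S.tree.verts

/-- The permutation `list(T)`. -/
noncomputable def list (S : TreeTriple G) : List ℕ := LabelledGraph.treeList S.tree

/-- A tree triple is breakable if its composition has at least two parts. -/
def IsBreakable (S : TreeTriple G) : Prop := 2 ≤ S.comp.length

/-- The tree triple has a vertex in `[m]`. -/
def IsPresent (S : TreeTriple G) (m : ℕ) : Prop := (S.verts ∩ Set.Icc 1 m).Nonempty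

/-- The number `k = |V(T) ∩ [m]|`. -/
noncomputable def numVerts (S : TreeTriple G) (m : ℕ) : ℕ := (S.verts ∩ Set.Icc 1 m).ncard

/-- The number `j` with `α₁ + ⋯ + α_{j-1} < k ≤ α₁ + ⋯ + α_j`, where `k = |V(T) ∩ [m]| ≥ 1`,
that is, the least `j` with `k ≤ α₁ + ⋯ + α_j`. -/
noncomputable def seg (S : TreeTriple G) (m : ℕ) : ℕ :=
  sInf {j | S.numVerts m ≤ (S.comp.take j).sum}

/-- `S'` is `S - x`: the entries of the tree list of `S'` are those of `S` decreased by `x`, and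
the other data agree. -/
def IsShift {G' : LabelledGraph} (x : ℕ) (S : TreeTriple G) (S' : TreeTriple G') : Prop :=
  S.list = S'.list.map (· + x) ∧ S'.comp = S.comp ∧ S'.r = S.r

end TreeTriple

/-- A forest triple of `G`: a sequence of tree triples such that each vertex of `G` is in exactly
one of the trees, ordered so that the minima of the trees increase. -/
structure ForestTriple (G : LabelledGraph) where
  triples : List (TreeTriple G)
  cover : ∀ v ∈ Set.Icc 1 G.n, ∃! S, S ∈ triples ∧ v ∈ S.verts
  increasing : triples.Pairwise fun S S' => sInf S.verts < sInf S'.verts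

namespace ForestTriple

variable {G : LabelledGraph}

/-- The type: the integer partition formed by all the parts of all the compositions, recorded as
the multiset of its parts. -/
def type (F : ForestTriple G) : Multiset ℕ := ↑(F.triples.flatMap TreeTriple.comp)

/-- The sign. -/
def sign (F : ForestTriple G) : ℤ := (-1) ^ (F.triples.map fun S => S.comp.length - 1).sum

/-- The weight. -/
noncomputable def weight (F : ForestTriple G) : ℕ :=
  G.inv (F.triples.flatMap TreeTriple.list) + (F.triples.map fun S => S.r - 1).sum

/-- The number `α^{(1)}_1`, the first part of the composition of the first tree triple (the one
whose tree contains the vertex `1`). -/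
def firstPart (F : ForestTriple G) : ℕ :=
  (F.triples.head?.map fun S => S.comp.headD 0).getD 0

/-- A forest triple is an atom if none of its tree triples is breakable. -/
def IsAtom (F : ForestTriple G) : Prop := ∀ S ∈ F.triples, ¬ S.IsBreakable

/-- A forest triple is simple if `r₁ = 1`. -/
def IsSimple (F : ForestTriple G) : Prop := ∀ S ∈ F.triples.head?, S.r = 1

open Classical in
/-- The number `seg_{[m]}(F)`: the sum over the tree triples present in `[m]`, where the one whose
tree contains the vertex `m` contributes `seg_{[m]}` and every other one contributes the length of
its composition. -/
noncomputable def seg (F : ForestTriple G) (m : ℕ) : ℕ :=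
  ((F.triples.filter fun S => S.IsPresent m).map fun S =>
    if m ∈ S.verts then S.seg m else S.comp.length).sum

end ForestTriple

/-- The set of simple forest triples of `G`. -/
abbrev SimpleForestTriple (G : LabelledGraph) : Type := {F : ForestTriple G // F.IsSimple}

/-- Nice involutions. -/
structure IsNiceInvolution {G : LabelledGraph}
    (φ : SimpleForestTriple G → SimpleForestTriple G) : Prop where
  involutive : Function.Involutive φ
  type_eq : ∀ F, (φ F).1.type = F.1.type
  weight_eq : ∀ F, (φ F).1.weight = F.1.weight
  firstPart_eq : ∀ F, (φ F).1.firstPart = F.1.firstPart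
  isAtom : ∀ F, φ F = F → F.1.IsAtom
  sign_eq : ∀ F, φ F ≠ F → (φ F).1.sign = - F.1.sign

open Classical in
/-- `F'` is the restriction `F|_{≥ n₁}` of the simple forest triple `F` of `G₁ + G₂` to `G₂`.
With `S = (T, α, r)` the tree triple of `F` whose tree contains the vertex `n₁`,
`σ = list(T)`, `k = |V(T) ∩ [n₁]|` and `j = seg_{[n₁]}(S)`, the first tree triple of `F'` is
`(n₁ σ_{k+1} ⋯, (α₁ + ⋯ + α_j - k + 1) α_{j+1} ⋯ α_ℓ, 1)` with the entries of the tree list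
decreased by `n₁ - 1`.  The remaining tree triples of `F'` are those of `F` that have no vertex in
`[n₁]`, in the same order, decreased by `n₁ - 1`. -/
def IsRestriction {G₁ G₂ : LabelledGraph} (F : SimpleForestTriple (G₁.sum G₂))
    (F' : SimpleForestTriple G₂) : Prop :=
  ∃ S ∈ F.1.triples, G₁.n ∈ S.verts ∧
    ∃ S' rest, F'.1.triples = S' :: rest ∧
      G₁.n :: S.list.drop (S.numVerts G₁.n) = S'.list.map (· + (G₁.n - 1)) ∧
      S'.comp = ((S.comp.take (S.seg G₁.n)).sum - S.numVerts G₁.n + 1) ::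
        S.comp.drop (S.seg G₁.n) ∧
      S'.r = 1 ∧
      List.Forall₂ (TreeTriple.IsShift (G₁.n - 1))
        (F.1.triples.filter fun S => ¬ S.IsPresent G₁.n) rest

/-! A decreasing tree is determined by its list. A newly read vertex `x` hangs from the last earlier
letter larger than `x` or, if no earlier letter is larger, from the largest earlier letter
(`IsParent`). So decreasing subtrees of `G` are the words that begin with their least letter and
whose parent edges lie in `G`, and a forest triple becomes a list of words with compositions and
integers `r` (`Block`). For `K_a^0` the edge condition is empty. For `K_a^1` it only forbids a word
that begins with `1, a` (`isTreeWord_almostComplete_iff`).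

In a sum, the tree through the glueing vertex `n₁` reads its vertices up to `n₁` before all others
(`IsTreeWord.sum_cases`). Cutting there splits a simple forest triple into its restriction `R` and a
left part `L`, a forest triple of the first graph whose vertex `n₁` carries `B` extra vertices,
where `B + 1` is the first part of `R` (`exists_combine`, `isForest_combine`). Weights and sign
exponents add up, the first part is that of `L`, and the types of `L` and `R` together with the
first part of `R` determine the type. If `R` is moved by `φ'`, replace it by its image and keep `L`;
this is legitimate because `φ'` preserves the first part, hence `B`. If `R` is fixed, keep it and
use an involution on the left parts for the given `B`; constructing that one is the main work
(`cancels_isLeft`).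

The left involution is not explicit. Once the type and the first part are controlled, it suffices
that the signed generating function by weight vanishes: then every weight has equally many positive
and negative elements, and any bijection between them will do (`Cancels.of_genFun_eq_zero`). To
compute it, cut the tree lists into segments, one for each part of the compositions. A part is
flagged by `r` if it begins a tree and unflagged, with sign `-1`, if it continues one. Write `[n]`
and `n!` for the `q`-analogues. Words on `n` letters contribute `n!` by inversions and those
beginning with their least letter contribute `(n-1)!`, so the `[n]` choices of `r` make up for the
lost factor. This cancels a single part of a tree away from `a`. Near `a` the extra `B` vertices may
change place when a tree is continued or closed, so two parts must be treated together
(`cancels_two_of_cur`, `cancels_two_of_mem`). By fixing leading parts, longer lists reduce to these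
cases (`cancels_partSet`).

For the whole left part the first block must have `r = 1`. One part is always fixed, and three or
more cancel after fixing the first one. For two parts of sizes `f < a` and `g = a + B - f`, let `W`
count the words on `{2, …, a}`, those beginning with `a` being excluded if `ε = 1`. An unflagged
second part contributes `-W`, and a first part that contains `a`, when possible, contributes `W -
[g](a-2)!`. A flagged second part that contains `a` contributes `[m](a-2)!` if `r` ranges up to `m`.
When `a` fits into the first part, `m = g` balances the sum; otherwise `W = [a-1-ε](a-2)!` and one
needs `m = a-1-ε`. The surplus, where `r ≥ a-ε`, and the case `f ≥ a` are the fixed points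
(`cancels_topSet`). -/

/-! ### Words and parents -/

theorem List.split_cases {α : Type*} {s t s' t' : List α} {x y : α}
    (h : s ++ x :: t = s' ++ y :: t') :
    (s = s' ∧ x = y ∧ t = t') ∨ (∃ m, s' = s ++ x :: m ∧ t = m ++ y :: t') ∨
      (∃ m, s = s' ++ y :: m ∧ t' = m ++ x :: t) := by
  rcases List.append_eq_append_iff.1 h with ⟨m, h₁, h₂⟩ | ⟨m, h₁, h₂⟩
  · cases m with
    | nil => simp_all
    | cons a m => simp only [List.cons_append, List.cons.injEq] at h₂; grind
  · cases m with
    | nil => simp_all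
    | cons a m => simp only [List.cons_append, List.cons.injEq] at h₂; grind

theorem List.Nodup.split_eq {α : Type*} {w s t s' t' : List α} {x : α} (hw : w.Nodup)
    (h : w = s ++ x :: t) (h' : w = s' ++ x :: t') : s = s' ∧ t = t' := by
  subst h
  rcases List.split_cases h' with h | ⟨m, h₁, h₂⟩ | ⟨m, h₁, h₂⟩
  · exact ⟨h.1, h.2.2⟩
  · subst h₂; simp [List.nodup_append] at hw
  · subst h₁; simp [List.nodup_append] at hw

/-- The vertex `y` of the word `u` to which a decreasing tree read as `u` attaches the next
vertex `x`. -/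
def IsParent (u : List ℕ) (x y : ℕ) : Prop :=
  (∃ s t, u = s ++ y :: t ∧ x < y ∧ ∀ z ∈ t, z < x) ∨ (y ∈ u ∧ y < x ∧ ∀ z ∈ u, z ≤ y)

namespace IsParent

variable {u : List ℕ} {x y y' : ℕ}

theorem mem (h : IsParent u x y) : y ∈ u := by
  rcases h with ⟨s, t, rfl, -⟩ | h
  · simp
  · exact h.1

theorem ne (h : IsParent u x y) : x ≠ y := by
  rcases h with ⟨s, t, rfl, h, -⟩ | h <;> omega

/-- The first alternative describes the last letter of `u` larger than `x`; the second describes the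
maximum of `u` and applies only if no letter is larger than `x`. -/
theorem unique (h : IsParent u x y) (h' : IsParent u x y') : y = y' := by
  have hm := h.mem
  have hm' := h'.mem
  rcases h with ⟨s, t, hu, h, ht⟩ | ⟨hu, h, ht⟩ <;> rcases h' with ⟨s', t', hu', h', ht'⟩ | ⟨hu', h', ht'⟩
  · rcases List.split_cases (hu.symm.trans hu') with h₁ | ⟨m, h₁, h₂⟩ | ⟨m, h₁, h₂⟩
    · exact h₁.2.1
    · have := ht y' (by simp [h₂]); omega
    · have := ht' y (by simp [h₂]); omega
  · have := ht' y hm; omega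
  · have := ht y' hm'; omega
  · have := ht _ hm'
    have := ht' _ hm
    omega

theorem exists_of_notMem : ∀ {u : List ℕ}, u ≠ [] → x ∉ u → ∃ y, IsParent u x y := by
  intro u
  induction u using List.reverseRecOn with
  | nil => simp
  | append_singleton u a ih =>
    intro _ hx
    simp only [List.mem_append, List.mem_singleton, not_or] at hx
    by_cases hxa : x < a
    · exact ⟨a, Or.inl ⟨u, [], rfl, hxa, by simp⟩⟩
    by_cases hu : u = []
    · exact ⟨a, Or.inr ⟨by simp, by omega, by simp [hu]⟩⟩
    obtain ⟨y, ⟨s, t, rfl, h, ht⟩ | ⟨hy, h, ht⟩⟩ := ih hu hx.1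
    · exact ⟨y, Or.inl ⟨s, t ++ [a], by simp, h, by
        intro z hz
        simp only [List.mem_append, List.mem_singleton] at hz
        rcases hz with hz | rfl
        · exact ht z hz
        · omega⟩⟩
    · rcases le_total a y with hay | hay
      · exact ⟨y, Or.inr ⟨by simp [hy], h, by
          intro z hz
          simp only [List.mem_append, List.mem_singleton] at hz
          rcases hz with hz | rfl
          · exact ht z hz
          · exact hay⟩⟩
      · exact ⟨a, Or.inr ⟨by simp, by omega, by
          intro z hz
          simp only [List.mem_append, List.mem_singleton] at hz
          rcases hz with hz | rfl
          · exact (ht z hz).trans hay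
          · exact le_rfl⟩⟩

end IsParent

/-- The least vertex of a cycle would have two distinct larger neighbours on it. -/
theorem SimpleGraph.isAcyclic_of_larger_unique {V : Type*} [LinearOrder V] (H : SimpleGraph V)
    (h : ∀ v a b, H.Adj v a → H.Adj v b → v < a → v < b → a = b) : H.IsAcyclic := by
  intro u c hc
  obtain ⟨m, hm, hmin⟩ := Finset.exists_min_image c.support.toFinset id
    ⟨u, by simp⟩
  simp only [List.mem_toFinset, id] at hm hmin
  have hc' := hc.rotate hm
  have hsupp : ∀ z ∈ (c.rotate m hm).support, m ≤ z := by
    intro z hz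
    exact hmin z (by simpa using hz)
  have hn : ¬ (c.rotate m hm).Nil := hc'.not_nil
  have h₁ := (c.rotate m hm).adj_snd hn
  have h₂ := (c.rotate m hm).adj_penultimate hn
  refine hc'.snd_ne_penultimate (h m _ _ h₁ h₂.symm ?_ ?_)
  · exact lt_of_le_of_ne (hsupp _ ((c.rotate m hm).getVert_mem_support 1)) h₁.ne
  · exact lt_of_le_of_ne (hsupp _ ((c.rotate m hm).getVert_mem_support _)) h₂.ne'

/-! ### From words to decreasing subtrees -/

/-- `w` is the list of a decreasing subtree of `G`. -/
structure IsTreeWord (G : LabelledGraph) (w : List ℕ) : Prop where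
  ne_nil : w ≠ []
  nodup : w.Nodup
  mem_Icc : ∀ x ∈ w, x ∈ Set.Icc 1 G.n
  head_le : ∀ x ∈ w, w.headD 0 ≤ x
  adj : ∀ u x v y, w = u ++ x :: v → IsParent u x y → G.graph.Adj x y

/-- The edge of the tree with list `w` joining `x` to a vertex read before it. -/
def WordAdj (w : List ℕ) (x y : ℕ) : Prop := ∃ u v, w = u ++ x :: v ∧ IsParent u x y

theorem WordAdj.mem_left {w : List ℕ} {x y : ℕ} (h : WordAdj w x y) : x ∈ w := by
  obtain ⟨u, v, rfl, h⟩ := h; simp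

theorem WordAdj.mem_right {w : List ℕ} {x y : ℕ} (h : WordAdj w x y) : y ∈ w := by
  obtain ⟨u, v, rfl, h⟩ := h; simp [h.mem]

/-- If a letter larger than `x` occurs before `x`, then the parent of `x` is larger and no later
letter above `x` can hang from it. Otherwise `x` is the maximum so far, and its larger neighbour is
the next letter exceeding it, which hangs from `x`. -/
theorem WordAdj.existsUnique_larger {w : List ℕ} (hw : w.Nodup) {x : ℕ} (hx : x ∈ w)
    (hz : ∃ z ∈ w, x < z) : ∃! y, (WordAdj w x y ∨ WordAdj w y x) ∧ x < y := by
  obtain ⟨u, v, huv⟩ := List.append_of_mem hx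
  have hxu : x ∉ u := by
    intro h; subst huv
    exact (List.nodup_append.1 hw).2.2 _ h x (by simp) rfl
  by_cases hA : ∃ z ∈ u, x < z
  · obtain ⟨z, hzu, hxz⟩ := hA
    obtain ⟨y, hy⟩ := IsParent.exists_of_notMem (List.ne_nil_of_mem hzu) hxu
    have hxy : x < y := by
      rcases hy with ⟨s, t, -, h, -⟩ | ⟨_, h, h'⟩
      · exact h
      · have := h' z hzu; omega
    refine ⟨y, ⟨Or.inl ⟨u, v, huv, hy⟩, hxy⟩, ?_⟩
    rintro y' ⟨⟨u', v', huv', hy'⟩ | ⟨u', v', huv', hy'⟩, hxy'⟩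
    · obtain ⟨rfl, rfl⟩ := hw.split_eq huv huv'
      exact hy'.unique hy
    · exfalso
      rcases hy' with ⟨s, t, rfl, h, -⟩ | ⟨h₁, h₂, h₃⟩
      · omega
      · rcases List.split_cases (huv.symm.trans huv') with h | ⟨m, h, -⟩ | ⟨m, h, -⟩
        · omega
        · have := h₃ z (by simp [h, hzu]); omega
        · exact hxu (by rw [h]; simp [h₁])
  · push Not at hA
    obtain ⟨z, hzw, hxz⟩ := hz
    have hzv : ∃ v₁ y v₂, v = v₁ ++ y :: v₂ ∧ x < y ∧ ∀ z ∈ v₁, z ≤ x := by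
      have hzv : z ∈ v := by
        rw [huv] at hzw
        simp only [List.mem_append, List.mem_cons] at hzw
        rcases hzw with h | h | h
        · have := hA z h; omega
        · omega
        · exact h
      clear huv
      induction v with
      | nil => simp at hzv
      | cons b v ih =>
        by_cases hb : x < b
        · exact ⟨[], b, v, rfl, hb, by simp⟩
        · have : z ∈ v := by
            rcases List.mem_cons.1 hzv with rfl | h
            · omega
            · exact h
          obtain ⟨v₁, y, v₂, rfl, h₁, h₂⟩ := ih this
          exact ⟨b :: v₁, y, v₂, rfl, h₁, by simpa using ⟨by omega, h₂⟩⟩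
    obtain ⟨v₁, y, v₂, rfl, hxy, hv₁⟩ := hzv
    have hle : ∀ z ∈ u ++ x :: v₁, z ≤ x := by
      intro z hz
      simp only [List.mem_append, List.mem_cons] at hz
      rcases hz with h | h | h
      · exact hA z h
      · omega
      · exact hv₁ z h
    refine ⟨y, ⟨Or.inr ⟨u ++ x :: v₁, v₂, by simp [huv], Or.inr ⟨by simp, hxy, hle⟩⟩, hxy⟩, ?_⟩
    rintro y' ⟨⟨u', v', huv', hy'⟩ | ⟨u', v', huv', hy'⟩, hxy'⟩
    · obtain ⟨rfl, rfl⟩ := hw.split_eq huv huv'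
      have := hA _ hy'.mem
      omega
    · rcases hy' with ⟨s, t, rfl, h, -⟩ | ⟨h₁, h₂, h₃⟩
      · omega
      · have huv₂ : w = (u ++ x :: v₁) ++ y :: v₂ := by simp [huv]
        rcases List.split_cases (huv₂.symm.trans huv') with h | ⟨m, h, -⟩ | ⟨m, h, -⟩
        · exact h.2.1.symm
        · have := h₃ y (by simp [h]); omega
        · have := hle y' (by rw [h]; simp); omega

namespace IsTreeWord

variable {G : LabelledGraph} {w : List ℕ}

/-- The decreasing subtree with list `w`. -/
def tree (h : IsTreeWord G w) : G.graph.Subgraph where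
  verts := {x | x ∈ w}
  Adj x y := WordAdj w x y ∨ WordAdj w y x
  adj_sub := by
    rintro x y (⟨u, v, h₁, h₂⟩ | ⟨u, v, h₁, h₂⟩)
    · exact h.adj u x v y h₁ h₂
    · exact (h.adj u y v x h₁ h₂).symm
  edge_vert := by
    rintro x y (h | h)
    · exact h.mem_left
    · exact h.mem_right
  symm := ⟨fun _ _ h => h.symm⟩

/-- Parents are read earlier, so following them leads back to the first letter. -/
theorem tree_connected (h : IsTreeWord G w) : h.tree.coe.Connected := by
  have key : ∀ u v, w = u ++ v → ∀ x ∈ u, ∀ (hx : x ∈ h.tree.verts)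
      (hd : w.headD 0 ∈ h.tree.verts), h.tree.coe.Reachable ⟨x, hx⟩ ⟨w.headD 0, hd⟩ := by
    intro u
    induction u using List.reverseRecOn with
    | nil => simp
    | append_singleton u a ih =>
      intro v hv x hxu hx hd
      rw [List.append_assoc] at hv
      simp only [List.mem_append, List.mem_singleton] at hxu
      rcases hxu with hxu | rfl
      · exact ih _ hv x hxu hx hd
      · by_cases hu : u = []
        · subst hu
          have : w.headD 0 = x := by simp [hv]
          simp only [this]
          exact SimpleGraph.Reachable.refl _
        · have hxu : x ∉ u := by
            intro hm
            have := h.nodup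
            rw [hv] at this
            exact (List.nodup_append.1 this).2.2 _ hm x (by simp) rfl
          obtain ⟨y, hy⟩ := IsParent.exists_of_notMem hu hxu
          have hyw : y ∈ h.tree.verts := by
            show y ∈ w
            rw [hv]; simp [hy.mem]
          refine SimpleGraph.Reachable.trans (SimpleGraph.Adj.reachable ?_)
            (ih _ hv y hy.mem hyw hd)
          show h.tree.Adj x y
          exact Or.inl ⟨u, v, by simpa using hv, hy⟩
  have hd : w.headD 0 ∈ h.tree.verts := by
    show w.headD 0 ∈ w
    have := h.ne_nil
    cases w <;> simp_all
  have : Nonempty h.tree.verts := ⟨⟨_, hd⟩⟩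
  refine SimpleGraph.Connected.mk ?_
  rintro ⟨x, hx⟩ ⟨y, hy⟩
  exact (key w [] (by simp) x hx hx hd).trans (key w [] (by simp) y hy hy hd).symm

theorem tree_isDecreasing (h : IsTreeWord G w) : G.IsDecreasingSubtree h.tree where
  subset := fun x hx => h.mem_Icc x hx
  isTree := by
    refine ⟨h.tree_connected, SimpleGraph.isAcyclic_of_larger_unique _ ?_⟩
    rintro ⟨v, hv⟩ ⟨a, ha⟩ ⟨b, hb⟩ h₁ h₂ h₃ h₄
    simp only [Subtype.mk_lt_mk] at h₃ h₄
    obtain ⟨y, -, hy⟩ := WordAdj.existsUnique_larger h.nodup hv ⟨a, ha, h₃⟩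
    simp only [Subtype.mk.injEq]
    rw [hy a ⟨h₁, h₃⟩, hy b ⟨h₂, h₄⟩]
  decreasing := fun _ hv hw => WordAdj.existsUnique_larger h.nodup hv hw

theorem ncard_tree (h : IsTreeWord G w) : h.tree.verts.ncard = w.length := by
  have : h.tree.verts = (w.toFinset : Set ℕ) := by ext; simp [tree]
  rw [this, Set.ncard_coe_finset, List.toFinset_card_of_nodup h.nodup]

theorem sInf_tree (h : IsTreeWord G w) : sInf h.tree.verts = w.headD 0 := by
  refine IsLeast.csInf_eq ⟨?_, fun x hx => h.head_le x hx⟩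
  show w.headD 0 ∈ w
  have := h.ne_nil
  cases w <;> simp_all

/-- The letter `x` after the prefix `u` is the least available one. A smaller unread `v` hanging
from a letter `y` of `u` would come later in the word, with `x > v` between `y` and `v`; so `y` is
not the last letter larger than `v`, and `v` does not exceed everything read before it. -/
theorem readVertices_tree (h : IsTreeWord G w) :
    ∀ k, k ≤ w.length → LabelledGraph.readVertices h.tree k = w.take k := by
  intro k
  induction k using LabelledGraph.readVertices.induct with
  | case1 => intro; simp [LabelledGraph.readVertices]
  | case2 =>
    intro hk
    rw [LabelledGraph.readVertices, h.sInf_tree]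
    cases w <;> simp_all
  | case3 k ih =>
    intro hk
    have ih := ih (by omega)
    rw [LabelledGraph.readVertices, ih]
    set u := w.take (k + 1) with hu
    have hlt : k + 1 < w.length := by omega
    have hw : w = u ++ w[k + 1] :: w.drop (k + 2) := by
      rw [← List.drop_eq_getElem_cons hlt, List.take_append_drop]
    have hnd := h.nodup
    rw [hw] at hnd
    obtain ⟨hndu, hndv, hdisj⟩ := List.nodup_append.1 hnd
    have hxu : w[k + 1] ∉ u := fun hm => hdisj _ hm _ List.mem_cons_self rfl
    have hune : u ≠ [] := by
      intro h0
      have : u.length = 0 := by simp [h0]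
      rw [hu, List.length_take] at this
      omega
    have : w.take (k + 2) = u ++ [w[k + 1]] := by
      rw [hu, List.take_concat_get' w (k + 1) hlt]
    rw [this]
    congr 2
    refine IsLeast.csInf_eq ⟨⟨?_, hxu, ?_⟩, ?_⟩
    · show w[k + 1] ∈ w
      simp
    · obtain ⟨y, hy⟩ := IsParent.exists_of_notMem hune hxu
      exact ⟨y, hy.mem, Or.inr ⟨_, _, hw, hy⟩⟩
    · rintro v ⟨hv, hvu, y, hyu, hyv⟩
      by_contra hlt'
      push Not at hlt'
      rcases hyv with ⟨s, t, hst, hy⟩ | ⟨s, t, hst, hy⟩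
      · rcases List.split_cases (hw.symm.trans hst) with h₁ | ⟨m, h₁, -⟩ | ⟨m, h₁, -⟩
        · exact hxu (h₁.2.1 ▸ hyu)
        · have hn := h.nodup
          rw [hst] at hn
          exact (List.nodup_append.1 hn).2.2 y (by rw [h₁]; simp [hyu]) y (by simp) rfl
        · exact hvu (by rw [h₁]; simp [hy.mem])
      · rcases List.split_cases (hw.symm.trans hst) with h₁ | ⟨m, h₁, -⟩ | ⟨m, h₁, -⟩
        · omega
        · rcases hy with ⟨s', t', hs', h₂, h₃⟩ | ⟨h₂, h₃, h₄⟩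
          · rw [h₁] at hs'
            rcases List.split_cases hs' with h₅ | ⟨m', h₅, h₆⟩ | ⟨m', h₅, h₆⟩
            · exact hxu (h₅.2.1 ▸ hyu)
            · have hn := h.nodup
              rw [hst, h₁, h₆] at hn
              simp only [List.append_assoc, List.cons_append] at hn
              exact (List.nodup_append.1 hn).2.2 y hyu y (by simp) rfl
            · have := h₃ w[k + 1] (by rw [h₆]; simp)
              omega
          · have := h₄ w[k + 1] (by rw [h₁]; simp)
            omega
        · exact hvu (by rw [h₁]; simp)

theorem treeList_tree (h : IsTreeWord G w) : LabelledGraph.treeList h.tree = w := by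
  rw [LabelledGraph.treeList, h.ncard_tree, h.readVertices_tree _ le_rfl, List.take_length]

end IsTreeWord

/-! ### From decreasing subtrees to words -/

namespace LabelledGraph

variable {G : LabelledGraph} {T : G.graph.Subgraph}

/-- The vertices of `T` that may be read after those of `u`. -/
def available (T : G.graph.Subgraph) (u : List ℕ) : Set ℕ :=
  {v | v ∈ T.verts ∧ v ∉ u ∧ ∃ y ∈ u, T.Adj y v}

/-- The words arising while reading the tree `T`. -/
inductive IsReading (T : G.graph.Subgraph) : List ℕ → Prop
  | base : IsReading T [sInf T.verts]
  | snoc {u : List ℕ} : IsReading T u → (available T u).Nonempty →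
      IsReading T (u ++ [sInf (available T u)])

namespace IsDecreasingSubtree

theorem finite_verts (hT : G.IsDecreasingSubtree T) : T.verts.Finite :=
  (Set.finite_Icc 1 G.n).subset hT.subset

theorem verts_nonempty (hT : G.IsDecreasingSubtree T) : T.verts.Nonempty :=
  Set.nonempty_coe_sort.1 hT.isTree.connected.nonempty

theorem ncard_pos (hT : G.IsDecreasingSubtree T) : 0 < T.verts.ncard :=
  (Set.ncard_pos hT.finite_verts).2 hT.verts_nonempty

/-- A path from a read vertex to an unread one crosses the boundary somewhere. -/
theorem available_nonempty (hT : G.IsDecreasingSubtree T) {u : List ℕ} (hu : u ≠ [])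
    (hsub : ∀ x ∈ u, x ∈ T.verts) (hlt : u.length < T.verts.ncard) :
    (available T u).Nonempty := by
  obtain ⟨x, hx⟩ := List.exists_mem_of_ne_nil u hu
  have : ∃ z ∈ T.verts, z ∉ u := by
    by_contra! h
    have h₁ : T.verts ⊆ (u.toFinset : Set ℕ) := fun z hz => by simpa using h z hz
    have h₂ := Set.ncard_le_ncard h₁ (Finset.finite_toSet _)
    rw [Set.ncard_coe_finset] at h₂
    have := u.toFinset_card_le
    omega
  obtain ⟨z, hz, hzu⟩ := this
  obtain ⟨p⟩ := hT.isTree.connected.preconnected ⟨x, hsub x hx⟩ ⟨z, hz⟩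
  obtain ⟨d, -, h₁, h₂⟩ := p.exists_boundary_dart {v | (v : ℕ) ∈ u} hx hzu
  exact ⟨d.snd, d.snd.2, h₂, d.fst, h₁, d.adj⟩

theorem isReading_readVertices (hT : G.IsDecreasingSubtree T) (k : ℕ)
    (hk : k + 1 ≤ T.verts.ncard) :
    IsReading T (readVertices T (k + 1)) ∧ (readVertices T (k + 1)).length = k + 1 ∧
      ∀ x ∈ readVertices T (k + 1), x ∈ T.verts := by
  induction k with
  | zero => exact ⟨.base, rfl, by simpa [readVertices] using Nat.sInf_mem hT.verts_nonempty⟩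
  | succ k ih =>
    obtain ⟨h₁, h₂, h₃⟩ := ih (by omega)
    have hne : readVertices T (k + 1) ≠ [] := by
      intro h; rw [h] at h₂; simp at h₂
    have := hT.available_nonempty hne h₃ (by omega)
    refine ⟨.snoc h₁ this, by rw [readVertices]; simp [h₂], ?_⟩
    rw [readVertices]
    intro x hx
    rcases List.mem_append.1 hx with hx | hx
    · exact h₃ x hx
    · rw [List.mem_singleton.1 hx]
      exact (Nat.sInf_mem this).1

theorem isReading_treeList (hT : G.IsDecreasingSubtree T) : IsReading T (treeList T) := by
  have := hT.ncard_pos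
  obtain ⟨k, hk⟩ : ∃ k, T.verts.ncard = k + 1 := ⟨_, (Nat.succ_pred_eq_of_pos this).symm⟩
  rw [treeList, hk]
  exact (hT.isReading_readVertices k hk.ge).1

theorem length_treeList (hT : G.IsDecreasingSubtree T) :
    (treeList T).length = T.verts.ncard := by
  have := hT.ncard_pos
  obtain ⟨k, hk⟩ : ∃ k, T.verts.ncard = k + 1 := ⟨_, (Nat.succ_pred_eq_of_pos this).symm⟩
  rw [treeList, hk]
  exact (hT.isReading_readVertices k hk.ge).2.1

end IsDecreasingSubtree

namespace IsReading

variable {u : List ℕ}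

theorem subset (hT : G.IsDecreasingSubtree T) (h : IsReading T u) : ∀ x ∈ u, x ∈ T.verts := by
  induction h with
  | base => simpa using Nat.sInf_mem hT.verts_nonempty
  | snoc h hne ih =>
    intro x hx
    rcases List.mem_append.1 hx with hx | hx
    · exact ih x hx
    · rw [List.mem_singleton.1 hx]
      exact (Nat.sInf_mem hne).1

theorem ne_nil (h : IsReading T u) : u ≠ [] := by cases h <;> simp

theorem headD_eq (h : IsReading T u) : u.headD 0 = sInf T.verts := by
  induction h with
  | base => rfl
  | @snoc v h hne ih =>
    rw [← ih]
    have := h.ne_nil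
    cases v <;> simp_all

theorem nodup (h : IsReading T u) : u.Nodup := by
  induction h with
  | base => simp
  | snoc h hne ih =>
    have := (Nat.sInf_mem hne).2.1
    simp [List.nodup_append, ih]
    rintro a ha rfl
    exact this ha

/-- Every vertex read so far, except the largest, has its larger neighbour among those read. -/
theorem larger_mem (hT : G.IsDecreasingSubtree T) (h : IsReading T u) {v : ℕ} (hv : v ∈ u) :
    (∀ z ∈ u, z ≤ v) ∨ ∃ p ∈ u, T.Adj v p ∧ v < p := by
  induction h generalizing v with
  | base => left; intro z hz; simp_all
  | @snoc u h hne ih =>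
    obtain ⟨hx, hxu, y, hyu, hyx⟩ := Nat.sInf_mem hne
    set x := sInf (available T u)
    -- If `w` already had its larger neighbour among the read vertices, uniqueness would identify it
    -- with the unread `x`.
    have hmax : ∀ w ∈ u, T.Adj w x → w < x → ∀ z ∈ u, z ≤ w := by
      intro w hw hwx hlt
      rcases ih hw with h | ⟨p, hp, h₁, h₂⟩
      · exact h
      · obtain ⟨q, -, hq⟩ := hT.decreasing w (h.subset hT w hw) ⟨x, hx, hlt⟩
        have h₃ := hq p ⟨h₁, h₂⟩
        have h₄ := hq x ⟨hwx, hlt⟩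
        exact absurd (h₄.trans h₃.symm ▸ hp) hxu
    rcases lt_or_gt_of_ne hyx.ne with hlt | hlt
    · have := hmax y hyu hyx hlt
      rcases List.mem_append.1 hv with hv | hv
      · rcases ih hv with h' | ⟨p, hp, h₁, h₂⟩
        · have : v = y := le_antisymm (this v hv) (h' y hyu)
          exact Or.inr ⟨x, by simp, this ▸ hyx, this ▸ hlt⟩
        · exact Or.inr ⟨p, by simp [hp], h₁, h₂⟩
      · left
        intro z hz
        rw [List.mem_singleton.1 hv]
        rcases List.mem_append.1 hz with hz | hz
        · exact (this z hz).trans hlt.le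
        · rw [List.mem_singleton.1 hz]
    · rcases List.mem_append.1 hv with hv | hv
      · rcases ih hv with h' | ⟨p, hp, h₁, h₂⟩
        · left
          intro z hz
          rcases List.mem_append.1 hz with hz | hz
          · exact h' z hz
          · rw [List.mem_singleton.1 hz]
            have := h' y hyu
            omega
        · exact Or.inr ⟨p, by simp [hp], h₁, h₂⟩
      · rw [List.mem_singleton.1 hv]
        exact Or.inr ⟨y, by simp [hyu], hyx.symm, hlt⟩

/-- An unread vertex adjacent to `y` is larger than everything read after `y`. -/
theorem lt_of_adj (h : IsReading T u) {s t : List ℕ} {y v z : ℕ}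
    (hu : u = s ++ y :: t) (hv : v ∉ u) (hyv : T.Adj y v) (hz : z ∈ t) : z < v := by
  induction h generalizing s t with
  | base =>
    cases s with
    | nil => simp only [List.nil_append, List.cons.injEq] at hu; simp [← hu.2] at hz
    | cons a s => simp at hu
  | @snoc u h hne ih =>
    rcases List.eq_nil_or_concat t with rfl | ⟨t, x, rfl⟩
    · simp at hz
    · rw [List.concat_eq_append, ← List.cons_append, ← List.append_assoc] at hu
      obtain ⟨h₁, h₂⟩ := List.append_inj' hu rfl
      simp only [List.mem_append, List.mem_singleton, not_or] at hv
      rw [List.concat_eq_append] at hz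
      rcases List.mem_append.1 hz with hz | hz
      · exact ih h₁ hv.1 hz
      · rw [List.mem_singleton.1 hz]
        simp only [List.cons.injEq, and_true] at h₂
        rw [← h₂]
        have : v ∈ available T u := ⟨T.edge_vert hyv.symm, hv.1, y, by simp [h₁], hyv⟩
        exact lt_of_le_of_ne (Nat.sInf_le this) (fun h => hv.2 h.symm)

/-- Let `y` be a read neighbour of `x`. If `x < y`, then `x` was available ever since `y` was read,
so all letters in between are smaller than `x` (`lt_of_adj`). If `y < x`, then `x` is the larger
neighbour of `y`, which was thus still missing, and `larger_mem` makes `y` the maximum. -/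
theorem isParent (hT : G.IsDecreasingSubtree T) (h : IsReading T u) {s t : List ℕ} {x : ℕ}
    (hu : u = s ++ x :: t) (hs : s ≠ []) :
    (∃ y ∈ s, T.Adj x y) ∧ ∀ y ∈ s, T.Adj x y → IsParent s x y := by
  induction h generalizing t with
  | base =>
    cases s with
    | nil => exact absurd rfl hs
    | cons a s => simp at hu
  | @snoc u h hne ih =>
    rcases List.eq_nil_or_concat t with rfl | ⟨t, b, rfl⟩
    · obtain ⟨h₁, h₂⟩ := List.append_inj' hu rfl
      subst h₁
      simp only [List.cons.injEq, and_true] at h₂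
      obtain ⟨hx, hxu, y, hyu, hyx⟩ := Nat.sInf_mem hne
      rw [h₂] at hx hxu hyx
      refine ⟨⟨y, hyu, hyx.symm⟩, ?_⟩
      intro y hy hxy
      rcases lt_or_gt_of_ne hxy.ne with hlt | hlt
      · obtain ⟨s, t, hst⟩ := List.append_of_mem hy
        exact Or.inl ⟨s, t, hst, hlt, fun z hz => h.lt_of_adj hst hxu hxy.symm hz⟩
      · refine Or.inr ⟨hy, hlt, ?_⟩
        rcases h.larger_mem hT hy with h' | ⟨p, hp, h₃, h₄⟩
        · exact h'
        · obtain ⟨q, -, hq⟩ := hT.decreasing y (h.subset hT y hy) ⟨x, hx, hlt⟩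
          have h₅ := hq p ⟨h₃, h₄⟩
          have h₆ := hq x ⟨hxy.symm, hlt⟩
          exact absurd (h₆.trans h₅.symm ▸ hp) hxu
    · rw [List.concat_eq_append, ← List.cons_append, ← List.append_assoc] at hu
      exact ih (List.append_inj' hu rfl).1

end IsReading

namespace IsDecreasingSubtree

theorem mem_treeList (hT : G.IsDecreasingSubtree T) {x : ℕ} : x ∈ treeList T ↔ x ∈ T.verts := by
  have h := hT.isReading_treeList
  have hsub : ((treeList T).toFinset : Set ℕ) ⊆ T.verts := fun x hx =>
    h.subset hT x (by simpa using hx)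
  have := Set.eq_of_subset_of_ncard_le hsub (by
    rw [Set.ncard_coe_finset, List.toFinset_card_of_nodup h.nodup, hT.length_treeList])
    hT.finite_verts
  rw [← this]; simp

theorem adj_iff (hT : G.IsDecreasingSubtree T) {x y : ℕ} :
    T.Adj x y ↔ WordAdj (treeList T) x y ∨ WordAdj (treeList T) y x := by
  have h := hT.isReading_treeList
  have hadj : ∀ {x y}, WordAdj (treeList T) x y → T.Adj x y := by
    rintro x y ⟨u, v, h₁, h₂⟩
    obtain ⟨⟨y', h₃, h₄⟩, h₅⟩ := h.isParent hT h₁ (List.ne_nil_of_mem h₂.mem)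
    rw [h₂.unique (h₅ y' h₃ h₄)]
    exact h₄
  constructor
  · intro hxy
    have hx := hT.mem_treeList.2 (T.edge_vert hxy)
    have hy := hT.mem_treeList.2 (T.edge_vert hxy.symm)
    obtain ⟨s, t, hst⟩ := List.append_of_mem hx
    rw [hst] at hy
    simp only [List.mem_append, List.mem_cons] at hy
    rcases hy with hy | hy | hy
    · exact Or.inl ⟨s, t, hst, (h.isParent hT hst (List.ne_nil_of_mem hy)).2 y hy hxy⟩
    · exact absurd hy.symm hxy.ne
    · obtain ⟨t₁, t₂, rfl⟩ := List.append_of_mem hy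
      refine Or.inr ⟨s ++ x :: t₁, t₂, by simp [hst],
        (h.isParent hT (t := t₂) (by simp [hst]) (by simp)).2 x (by simp) hxy.symm⟩
  · rintro (h | h)
    · exact hadj h
    · exact (hadj h).symm

theorem isTreeWord_treeList (hT : G.IsDecreasingSubtree T) : IsTreeWord G (treeList T) where
  ne_nil := hT.isReading_treeList.ne_nil
  nodup := hT.isReading_treeList.nodup
  mem_Icc := fun x hx => hT.subset (hT.mem_treeList.1 hx)
  head_le := fun x hx => by
    rw [hT.isReading_treeList.headD_eq]
    exact Nat.sInf_le (hT.mem_treeList.1 hx)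
  adj := fun u x v y h₁ h₂ => T.adj_sub (hT.adj_iff.2 (Or.inl ⟨u, v, h₁, h₂⟩))

theorem treeList_injective {T' : G.graph.Subgraph} (hT : G.IsDecreasingSubtree T)
    (hT' : G.IsDecreasingSubtree T') (h : treeList T = treeList T') : T = T' := by
  refine SimpleGraph.Subgraph.ext ?_ ?_
  · ext x; rw [← hT.mem_treeList, ← hT'.mem_treeList, h]
  · ext x y; rw [hT.adj_iff, hT'.adj_iff, h]

end IsDecreasingSubtree

end LabelledGraph

/-! ### Forest triples as lists of blocks -/

/-- A tree triple recorded by the list of its tree, its composition and its integer `r`. -/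
@[ext]
structure Block where
  word : List ℕ
  comp : List ℕ
  r : ℕ

namespace Block

/-- `C` encodes a tree triple of `G`. -/
structure IsValid (G : LabelledGraph) (C : Block) : Prop where
  isTreeWord : IsTreeWord G C.word
  comp_pos : ∀ p ∈ C.comp, 1 ≤ p
  comp_sum : C.comp.sum = C.word.length
  one_le_r : 1 ≤ C.r
  r_le : C.r ≤ C.comp.headD 0

/-- The tree triple encoded by a block. -/
def toTriple {G : LabelledGraph} (C : Block) (h : C.IsValid G) : TreeTriple G where
  tree := h.isTreeWord.tree
  isDecreasing := h.isTreeWord.tree_isDecreasing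
  comp := C.comp
  comp_pos := h.comp_pos
  comp_sum := by rw [h.comp_sum, h.isTreeWord.ncard_tree]
  r := C.r
  one_le_r := h.one_le_r
  r_le := h.r_le

end Block

namespace TreeTriple

variable {G : LabelledGraph}

/-- The block of a tree triple. -/
noncomputable def toBlock (S : TreeTriple G) : Block := ⟨S.list, S.comp, S.r⟩

theorem isValid_toBlock (S : TreeTriple G) : S.toBlock.IsValid G where
  isTreeWord := S.isDecreasing.isTreeWord_treeList
  comp_pos := S.comp_pos
  comp_sum := by rw [toBlock, S.comp_sum]; exact S.isDecreasing.length_treeList.symm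
  one_le_r := S.one_le_r
  r_le := S.r_le

theorem mem_list (S : TreeTriple G) {v : ℕ} : v ∈ S.list ↔ v ∈ S.verts :=
  S.isDecreasing.mem_treeList

theorem headD_list (S : TreeTriple G) : S.list.headD 0 = sInf S.verts :=
  S.isDecreasing.isReading_treeList.headD_eq

theorem toBlock_injective : Function.Injective (toBlock (G := G)) := by
  rintro ⟨T, hT, α, h₁, h₂, r, h₃, h₄⟩ ⟨T', hT', α', h₁', h₂', r', h₃', h₄'⟩ h
  simp only [toBlock, Block.mk.injEq] at h
  obtain ⟨h, rfl, rfl⟩ := h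
  obtain rfl := hT.treeList_injective hT' h
  rfl

theorem toBlock_toTriple (C : Block) (h : C.IsValid G) : (C.toTriple h).toBlock = C := by
  have : (C.toTriple h).list = C.word := h.isTreeWord.treeList_tree
  rw [toBlock, this]; rfl

end TreeTriple

/-- The list of blocks `L` encodes a forest triple of `G`. -/
structure IsForest (G : LabelledGraph) (L : List Block) : Prop where
  isValid : ∀ C ∈ L, C.IsValid G
  nodup : (L.flatMap Block.word).Nodup
  mem_iff : ∀ v, v ∈ L.flatMap Block.word ↔ v ∈ Set.Icc 1 G.n
  heads : L.Pairwise fun C D => C.word.headD 0 < D.word.headD 0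

theorem List.Pairwise.rel_of_ne {α : Type*} {R : α → α → Prop} (hR : ∀ a b, R a b → R b a)
    {l : List α} (h : l.Pairwise R) {a b : α} (ha : a ∈ l) (hb : b ∈ l) (hab : a ≠ b) : R a b := by
  induction l with
  | nil => simp at ha
  | cons c l ih =>
    rw [List.pairwise_cons] at h
    rcases List.mem_cons.1 ha with ha | ha <;> rcases List.mem_cons.1 hb with hb | hb
    · exact absurd (ha.trans hb.symm) hab
    · exact ha ▸ h.1 b hb
    · exact hR _ _ (hb ▸ h.1 a ha)
    · exact ih h.2 ha hb

theorem List.Nodup.eq_of_mem_flatMap {α β : Type*} {f : α → List β} {l : List α}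
    (h : (l.flatMap f).Nodup) {a b : α} (ha : a ∈ l) (hb : b ∈ l) {v : β} (hva : v ∈ f a)
    (hvb : v ∈ f b) : a = b := by
  by_contra hab
  exact (List.nodup_flatMap.1 h).2.rel_of_ne (fun _ _ h => h.symm) ha hb hab hva hvb

namespace ForestTriple

variable {G : LabelledGraph}

/-- The blocks of a forest triple. -/
noncomputable def blocks (F : ForestTriple G) : List Block := F.triples.map TreeTriple.toBlock

theorem blocks_injective : Function.Injective (blocks (G := G)) := by
  rintro ⟨l, h₁, h₂⟩ ⟨l', h₁', h₂'⟩ h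
  obtain rfl : l = l' := List.map_injective_iff.2 TreeTriple.toBlock_injective h
  rfl

theorem isForest_blocks (F : ForestTriple G) : IsForest G F.blocks where
  isValid := by
    intro C hC
    obtain ⟨S, -, rfl⟩ := List.mem_map.1 hC
    exact S.isValid_toBlock
  nodup := by
    rw [List.nodup_flatMap]
    refine ⟨?_, ?_⟩
    · intro C hC
      obtain ⟨S, -, rfl⟩ := List.mem_map.1 hC
      exact S.isValid_toBlock.isTreeWord.nodup
    · rw [blocks, List.pairwise_map]
      refine List.Pairwise.imp_of_mem ?_ F.increasing
      intro S S' hS hS' hlt v hv hv'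
      have hv : v ∈ S.verts := S.mem_list.1 hv
      have hv' : v ∈ S'.verts := S'.mem_list.1 hv'
      have := (F.cover v (S.isDecreasing.subset hv)).unique ⟨hS, hv⟩ ⟨hS', hv'⟩
      rw [this] at hlt
      exact lt_irrefl _ hlt
  mem_iff := by
    intro v
    simp only [blocks, List.mem_flatMap, List.mem_map, exists_exists_and_eq_and]
    constructor
    · rintro ⟨S, hS, hv⟩
      exact S.isDecreasing.subset (S.mem_list.1 hv)
    · intro hv
      obtain ⟨S, ⟨hS, hv⟩, -⟩ := F.cover v hv
      exact ⟨S, hS, S.mem_list.2 hv⟩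
  heads := by
    rw [blocks, List.pairwise_map]
    refine F.increasing.imp ?_
    intro S S' h
    show S.list.headD 0 < S'.list.headD 0
    rwa [S.headD_list, S'.headD_list]

theorem exists_blocks_eq {L : List Block} (h : IsForest G L) :
    ∃ F : ForestTriple G, F.blocks = L := by
  have hmap : (L.pmap Block.toTriple h.isValid).map TreeTriple.toBlock = L := by
    rw [List.map_pmap]
    simp only [TreeTriple.toBlock_toTriple]
    simp
  set l := L.pmap Block.toTriple h.isValid
  refine ⟨⟨l, ?_, ?_⟩, hmap⟩
  · intro v hv
    obtain ⟨C, hC, hvC⟩ := List.mem_flatMap.1 ((h.mem_iff v).2 hv)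
    rw [← hmap] at hC
    obtain ⟨S, hS, rfl⟩ := List.mem_map.1 hC
    refine ⟨S, ⟨hS, S.mem_list.1 hvC⟩, ?_⟩
    rintro S' ⟨hS', hv'⟩
    have hn := h.nodup
    rw [← hmap, List.flatMap_map] at hn
    exact hn.eq_of_mem_flatMap hS' hS (S'.mem_list.2 hv') hvC
  · have := h.heads
    rw [← hmap, List.pairwise_map] at this
    refine this.imp ?_
    intro S S' h
    rw [← S.headD_list, ← S'.headD_list]
    exact h

end ForestTriple

/-! ### Inversions, recursively -/

namespace LabelledGraph

open Classical in
/-- The number of `G`-inversions, computed recursively. -/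
noncomputable def invCount (G : LabelledGraph) : List ℕ → ℕ
  | [] => 0
  | x :: l => l.countP (fun y => y < x ∧ G.graph.Adj y x) + invCount G l

open Classical in
theorem _root_.List.countP_eq_ncard {α : Type*} (p : α → Prop) (l : List α) :
    l.countP (fun x => p x) = {j : Fin l.length | p (l.get j)}.ncard := by
  induction l with
  | nil => simp [Set.ncard_eq_toFinset_card']
  | cons x l ih =>
    rw [List.countP_cons, ih]
    have h : {j : Fin (x :: l).length | p ((x :: l).get j)} =
        (Fin.succ '' {j : Fin l.length | p (l.get j)}) ∪
          (if p x then {(0 : Fin (l.length + 1))} else ∅) := by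
      ext j
      refine Fin.cases ?_ (fun j => ?_) j
      · by_cases hp : p x <;> simp [hp, Fin.succ_ne_zero]
      · by_cases hp : p x <;> simp [hp, Fin.succ_ne_zero]
    rw [h, Set.ncard_union_eq, Set.ncard_image_of_injective _ (Fin.succ_injective _)]
    · by_cases hp : p x <;> simp [hp]
    · by_cases hp : p x <;> simp [hp, Fin.succ_ne_zero]

theorem inv_eq_invCount (G : LabelledGraph) (σ : List ℕ) : G.inv σ = G.invCount σ := by
  classical
  induction σ with
  | nil => simp [inv, invCount, Set.ncard_eq_toFinset_card']
  | cons x l ih =>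
    have hc : l.countP (fun y => y < x ∧ G.graph.Adj y x) =
        {j : Fin l.length | l.get j < x ∧ G.graph.Adj (l.get j) x}.ncard := by
      rw [← List.countP_eq_ncard (fun y => y < x ∧ G.graph.Adj y x)]
      exact List.countP_congr (by simp)
    have hi : G.invCount (x :: l) = l.countP (fun y => y < x ∧ G.graph.Adj y x) + G.inv l := by
      rw [invCount, ih]
    rw [hi, hc, inv, inv]
    have h : {p : Fin (x :: l).length × Fin (x :: l).length |
        p.1 < p.2 ∧ (x :: l).get p.2 < (x :: l).get p.1 ∧
          G.graph.Adj ((x :: l).get p.2) ((x :: l).get p.1)} =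
        ((fun j : Fin l.length => ((0 : Fin (l.length + 1)), j.succ)) ''
          {j : Fin l.length | l.get j < x ∧ G.graph.Adj (l.get j) x}) ∪
        (Prod.map Fin.succ Fin.succ '' {p : Fin l.length × Fin l.length |
          p.1 < p.2 ∧ l.get p.2 < l.get p.1 ∧ G.graph.Adj (l.get p.2) (l.get p.1)}) := by
      ext ⟨i, j⟩
      refine Fin.cases ?_ (fun i => ?_) i <;> refine Fin.cases ?_ (fun j => ?_) j
      · simp
      · simp [Fin.succ_ne_zero]
      · simp [Fin.succ_ne_zero]
      · simp [Prod.ext_iff, (Fin.succ_ne_zero _).symm]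
    rw [h, Set.ncard_union_eq, Set.ncard_image_of_injective, Set.ncard_image_of_injective]
    · exact (Fin.succ_injective _).prodMap (Fin.succ_injective _)
    · intro i j h
      simpa using h
    · rw [Set.disjoint_left]
      rintro _ ⟨j, -, rfl⟩ ⟨⟨i, k⟩, -, h⟩
      simp [Prod.ext_iff, Fin.succ_ne_zero] at h

end LabelledGraph

/-! ### Tree words in a sum of graphs -/

theorem List.append_eq_append_cons {α : Type*} {u w s t : List α} {x : α}
    (h : u ++ w = s ++ x :: t) :
    (∃ m, u = s ++ x :: m ∧ t = m ++ w) ∨ (∃ m, s = u ++ m ∧ w = m ++ x :: t) := by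
  rcases List.append_eq_append_iff.1 h with ⟨m, h₁, h₂⟩ | ⟨m, h₁, h₂⟩
  · exact Or.inr ⟨m, h₁, h₂⟩
  · cases m with
    | nil => exact Or.inr ⟨[], by simpa using h₁.symm, by simpa using h₂.symm⟩
    | cons c m =>
      simp only [List.cons_append, List.cons.injEq] at h₂
      exact Or.inl ⟨m, by rw [h₁, h₂.1], h₂.2⟩

namespace IsParent

variable {u v : List ℕ} {x y z a : ℕ}

theorem map_add (h : IsParent u y z) (x : ℕ) : IsParent (u.map (· + x)) (y + x) (z + x) := by
  rcases h with ⟨s, t, rfl, h, ht⟩ | ⟨h₁, h₂, h₃⟩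
  · refine Or.inl ⟨s.map (· + x), t.map (· + x), by simp, by omega, ?_⟩
    simpa using ht
  · refine Or.inr ⟨by simpa using h₁, by omega, ?_⟩
    simpa using h₃

theorem of_map_add (h : IsParent (u.map (· + x)) (y + x) z) :
    ∃ z', z = z' + x ∧ IsParent u y z' := by
  obtain ⟨z', hz', rfl⟩ := List.mem_map.1 h.mem
  refine ⟨z', rfl, ?_⟩
  rcases h with ⟨s, t, hst, h, ht⟩ | ⟨h₁, h₂, h₃⟩
  · obtain ⟨s', t', rfl, rfl, hst'⟩ := List.map_eq_append_iff.1 hst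
    obtain ⟨c, t, rfl, hc, rfl⟩ := List.map_eq_cons_iff.1 hst'
    obtain rfl : c = z' := by omega
    refine Or.inl ⟨s', t, rfl, by omega, ?_⟩
    simpa using ht
  · refine Or.inr ⟨hz', by omega, ?_⟩
    simpa using h₃

/-- For a letter above `a`, a prefix with maximum `a` behaves like the single letter `a`. This lets
the part of a word beyond the glueing vertex be read as a word of the second graph. -/
theorem append_of_cons (hu : ∀ z ∈ u, z ≤ a) (ha : a ∈ u) (hy : a < y)
    (h : IsParent (a :: v) y z) : IsParent (u ++ v) y z := by
  rcases h with ⟨s, t, hst, h, ht⟩ | ⟨h₁, h₂, h₃⟩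
  · cases s with
    | nil => simp only [List.nil_append, List.cons.injEq] at hst; omega
    | cons b s =>
      simp only [List.cons_append, List.cons.injEq] at hst
      exact Or.inl ⟨u ++ s, t, by simp [hst.2], h, ht⟩
  · refine Or.inr ⟨?_, h₂, ?_⟩
    · rcases List.mem_cons.1 h₁ with rfl | h
      · simp [ha]
      · simp [h]
    · intro b hb
      rcases List.mem_append.1 hb with hb | hb
      · exact (hu b hb).trans (h₃ a (by simp))
      · exact h₃ b (by simp [hb])

/-- Follows from the converse, since parents exist and are unique. -/
theorem cons_of_append (hu : ∀ z ∈ u, z ≤ a) (ha : a ∈ u) (hy : a < y) (hyv : y ∉ v)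
    (h : IsParent (u ++ v) y z) : IsParent (a :: v) y z := by
  obtain ⟨z', hz'⟩ := exists_of_notMem (u := a :: v) (x := y) (by simp) (by simp [hyv]; omega)
  rw [h.unique (hz'.append_of_cons hu ha hy)]
  exact hz'

end IsParent

namespace LabelledGraph

variable {G₁ G₂ : LabelledGraph}

theorem sum_adj_left {y z : ℕ} (hy : y ≤ G₁.n) (hz : z ≤ G₁.n) :
    (G₁.sum G₂).graph.Adj y z ↔ G₁.graph.Adj y z := by
  refine ⟨?_, Or.inl⟩
  rintro (h | ⟨i, j, h, rfl, rfl⟩)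
  · exact h
  · have h₁ := G₂.mem_of_adj _ _ h
    have h₂ := G₂.mem_of_adj _ _ h.symm
    have h₃ := G₁.pos
    simp only [Set.mem_Icc] at h₁ h₂
    exact absurd rfl ((show i = j by omega) ▸ h.ne)

theorem sum_adj_right {i j : ℕ} (hi : 1 ≤ i) (hj : 1 ≤ j) :
    (G₁.sum G₂).graph.Adj (i + (G₁.n - 1)) (j + (G₁.n - 1)) ↔ G₂.graph.Adj i j := by
  have h₃ := G₁.pos
  constructor
  · rintro (h | ⟨i', j', h, h₁, h₂⟩)
    · have h₁ := G₁.mem_of_adj _ _ h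
      have h₂ := G₁.mem_of_adj _ _ h.symm
      simp only [Set.mem_Icc] at h₁ h₂
      exact absurd rfl ((show i = j by omega) ▸ h.ne)
    · rwa [show i = i' by omega, show j = j' by omega]
  · intro h
    exact Or.inr ⟨i, j, h, by omega, by omega⟩

theorem not_sum_adj {y z : ℕ} (hy : y < G₁.n) (hz : G₁.n < z) :
    ¬ (G₁.sum G₂).graph.Adj y z := by
  rintro (h | ⟨i, j, h, rfl, rfl⟩)
  · have h₂ := G₁.mem_of_adj _ _ h.symm
    simp only [Set.mem_Icc] at h₂
    omega
  · have h₁ := G₂.mem_of_adj _ _ h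
    simp only [Set.mem_Icc] at h₁
    omega

theorem sum_n : (G₁.sum G₂).n = G₁.n + G₂.n - 1 := rfl

end LabelledGraph

namespace IsTreeWord

variable {G₁ G₂ : LabelledGraph} {u w v : List ℕ}

theorem headD_mem {G : LabelledGraph} (h : IsTreeWord G w) : w.headD 0 ∈ w := by
  have := h.ne_nil
  cases w <;> simp_all

theorem sum_left (h : IsTreeWord G₁ u) : IsTreeWord (G₁.sum G₂) u where
  ne_nil := h.ne_nil
  nodup := h.nodup
  mem_Icc := fun x hx => by
    have h₁ := h.mem_Icc x hx
    have := G₂.pos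
    simp only [Set.mem_Icc, LabelledGraph.sum_n] at h₁ ⊢
    omega
  head_le := h.head_le
  adj := fun _ _ _ _ h₁ h₂ => Or.inl (h.adj _ _ _ _ h₁ h₂)

theorem of_sum_left (h : IsTreeWord (G₁.sum G₂) u) (hu : ∀ z ∈ u, z ≤ G₁.n) :
    IsTreeWord G₁ u where
  ne_nil := h.ne_nil
  nodup := h.nodup
  mem_Icc := fun x hx => ⟨(h.mem_Icc x hx).1, hu x hx⟩
  head_le := h.head_le
  adj := fun s x t y h₁ h₂ => by
    refine (LabelledGraph.sum_adj_left (hu _ (by simp [h₁])) (hu _ ?_)).1 (h.adj s x t y h₁ h₂)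
    simp [h₁, h₂.mem]

theorem sum_right (h : IsTreeWord G₂ w) :
    IsTreeWord (G₁.sum G₂) (w.map (· + (G₁.n - 1))) where
  ne_nil := by simpa using h.ne_nil
  nodup := h.nodup.map (add_left_injective _)
  mem_Icc := by
    intro x hx
    obtain ⟨y, hy, rfl⟩ := List.mem_map.1 hx
    have h₁ := h.mem_Icc y hy
    have := G₁.pos
    simp only [Set.mem_Icc, LabelledGraph.sum_n] at h₁ ⊢
    omega
  head_le := by
    intro x hx
    obtain ⟨y, hy, rfl⟩ := List.mem_map.1 hx
    have := h.head_le y hy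
    cases w <;> simp_all
  adj := by
    intro s x t y h₁ h₂
    obtain ⟨s', t', rfl, rfl, h₃⟩ := List.map_eq_append_iff.1 h₁
    obtain ⟨c, t, rfl, rfl, rfl⟩ := List.map_eq_cons_iff.1 h₃
    obtain ⟨y, rfl, h₄⟩ := h₂.of_map_add
    exact (LabelledGraph.sum_adj_right (h.mem_Icc _ (by simp)).1
      (h.mem_Icc _ (by simp [h₄.mem])).1).2 (h.adj s' c t y rfl h₄)

theorem of_sum_right (h : IsTreeWord (G₁.sum G₂) (w.map (· + (G₁.n - 1))))
    (hw : ∀ z ∈ w, 1 ≤ z) : IsTreeWord G₂ w where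
  ne_nil := by simpa using h.ne_nil
  nodup := h.nodup.of_map
  mem_Icc := by
    intro x hx
    have h₁ := h.mem_Icc _ (List.mem_map_of_mem hx)
    have := G₁.pos
    have := hw x hx
    simp only [Set.mem_Icc, LabelledGraph.sum_n] at h₁ ⊢
    omega
  head_le := by
    intro x hx
    have := h.head_le _ (List.mem_map_of_mem hx)
    cases w <;> simp_all
  adj := by
    rintro s x t y rfl h₂
    refine (LabelledGraph.sum_adj_right (hw _ (by simp)) (hw _ (by simp [h₂.mem]))).1
      (h.adj (s.map (· + (G₁.n - 1))) _ (t.map (· + (G₁.n - 1))) _ (by simp) (h₂.map_add _))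

theorem sum_append (hu : IsTreeWord G₁ u) (hn : G₁.n ∈ u) (hw : IsTreeWord G₂ (1 :: w)) :
    IsTreeWord (G₁.sum G₂) (u ++ w.map (· + (G₁.n - 1))) := by
  have hpos := G₁.pos
  have hw2 : ∀ z ∈ w, 2 ≤ z := by
    intro z hz
    have h₁ := (hw.mem_Icc z (by simp [hz])).1
    have h₂ := (List.nodup_cons.1 hw.nodup).1
    have : z ≠ 1 := fun h => h₂ (h ▸ hz)
    omega
  refine ⟨by simp [hu.ne_nil], ?_, ?_, ?_, ?_⟩
  · refine List.nodup_append.2 ⟨hu.nodup,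
      (List.nodup_cons.1 hw.nodup).2.map (add_left_injective _), ?_⟩
    intro y hy z hz
    obtain ⟨z, hz', rfl⟩ := List.mem_map.1 hz
    have h₁ := (hu.mem_Icc y hy).2
    have := hw2 z hz'
    omega
  · intro x hx
    rcases List.mem_append.1 hx with hx | hx
    · exact (hu.sum_left (G₂ := G₂)).mem_Icc x hx
    · exact (hw.sum_right (G₁ := G₁)).mem_Icc x (by
        rw [List.map_cons]; exact List.mem_cons_of_mem _ hx)
  · intro x hx
    have hne := hu.ne_nil
    have hd : (u ++ w.map (· + (G₁.n - 1))).headD 0 = u.headD 0 := by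
      cases u <;> simp_all
    rw [hd]
    rcases List.mem_append.1 hx with hx | hx
    · exact hu.head_le x hx
    · obtain ⟨z, hz, rfl⟩ := List.mem_map.1 hx
      have := hu.head_le _ hn
      have := hw2 z hz
      omega
  · intro s x t y h₁ h₂
    rcases List.append_eq_append_cons h₁ with ⟨m, h₃, -⟩ | ⟨m, rfl, h₃⟩
    · exact Or.inl (hu.adj s x m y h₃ h₂)
    · obtain ⟨m', t', rfl, rfl, h₅⟩ := List.map_eq_append_iff.1 h₃
      obtain ⟨c, t, rfl, rfl, rfl⟩ := List.map_eq_cons_iff.1 h₅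
      have hc := hw2 c (by simp)
      have hnd := hw.nodup
      have h₆ := h₂.cons_of_append (a := G₁.n) (fun z hz => (hu.mem_Icc z hz).2) hn (by omega) (by
        simp only [List.mem_map, not_exists, not_and]
        intro z hz hzc
        have : z = c := by omega
        subst this
        simp only [List.nodup_cons, List.nodup_append] at hnd
        exact hnd.2.2.2 z hz z (by simp) rfl)
      have h₇ : IsParent ((1 :: m').map (· + (G₁.n - 1))) (c + (G₁.n - 1)) y := by
        rw [List.map_cons]
        rwa [show 1 + (G₁.n - 1) = G₁.n by omega]
      obtain ⟨y, rfl, h₈⟩ := h₇.of_map_add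
      refine (LabelledGraph.sum_adj_right (by omega) (hw.mem_Icc y ?_).1).2
        (hw.adj (1 :: m') c t y (by simp) h₈)
      have := h₈.mem
      simp only [List.mem_cons] at this ⊢
      simp only [List.mem_append]
      tauto

theorem of_sum_append_left (h : IsTreeWord (G₁.sum G₂) (u ++ v)) (hu : ∀ z ∈ u, z ≤ G₁.n)
    (hne : u ≠ []) : IsTreeWord G₁ u := by
  refine IsTreeWord.of_sum_left (G₂ := G₂) ⟨hne, (List.nodup_append.1 h.nodup).1,
    fun x hx => h.mem_Icc x (by simp [hx]), ?_, ?_⟩ hu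
  · intro x hx
    have := h.head_le x (by simp [hx])
    cases u <;> simp_all
  · intro s x t y h₁ h₂
    exact h.adj s x (t ++ v) y (by simp [h₁]) h₂

theorem of_sum_append_right (h : IsTreeWord (G₁.sum G₂) (u ++ w.map (· + (G₁.n - 1))))
    (hu : ∀ z ∈ u, z ≤ G₁.n) (hn : G₁.n ∈ u) (hw : ∀ z ∈ w, 2 ≤ z) : IsTreeWord G₂ (1 :: w) := by
  have hpos := G₁.pos
  have hle : ∀ x ∈ 1 :: w, 1 ≤ x := by
    intro x hx
    rcases List.mem_cons.1 hx with rfl | hx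
    · exact le_rfl
    · have := hw x hx; omega
  refine ⟨by simp, ?_, ?_, by simpa using hle, ?_⟩
  · refine List.nodup_cons.2 ⟨fun h => ?_, (List.nodup_append.1 h.nodup).2.1.of_map⟩
    have := hw 1 h
    omega
  · intro x hx
    have h₂ := G₂.pos
    rcases List.mem_cons.1 hx with rfl | hx
    · exact ⟨le_rfl, h₂⟩
    · have h₁ := h.mem_Icc (x + (G₁.n - 1))
        (List.mem_append_right _ (List.mem_map.2 ⟨x, hx, rfl⟩))
      have := hw x hx
      simp only [Set.mem_Icc, LabelledGraph.sum_n] at h₁ ⊢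
      omega
  · intro s x t y h₁ h₂
    cases s with
    | nil => simpa using h₂.mem
    | cons b s =>
      simp only [List.cons_append, List.cons.injEq] at h₁
      obtain ⟨rfl, rfl⟩ := h₁
      refine (LabelledGraph.sum_adj_right (G₁ := G₁) (hle x (by simp)) (hle y ?_)).1 ?_
      · have := h₂.mem
        simp only [List.mem_cons] at this ⊢
        simp only [List.mem_append]
        tauto
      · refine h.adj (u ++ s.map (· + (G₁.n - 1))) _ (t.map (· + (G₁.n - 1))) _ (by simp) ?_
        have h₃ := h₂.map_add (G₁.n - 1)
        rw [List.map_cons, show 1 + (G₁.n - 1) = G₁.n by omega] at h₃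
        refine h₃.append_of_cons hu hn ?_
        have := hw x (by simp)
        omega

/-- The word of a tree of a sum of graphs: the tree avoids the glueing vertex and lies on one side,
or the vertices of the first summand are read before the others. -/
theorem sum_cases (h : IsTreeWord (G₁.sum G₂) v) :
    (∀ z ∈ v, z < G₁.n) ∨ (∀ z ∈ v, G₁.n < z) ∨
      ∃ u w : List ℕ, v = u ++ w.map (· + (G₁.n - 1)) ∧ (∀ z ∈ u, z ≤ G₁.n) ∧ G₁.n ∈ u ∧
        ∀ z ∈ w, 2 ≤ z := by
  have hpos := G₁.pos
  have key : ∀ s t, v = s ++ t → (∀ z ∈ s, z < G₁.n) ∨ (∀ z ∈ s, G₁.n < z) ∨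
      ∃ u w : List ℕ, s = u ++ w.map (· + (G₁.n - 1)) ∧ (∀ z ∈ u, z ≤ G₁.n) ∧ G₁.n ∈ u ∧
        ∀ z ∈ w, 2 ≤ z := by
    intro s
    induction s using List.reverseRecOn with
    | nil => simp
    | append_singleton s x ih =>
      intro t hst
      have hst' : v = s ++ x :: t := by simpa using hst
      by_cases hs : s = []
      · subst hs
        rcases lt_trichotomy x G₁.n with hx | hx | hx
        · left; simpa using hx
        · right; right
          exact ⟨[x], [], by simp, by simp [hx], by simp [hx], by simp⟩
        · right; left; simpa using hx
      have hx : x ∉ s := by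
        intro hm
        have hn := h.nodup
        rw [hst'] at hn
        exact (List.nodup_append.1 hn).2.2 x hm x (by simp) rfl
      obtain ⟨y, hy⟩ := IsParent.exists_of_notMem hs hx
      have hadj := h.adj s x t y hst' hy
      have hhead : s.headD 0 ≤ x := by
        have := h.head_le x (by simp [hst'])
        rw [hst'] at this
        cases s <;> simp_all
      rcases ih _ hst' with h₁ | h₁ | ⟨u, w, rfl, h₁, h₂, h₃⟩
      · rcases lt_trichotomy x G₁.n with hxn | hxn | hxn
        · left
          intro z hz
          rcases List.mem_append.1 hz with hz | hz
          · exact h₁ z hz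
          · rwa [List.mem_singleton.1 hz]
        · right; right
          refine ⟨s ++ [x], [], by simp, ?_, by simp [hxn], by simp⟩
          intro z hz
          rcases List.mem_append.1 hz with hz | hz
          · exact (h₁ z hz).le
          · rw [List.mem_singleton.1 hz, hxn]
        · exact absurd hadj.symm (LabelledGraph.not_sum_adj (h₁ y hy.mem) hxn)
      · right; left
        have : s.headD 0 ∈ s := by cases s <;> simp_all
        have := h₁ _ this
        intro z hz
        rcases List.mem_append.1 hz with hz | hz
        · exact h₁ z hz
        · rw [List.mem_singleton.1 hz]; omega
      · right; right
        have hxn : x ≠ G₁.n := fun h => hx (by simp [h, h₂])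
        by_cases hlt : G₁.n < x
        · refine ⟨u, w ++ [x - (G₁.n - 1)], ?_, h₁, h₂, ?_⟩
          · simp only [List.map_append, List.map_cons, List.map_nil, List.append_assoc]
            rw [Nat.sub_add_cancel (by omega)]
          · intro z hz
            rcases List.mem_append.1 hz with hz | hz
            · exact h₃ z hz
            · rw [List.mem_singleton.1 hz]; omega
        · rcases List.eq_nil_or_concat w with rfl | ⟨w, c, rfl⟩
          · refine ⟨u ++ [x], [], by simp, ?_, by simp [h₂], by simp⟩
            intro z hz
            rcases List.mem_append.1 hz with hz | hz
            · exact h₁ z hz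
            · rw [List.mem_singleton.1 hz]; omega
          -- The last letter read lies beyond `n₁` and is larger than `x < n₁`, so it is the parent
          -- of `x`; but no edge joins the two sides.
          · exfalso
            have hc := h₃ c (by simp)
            have hp : IsParent (u ++ (w.concat c).map (· + (G₁.n - 1))) x (c + (G₁.n - 1)) :=
              Or.inl ⟨u ++ w.map (· + (G₁.n - 1)), [], by simp, by omega, by simp⟩
            rw [hy.unique hp] at hadj
            exact LabelledGraph.not_sum_adj (by omega) (by omega) hadj
  exact key v [] (by simp)

end IsTreeWord

namespace LabelledGraph

variable {G₁ G₂ : LabelledGraph}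

/-- The inversions of a word in a sum of graphs are those of its two restrictions. -/
theorem invCount_sum (σ τ : List ℕ) (hτ : ∀ z ∈ τ, 1 ≤ z)
    (h : σ.filter (G₁.n ≤ ·) = τ.map (· + (G₁.n - 1))) :
    (G₁.sum G₂).invCount σ = G₁.invCount (σ.filter (· ≤ G₁.n)) + G₂.invCount τ := by
  classical
  have hpos := G₁.pos
  induction σ generalizing τ with
  | nil =>
    have : τ = [] := by simpa using h.symm
    subst this
    simp [invCount]
  | cons x l ih =>
    have hleft : x ≤ G₁.n →
        l.countP (fun y => y < x ∧ (G₁.sum G₂).graph.Adj y x) =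
        (l.filter (· ≤ G₁.n)).countP (fun y => y < x ∧ G₁.graph.Adj y x) := by
      intro hx
      rw [List.countP_filter]
      refine List.countP_congr fun y _ => ?_
      simp only [decide_eq_true_eq, Bool.and_eq_true]
      constructor
      · rintro ⟨h₁, h₂⟩
        exact ⟨⟨h₁, (sum_adj_left (by omega) hx).1 h₂⟩, by omega⟩
      · rintro ⟨⟨h₁, h₂⟩, h₃⟩
        exact ⟨h₁, (sum_adj_left h₃ hx).2 h₂⟩
    have hright : ∀ τ' : List ℕ, (∀ z ∈ τ', 1 ≤ z) →
        l.filter (G₁.n ≤ ·) = τ'.map (· + (G₁.n - 1)) → ∀ x', 1 < x' → x = x' + (G₁.n - 1) →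
        l.countP (fun y => y < x ∧ (G₁.sum G₂).graph.Adj y x) =
        τ'.countP (fun y => y < x' ∧ G₂.graph.Adj y x') := by
      intro τ' hτ' hf x' hx' hx
      have h₁ : l.countP (fun y => y < x ∧ (G₁.sum G₂).graph.Adj y x) =
          (l.filter (G₁.n ≤ ·)).countP (fun y => y < x ∧ (G₁.sum G₂).graph.Adj y x) := by
        rw [List.countP_filter]
        refine List.countP_congr fun y _ => ?_
        simp only [decide_eq_true_eq, Bool.and_eq_true]
        refine ⟨fun h => ⟨h, ?_⟩, fun h => h.1⟩
        by_contra hlt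
        exact not_sum_adj (by omega) (by omega) h.2
      rw [h₁, hf, List.countP_map]
      refine List.countP_congr fun y hy => ?_
      simp only [Function.comp_apply, decide_eq_true_eq]
      rw [hx, sum_adj_right (hτ' y hy) hx'.le]
      simp
    rw [invCount]
    rcases lt_trichotomy x G₁.n with hx | hx | hx
    · rw [List.filter_cons_of_neg (by simpa using hx)] at h
      rw [List.filter_cons_of_pos (by simpa using hx.le), invCount, ih τ hτ h, ← hleft hx.le,
        add_assoc]
    · rw [List.filter_cons_of_pos (by simpa using hx.ge)] at h
      obtain ⟨c, τ, rfl, hc, h⟩ := List.map_eq_cons_iff.1 h.symm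
      have hτ' : ∀ z ∈ τ, 1 ≤ z := fun z hz => hτ z (by simp [hz])
      rw [List.filter_cons_of_pos (by simpa using hx.le), invCount, invCount, ih τ hτ' h.symm,
        ← hleft hx.le]
      -- Here `x` is the glueing vertex, so `c = 1` is the least vertex of `G₂` and creates no
      -- inversion there.
      have : τ.countP (fun y => y < c ∧ G₂.graph.Adj y c) = 0 := by
        rw [List.countP_eq_zero]
        intro y hy
        have := hτ' y hy
        simp only [decide_eq_true_eq, not_and]
        intro h; omega
      rw [this]
      omega
    · rw [List.filter_cons_of_pos (by simpa using hx.le)] at h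
      obtain ⟨c, τ, rfl, hc, h⟩ := List.map_eq_cons_iff.1 h.symm
      have hτ' : ∀ z ∈ τ, 1 ≤ z := fun z hz => hτ z (by simp [hz])
      rw [List.filter_cons_of_neg (by simpa using hx), invCount, ih τ hτ' h.symm,
        ← hright τ hτ' h.symm c (by omega) hc.symm]
      omega

end LabelledGraph

/-! ### Glueing a left part and a right part -/

/-- The first part of the first composition. -/
def firstPartOf (L : List Block) : ℕ := (L.head?.map fun C => C.comp.headD 0).getD 0

/-- The first block has `r = 1`. -/
def SimpleBlocks (L : List Block) : Prop := ∀ C ∈ L.head?, C.r = 1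

/-- The number of parts that are not first in their composition. -/
def excess (L : List Block) : ℕ := (L.map fun C => C.comp.length - 1).sum

/-- The weight of a list of blocks. -/
noncomputable def blockWeight (G : LabelledGraph) (L : List Block) : ℕ :=
  G.invCount (L.flatMap Block.word) + (L.map fun C => C.r - 1).sum

namespace ForestTriple

variable {G : LabelledGraph} (F : ForestTriple G)

theorem type_eq : F.type = ↑(F.blocks.flatMap Block.comp) := by
  rw [type, blocks, List.flatMap_map]; rfl

theorem sign_eq : F.sign = (-1) ^ excess F.blocks := by
  rw [sign, excess, blocks, List.map_map]; rfl

theorem weight_eq : F.weight = blockWeight G F.blocks := by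
  rw [weight, blockWeight, blocks, List.map_map, List.flatMap_map, LabelledGraph.inv_eq_invCount]
  rfl

theorem firstPart_eq : F.firstPart = firstPartOf F.blocks := by
  rw [firstPart, firstPartOf, blocks, List.head?_map, Option.map_map]; rfl

theorem isSimple_iff : F.IsSimple ↔ SimpleBlocks F.blocks := by
  rw [IsSimple, SimpleBlocks, blocks, List.head?_map]
  cases F.triples.head? <;> simp [TreeTriple.toBlock]

theorem isAtom_iff : F.IsAtom ↔ ∀ C ∈ F.blocks, C.comp.length ≤ 1 := by
  simp only [IsAtom, blocks, List.mem_map, forall_exists_index, and_imp,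
    forall_apply_eq_imp_iff₂, TreeTriple.IsBreakable, TreeTriple.toBlock]
  refine forall₂_congr fun S _ => ?_
  omega

end ForestTriple

/-- A tree triple of `G` in which the largest vertex carries `B` extra vertices. -/
structure IsLeftBlock (G : LabelledGraph) (B : ℕ) (C : Block) : Prop where
  isTreeWord : IsTreeWord G C.word
  comp_pos : ∀ p ∈ C.comp, 1 ≤ p
  comp_sum : C.comp.sum = C.word.length + if G.n ∈ C.word then B else 0
  lt_last : G.n ∈ C.word → B < C.comp.getLastD 0
  one_le_r : 1 ≤ C.r
  r_le : C.r ≤ C.comp.headD 0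

/-- A simple forest triple of `G` in which the largest vertex carries `B` extra vertices. -/
structure IsLeft (G : LabelledGraph) (B : ℕ) (L : List Block) : Prop where
  isLeftBlock : ∀ C ∈ L, IsLeftBlock G B C
  nodup : (L.flatMap Block.word).Nodup
  mem_iff : ∀ v, v ∈ L.flatMap Block.word ↔ v ∈ Set.Icc 1 G.n
  heads : L.Pairwise fun C D => C.word.headD 0 < D.word.headD 0
  simple : SimpleBlocks L

namespace Block

/-- Relabelling. -/
def shift (x : ℕ) (C : Block) : Block := ⟨C.word.map (· + x), C.comp, C.r⟩

/-- The tree triple obtained by glueing the vertex `1` of `D` to the vertex `m`. -/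
def attach (m : ℕ) (D C : Block) : Block :=
  if m ∈ C.word then ⟨C.word ++ D.word.tail.map (· + (m - 1)), C.comp ++ D.comp.tail, C.r⟩ else C

end Block

/-- Glue a list of blocks on the vertices `1, …, m` and one on the vertices `m, m + 1, …`. -/
def combine (m : ℕ) (L : List Block) : List Block → List Block
  | [] => L
  | D :: R => L.map (Block.attach m D) ++ R.map (Block.shift (m - 1))

theorem exists_split {L : List Block} (hL : (L.flatMap Block.word).Nodup) {m : ℕ}
    (hm : m ∈ L.flatMap Block.word) : ∃ L₁ C L₂, L = L₁ ++ C :: L₂ ∧ m ∈ C.word ∧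
      (∀ D ∈ L₁, m ∉ D.word) ∧ ∀ D ∈ L₂, m ∉ D.word := by
  obtain ⟨C, hC, hmC⟩ := List.mem_flatMap.1 hm
  obtain ⟨L₁, L₂, rfl⟩ := List.append_of_mem hC
  simp only [List.flatMap_append, List.flatMap_cons, List.nodup_append, List.mem_append,
    List.mem_flatMap] at hL
  refine ⟨L₁, C, L₂, rfl, hmC, fun D hD hm => ?_, fun D hD hm => ?_⟩
  · exact hL.2.2 m ⟨D, hD, hm⟩ m (Or.inl hmC) rfl
  · exact hL.2.1.2.2 m hmC m ⟨D, hD, hm⟩ rfl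

theorem combine_split {m : ℕ} {L₁ L₂ R : List Block} {C D : Block} (hC : m ∈ C.word)
    (h₁ : ∀ C ∈ L₁, m ∉ C.word) (h₂ : ∀ C ∈ L₂, m ∉ C.word) :
    combine m (L₁ ++ C :: L₂) (D :: R) =
      L₁ ++ ⟨C.word ++ D.word.tail.map (· + (m - 1)), C.comp ++ D.comp.tail, C.r⟩ ::
        (L₂ ++ R.map (Block.shift (m - 1))) := by
  have h : ∀ L : List Block, (∀ C ∈ L, m ∉ C.word) → L.map (Block.attach m D) = L := by
    intro L hL
    rw [List.map_congr_left (g := id) (fun C hC => by simp [Block.attach, hL C hC]), List.map_id]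
  simp [combine, h L₁ h₁, h L₂ h₂, Block.attach, hC]

namespace IsForest

variable {G : LabelledGraph} {R : List Block}

/-- The minima of the blocks increase, so the block containing `1` comes first and its word begins
with `1`. -/
theorem exists_cons (h : IsForest G R) : ∃ D R', R = D :: R' ∧ D.word = 1 :: D.word.tail ∧
    D.comp = D.comp.headD 0 :: D.comp.tail ∧ 1 ≤ D.comp.headD 0 ∧ firstPartOf R = D.comp.headD 0 := by
  have hpos := G.pos
  have h1 := (h.mem_iff 1).2 ⟨le_rfl, hpos⟩
  cases R with
  | nil => simp at h1
  | cons D R' =>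
    have hD := h.isValid D (by simp)
    have hne := hD.isTreeWord.ne_nil
    refine ⟨D, R', rfl, ?_, ?_, ?_, rfl⟩
    · have hhead : D.word.headD 0 = 1 := by
        have hge := (hD.isTreeWord.mem_Icc _ hD.isTreeWord.headD_mem).1
        obtain ⟨C, hC, hmC⟩ := List.mem_flatMap.1 h1
        rcases List.mem_cons.1 hC with rfl | hC'
        · have := hD.isTreeWord.head_le 1 hmC
          omega
        · have := (List.pairwise_cons.1 h.heads).1 C hC'
          have := (h.isValid C hC).isTreeWord.head_le 1 hmC
          omega
      cases hw : D.word with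
      | nil => exact absurd hw hne
      | cons a l => rw [hw] at hhead; simpa using hhead
    · have := hD.r_le
      have := hD.one_le_r
      cases hw : D.comp with
      | nil => simp [hw] at *; omega
      | cons a l => simp
    · have := hD.r_le
      have := hD.one_le_r
      omega

end IsForest

theorem List.flatMap_word_shift (x : ℕ) (R : List Block) :
    (R.map (Block.shift x)).flatMap Block.word = (R.flatMap Block.word).map (· + x) := by
  rw [List.flatMap_map, List.map_flatMap]; rfl

theorem List.flatMap_comp_shift (x : ℕ) (R : List Block) :
    (R.map (Block.shift x)).flatMap Block.comp = R.flatMap Block.comp := by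
  rw [List.flatMap_map]; rfl

theorem List.Nodup.of_filter {α : Type*} (p : α → Bool) {l : List α} (h₁ : (l.filter p).Nodup)
    (h₂ : (l.filter fun x => !p x).Nodup) : l.Nodup := by
  rw [← (List.filter_append_perm p l).nodup_iff, List.nodup_append]
  refine ⟨h₁, h₂, ?_⟩
  rintro a ha b hb rfl
  simp only [List.mem_filter] at ha hb
  simp [ha.2] at hb

section combine

variable {G₁ G₂ : LabelledGraph} {B : ℕ} {L R : List Block}

theorem IsForest.two_le {D : Block} {R' : List Block} (hR : IsForest G₂ (D :: R'))
    (hD : D.word = 1 :: D.word.tail) :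
    (∀ z ∈ D.word.tail, 2 ≤ z) ∧ ∀ z ∈ R'.flatMap Block.word, 2 ≤ z := by
  have hn := hR.nodup
  have hm := hR.mem_iff
  rw [List.flatMap_cons, hD, List.cons_append, List.nodup_cons] at hn
  rw [List.flatMap_cons, hD, List.cons_append] at hm
  have : ∀ z ∈ D.word.tail ++ R'.flatMap Block.word, 2 ≤ z := by
    intro z hz
    have h₁ := ((hm z).1 (List.mem_cons_of_mem _ hz)).1
    have : z ≠ 1 := fun h => hn.1 (h ▸ hz)
    omega
  exact ⟨fun z hz => this z (List.mem_append_left _ hz),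
    fun z hz => this z (List.mem_append_right _ hz)⟩

theorem IsLeft.exists_split (hL : IsLeft G₁ B L) : ∃ L₁ C L₂, L = L₁ ++ C :: L₂ ∧
    G₁.n ∈ C.word ∧ (∀ D ∈ L₁, G₁.n ∉ D.word) ∧ ∀ D ∈ L₂, G₁.n ∉ D.word :=
  _root_.exists_split hL.nodup ((hL.mem_iff _).2 ⟨G₁.pos, le_rfl⟩)

theorem filter_le_combine (hL : IsLeft G₁ B L) (hR : IsForest G₂ R) :
    ((combine G₁.n L R).flatMap Block.word).filter (· ≤ G₁.n) = L.flatMap Block.word := by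
  have hpos := G₁.pos
  obtain ⟨D, R, rfl, hD, -⟩ := hR.exists_cons
  obtain ⟨h₁, h₂⟩ := hR.two_le hD
  obtain ⟨L₁, C, L₂, rfl, hC, hL₁, hL₂⟩ := hL.exists_split
  rw [combine_split hC hL₁ hL₂]
  have hle : ∀ z ∈ (L₁ ++ C :: L₂).flatMap Block.word, z ≤ G₁.n := fun z hz =>
    ((hL.mem_iff z).1 hz).2
  simp only [List.flatMap_append, List.flatMap_cons, List.mem_append] at hle
  have e : ∀ l : List ℕ, (∀ z ∈ l, z ≤ G₁.n) → l.filter (· ≤ G₁.n) = l := fun l hl =>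
    List.filter_eq_self.2 (by simpa using hl)
  have e' : ∀ l : List ℕ, (∀ z ∈ l, 2 ≤ z) →
      (l.map (· + (G₁.n - 1))).filter (· ≤ G₁.n) = [] := by
    intro l hl
    rw [List.filter_eq_nil_iff]
    intro a ha
    obtain ⟨z, hz, rfl⟩ := List.mem_map.1 ha
    have := hl z hz
    simp only [decide_eq_true_eq]
    omega
  simp only [List.flatMap_append, List.flatMap_cons, List.filter_append, List.flatMap_word_shift]
  rw [e _ (fun z hz => hle z (Or.inl hz)), e _ (fun z hz => hle z (Or.inr (Or.inl hz))),
    e _ (fun z hz => hle z (Or.inr (Or.inr hz))), e' _ h₁, e' _ h₂]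
  simp

theorem filter_ge_combine (hL : IsLeft G₁ B L) (hR : IsForest G₂ R) :
    ((combine G₁.n L R).flatMap Block.word).filter (G₁.n ≤ ·) =
      (R.flatMap Block.word).map (· + (G₁.n - 1)) := by
  have hpos := G₁.pos
  obtain ⟨D, R, rfl, hD, -⟩ := hR.exists_cons
  obtain ⟨h₁, h₂⟩ := hR.two_le hD
  obtain ⟨L₁, C, L₂, rfl, hC, hL₁, hL₂⟩ := hL.exists_split
  rw [combine_split hC hL₁ hL₂]
  have hle : ∀ z ∈ (L₁ ++ C :: L₂).flatMap Block.word, z ≤ G₁.n := fun z hz =>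
    ((hL.mem_iff z).1 hz).2
  have hCn : C.word.Nodup := (hL.isLeftBlock C (by simp)).isTreeWord.nodup
  simp only [List.flatMap_append, List.flatMap_cons, List.mem_append] at hle
  have e : ∀ L : List Block, (∀ C ∈ L, G₁.n ∉ C.word) → (∀ z ∈ L.flatMap Block.word, z ≤ G₁.n) →
      (L.flatMap Block.word).filter (G₁.n ≤ ·) = [] := by
    intro L h hl
    rw [List.filter_eq_nil_iff]
    intro z hz
    have h₁ := hl z hz
    obtain ⟨C, hC, hz⟩ := List.mem_flatMap.1 hz
    have : z ≠ G₁.n := fun h' => h C hC (h' ▸ hz)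
    simp only [decide_eq_true_eq]
    omega
  have e' : ∀ l : List ℕ, (∀ z ∈ l, 2 ≤ z) →
      (l.map (· + (G₁.n - 1))).filter (G₁.n ≤ ·) = l.map (· + (G₁.n - 1)) := by
    intro l hl
    rw [List.filter_eq_self]
    intro a ha
    obtain ⟨z, hz, rfl⟩ := List.mem_map.1 ha
    have := hl z hz
    simp only [decide_eq_true_eq]
    omega
  have eC : C.word.filter (G₁.n ≤ ·) = [G₁.n] := by
    have : C.word.filter (G₁.n ≤ ·) = C.word.filter (· == G₁.n) := by
      refine List.filter_congr fun z hz => ?_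
      have := hle z (Or.inr (Or.inl hz))
      rw [Bool.eq_iff_iff]
      simp only [decide_eq_true_eq, beq_iff_eq]
      omega
    rw [this, List.filter_beq, List.count_eq_one_of_mem hCn hC]
    rfl
  simp only [List.flatMap_append, List.flatMap_cons, List.filter_append, List.flatMap_word_shift]
  rw [e _ hL₁ (fun z hz => hle z (Or.inl hz)), e _ hL₂ (fun z hz => hle z (Or.inr (Or.inr hz))),
    e' _ h₁, e' _ h₂, eC, hD]
  simp [Nat.add_sub_cancel' hpos]

/-- Inversions split by `invCount_sum`. The integer `r` of the first block of `R` is lost in the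
glueing, which is harmless because it equals `1`. -/
theorem blockWeight_combine (hL : IsLeft G₁ B L) (hR : IsForest G₂ R) (hs : SimpleBlocks R) :
    blockWeight (G₁.sum G₂) (combine G₁.n L R) = blockWeight G₁ L + blockWeight G₂ R := by
  have h := LabelledGraph.invCount_sum (G₁ := G₁) (G₂ := G₂) _ _
    (fun z hz => ((hR.mem_iff z).1 hz).1) (filter_ge_combine hL hR)
  rw [filter_le_combine hL hR] at h
  rw [blockWeight, blockWeight, blockWeight, h]
  have hr : ((combine G₁.n L R).map fun C => C.r - 1).sum =
      (L.map fun C => C.r - 1).sum + (R.map fun C => C.r - 1).sum := by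
    obtain ⟨D, R, rfl, hD, -⟩ := hR.exists_cons
    obtain ⟨L₁, C, L₂, rfl, hC, hL₁, hL₂⟩ := hL.exists_split
    rw [combine_split hC hL₁ hL₂]
    have hDr : D.r = 1 := hs D (by simp)
    simp only [List.map_append, List.map_cons, List.sum_append, List.sum_cons, List.map_map, hDr]
    have : ((fun C : Block => C.r - 1) ∘ Block.shift (G₁.n - 1)) = fun C => C.r - 1 := rfl
    rw [this]
    omega
  rw [hr]
  omega

/-- The first part of `R` disappears: its vertices other than the glueing vertex are already counted
as extra vertices in the last part of the left block. -/
theorem type_combine (hL : IsLeft G₁ B L) (hR : IsForest G₂ R) :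
    (((combine G₁.n L R).flatMap Block.comp : List ℕ) : Multiset ℕ) + {firstPartOf R} =
      ↑(L.flatMap Block.comp) + ↑(R.flatMap Block.comp) := by
  obtain ⟨D, R, rfl, hD, hc, -, hf⟩ := hR.exists_cons
  obtain ⟨L₁, C, L₂, rfl, hC, hL₁, hL₂⟩ := hL.exists_split
  rw [combine_split hC hL₁ hL₂, hf]
  simp only [List.flatMap_append, List.flatMap_cons, List.flatMap_comp_shift]
  have hc' : (D.comp : Multiset ℕ) = D.comp.headD 0 ::ₘ ↑D.comp.tail := congrArg _ hc
  simp only [← Multiset.coe_add, hc', ← Multiset.singleton_add]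
  abel

theorem IsLeftBlock.comp_ne_nil {G : LabelledGraph} {C : Block} (h : IsLeftBlock G B C) :
    C.comp ≠ [] := by
  intro h0
  have h₁ := h.r_le
  have h₂ := h.one_le_r
  rw [h0] at h₁
  simp at h₁
  omega

theorem excess_combine (hL : IsLeft G₁ B L) (hR : IsForest G₂ R) :
    excess (combine G₁.n L R) = excess L + excess R := by
  obtain ⟨D, R, rfl, hD, hc, -, hf⟩ := hR.exists_cons
  obtain ⟨L₁, C, L₂, rfl, hC, hL₁, hL₂⟩ := hL.exists_split
  have hne := List.length_pos_iff.2 (hL.isLeftBlock C (by simp)).comp_ne_nil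
  rw [combine_split hC hL₁ hL₂]
  simp only [excess, List.map_append, List.map_cons, List.sum_append, List.sum_cons, List.map_map,
    List.length_append, List.length_tail]
  have : ((fun C : Block => C.comp.length - 1) ∘ Block.shift (G₁.n - 1)) =
    fun C => C.comp.length - 1 := rfl
  rw [this]
  omega

theorem IsLeft.ne_nil (hL : IsLeft G₁ B L) : L ≠ [] := by
  obtain ⟨L₁, C, L₂, rfl, -⟩ := hL.exists_split
  simp

theorem head?_combine (hL : IsLeft G₁ B L) (hR : IsForest G₂ R) :
    ∃ C C', L.head? = some C ∧ (combine G₁.n L R).head? = some C' ∧ C'.r = C.r ∧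
      C'.comp.headD 0 = C.comp.headD 0 := by
  obtain ⟨D, R, rfl, -⟩ := hR.exists_cons
  have hne := hL.ne_nil
  cases L with
  | nil => exact absurd rfl hne
  | cons C L =>
    refine ⟨C, Block.attach G₁.n D C, rfl, rfl, ?_⟩
    have h := (hL.isLeftBlock C (by simp)).comp_ne_nil
    by_cases hC : G₁.n ∈ C.word
    · cases hc : C.comp with
      | nil => exact absurd hc h
      | cons p l => simp [Block.attach, hC, hc]
    · simp [Block.attach, hC]

theorem firstPartOf_combine (hL : IsLeft G₁ B L) (hR : IsForest G₂ R) :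
    firstPartOf (combine G₁.n L R) = firstPartOf L := by
  obtain ⟨C, C', h₁, h₂, -, h₃⟩ := head?_combine hL hR
  rw [firstPartOf, firstPartOf, h₁, h₂, Option.map_some, Option.map_some, h₃]

theorem simpleBlocks_combine (hL : IsLeft G₁ B L) (hR : IsForest G₂ R) :
    SimpleBlocks (combine G₁.n L R) := by
  obtain ⟨C, C', h₁, h₂, h₃, -⟩ := head?_combine hL hR
  have := hL.simple C h₁
  intro C hC
  obtain rfl : C' = C := by simpa [h₂] using hC
  rw [h₃, this]

theorem isForest_combine (hR : IsForest G₂ R) (hs : SimpleBlocks R)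
    (hL : IsLeft G₁ (firstPartOf R - 1) L) : IsForest (G₁.sum G₂) (combine G₁.n L R) := by
  have hpos := G₁.pos
  have hpos₂ := G₂.pos
  have hle := filter_le_combine hL hR
  have hge := filter_ge_combine hL hR
  obtain ⟨D, R, rfl, hD, hc, hb, hf⟩ := hR.exists_cons
  obtain ⟨h₁, h₂⟩ := hR.two_le hD
  refine ⟨?_, ?_, ?_, ?_⟩
  · intro C' hC'
    simp only [combine, List.mem_append, List.mem_map] at hC'
    rcases hC' with ⟨C, hC, rfl⟩ | ⟨C, hC, rfl⟩
    · have hCL := hL.isLeftBlock C hC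
      by_cases hm : G₁.n ∈ C.word
      · have hDv := hR.isValid D (by simp)
        simp only [Block.attach, hm, if_true]
        refine ⟨hCL.isTreeWord.sum_append hm (hD ▸ hDv.isTreeWord), ?_, ?_, hCL.one_le_r, ?_⟩
        · intro p hp
          rcases List.mem_append.1 hp with hp | hp
          · exact hCL.comp_pos p hp
          · exact hDv.comp_pos p (List.mem_of_mem_tail hp)
        -- The extra vertices counted by `C.comp` number the first part of `D` minus one, the
        -- glueing vertex being shared.
        · have e₁ := hCL.comp_sum
          have e₂ := hDv.comp_sum
          rw [hD, hc, List.sum_cons, List.length_cons] at e₂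
          simp only [hm, if_true, hf] at e₁
          simp only [List.sum_append, List.length_append, List.length_map]
          omega
        · have := hCL.r_le
          have hne := hCL.comp_ne_nil
          cases hc : C.comp with
          | nil => exact absurd hc hne
          | cons p l => simpa [hc] using this
      · simp only [Block.attach, hm, if_false]
        exact ⟨hCL.isTreeWord.sum_left, hCL.comp_pos, by simpa [hm] using hCL.comp_sum,
          hCL.one_le_r, hCL.r_le⟩
    · have hCv := hR.isValid C (by simp [hC])
      exact ⟨hCv.isTreeWord.sum_right, hCv.comp_pos, by simpa [Block.shift] using hCv.comp_sum,
        hCv.one_le_r, hCv.r_le⟩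
  · refine List.Nodup.of_filter (· ≤ G₁.n) ?_ ?_
    · rw [hle]; exact hL.nodup
    · have : ((combine G₁.n L (D :: R)).flatMap Block.word).filter (fun x => !decide (x ≤ G₁.n)) =
          (((combine G₁.n L (D :: R)).flatMap Block.word).filter (G₁.n ≤ ·)).filter
            (fun x => !decide (x ≤ G₁.n)) := by
        rw [List.filter_filter]
        refine List.filter_congr fun z _ => ?_
        rw [Bool.eq_iff_iff]
        simp only [Bool.not_eq_true', decide_eq_false_iff_not, Bool.and_eq_true, decide_eq_true_eq]
        omega
      rw [this, hge]
      exact (hR.nodup.map (add_left_injective _)).filter _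
  · intro v
    have e : v ∈ (combine G₁.n L (D :: R)).flatMap Block.word ↔
        v ∈ L.flatMap Block.word ∨ v ∈ ((D :: R).flatMap Block.word).map (· + (G₁.n - 1)) := by
      rw [← hle, ← hge, List.mem_filter, List.mem_filter, ← and_or_left]
      simp only [decide_eq_true_eq, le_total, and_true]
    rw [e, hL.mem_iff, List.mem_map]
    simp only [hR.mem_iff, Set.mem_Icc, LabelledGraph.sum_n]
    constructor
    · rintro (h | ⟨z, h, rfl⟩) <;> omega
    · intro h
      by_cases hv : v ≤ G₁.n
      · exact Or.inl ⟨h.1, hv⟩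
      · exact Or.inr ⟨v - (G₁.n - 1), by omega, by omega⟩
  · have hhead : ∀ C ∈ L, (Block.attach G₁.n D C).word.headD 0 = C.word.headD 0 := by
      intro C hC
      have hne := (hL.isLeftBlock C hC).isTreeWord.ne_nil
      by_cases hm : G₁.n ∈ C.word
      · cases hw : C.word with
        | nil => exact absurd hw hne
        | cons p l => rw [hw] at hm; simp [Block.attach, hw, hm]
      · simp [Block.attach, hm]
    rw [combine, List.pairwise_append]
    refine ⟨?_, ?_, ?_⟩
    · rw [List.pairwise_map]
      refine List.Pairwise.imp_of_mem ?_ hL.heads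
      intro C C' hC hC' h
      rwa [hhead C hC, hhead C' hC']
    · rw [List.pairwise_map]
      refine List.Pairwise.imp_of_mem ?_ (List.pairwise_cons.1 hR.heads).2
      intro C C' hC hC' h
      have h₃ := (hR.isValid C (by simp [hC])).isTreeWord.ne_nil
      have h₄ := (hR.isValid C' (by simp [hC'])).isTreeWord.ne_nil
      cases hw : C.word with
      | nil => exact absurd hw h₃
      | cons p l =>
        cases hw' : C'.word with
        | nil => exact absurd hw' h₄
        | cons p' l' => simpa [Block.shift, hw, hw'] using h
    · intro C' hC' E' hE'
      obtain ⟨C, hC, rfl⟩ := List.mem_map.1 hC'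
      obtain ⟨E, hE, rfl⟩ := List.mem_map.1 hE'
      rw [hhead C hC]
      have h₃ := (hL.isLeftBlock C hC).isTreeWord
      have h₄ := (h₃.mem_Icc _ h₃.headD_mem).2
      have h₅ := (hR.isValid E (by simp [hE])).isTreeWord
      have h₆ := h₂ _ (List.mem_flatMap.2 ⟨E, hE, h₅.headD_mem⟩)
      have h₇ : (Block.shift (G₁.n - 1) E).word.headD 0 = E.word.headD 0 + (G₁.n - 1) := by
        have h₃ := h₅.ne_nil
        cases hw : E.word with
        | nil => exact absurd hw h₃
        | cons p l => simp [Block.shift, hw]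
      rw [h₇]
      omega

end combine

/-! ### Cutting a forest triple of a sum -/

theorem List.exists_split_sum {l : List ℕ} {k : ℕ} (hk : 1 ≤ k) (hl : k ≤ l.sum) :
    ∃ s p t, l = s ++ p :: t ∧ s.sum < k ∧ k ≤ s.sum + p := by
  induction l generalizing k with
  | nil => simp at hl; omega
  | cons q l ih =>
    by_cases hq : k ≤ q
    · exact ⟨[], q, l, rfl, by simpa using by omega, by simpa using hq⟩
    · rw [List.sum_cons] at hl
      obtain ⟨s, p, t, rfl, h₁, h₂⟩ := ih (k := k - q) (by omega) (by omega)
      exact ⟨q :: s, p, t, rfl, by simp; omega, by simp; omega⟩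

theorem List.Pairwise.exists_append {α : Type*} {f : α → ℕ} {l : List α}
    (h : l.Pairwise fun a b => f a < f b) (m : ℕ) :
    ∃ l₁ l₂, l = l₁ ++ l₂ ∧ (∀ a ∈ l₁, f a ≤ m) ∧ ∀ a ∈ l₂, m < f a := by
  induction l with
  | nil => exact ⟨[], [], by simp⟩
  | cons c l ih =>
    rw [List.pairwise_cons] at h
    by_cases hc : f c ≤ m
    · obtain ⟨l₁, l₂, rfl, h₁, h₂⟩ := ih h.2
      exact ⟨c :: l₁, l₂, rfl, by simpa [hc] using h₁, h₂⟩
    · refine ⟨[], c :: l, rfl, by simp, ?_⟩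
      intro a ha
      rcases List.mem_cons.1 ha with rfl | ha
      · omega
      · have := h.1 a ha
        omega

section decompose

variable {G₁ G₂ : LabelledGraph}

theorem exists_shift_eq {x : ℕ} {P : List Block} (hP : ∀ C ∈ P, ∀ z ∈ C.word, x + 1 < z) :
    ∃ R : List Block, R.map (Block.shift x) = P ∧ ∀ C ∈ R, ∀ z ∈ C.word, 2 ≤ z := by
  refine ⟨P.map fun C => ⟨C.word.map (· - x), C.comp, C.r⟩, ?_, ?_⟩
  · rw [List.map_map]
    conv_rhs => rw [← List.map_id P]
    refine List.map_congr_left fun C hC => ?_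
    simp only [Function.comp_apply, Block.shift, List.map_map, id]
    have : C.word.map ((· + x) ∘ (· - x)) = C.word := by
      conv_rhs => rw [← List.map_id C.word]
      refine List.map_congr_left fun z hz => ?_
      have := hP C hC z hz
      simp only [Function.comp_apply, id]
      omega
    rw [this]
  · intro C hC z hz
    obtain ⟨E, hE, rfl⟩ := List.mem_map.1 hC
    obtain ⟨y, hy, rfl⟩ := List.mem_map.1 hz
    have := hP E hE y hy
    omega

/-- The tree through `n₁` is cut after its letters up to `n₁`, and its composition after the part in
which this cut falls. That part stays whole on the left, which gives `B < ` last part; its overhang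
reappears on the right. -/
theorem exists_combine {M : List Block} (hM : IsForest (G₁.sum G₂) M) (hs : SimpleBlocks M) :
    ∃ L R, IsForest G₂ R ∧ SimpleBlocks R ∧ IsLeft G₁ (firstPartOf R - 1) L ∧
      combine G₁.n L R = M := by
  have hpos := G₁.pos
  have hpos₂ := G₂.pos
  obtain ⟨M₁, X, M₂, rfl, hX, hM₁, hM₂⟩ := exists_split hM.nodup
    ((hM.mem_iff G₁.n).2 ⟨hpos, by rw [LabelledGraph.sum_n]; omega⟩)
  have hpw := hM.heads
  rw [List.pairwise_append, List.pairwise_cons] at hpw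
  obtain ⟨hpw₁, ⟨hpwX, hpw₂⟩, hpw₃⟩ := hpw
  -- Among the blocks after `X`, those of `P` begin below `n₁` and therefore stay below it, while
  -- those of `Q` lie entirely beyond `n₁`.
  obtain ⟨P, Q, rfl, hP, hQ⟩ := hpw₂.exists_append G₁.n
  have hXv := hM.isValid X (by simp)
  have hXhead : X.word.headD 0 ≤ G₁.n := hXv.isTreeWord.head_le _ hX
  have hsmall : ∀ C ∈ M₁ ++ X :: (P ++ Q), G₁.n ∉ C.word → C.word.headD 0 ≤ G₁.n →
      ∀ z ∈ C.word, z < G₁.n := by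
    intro C hC hm hh
    have hC := (hM.isValid C hC).isTreeWord
    rcases hC.sum_cases with h | h | ⟨u, w, h, -, hn, -⟩
    · exact h
    · have := h _ hC.headD_mem
      omega
    · exact absurd (by simp [h, hn]) hm
  have hM₁s : ∀ C ∈ M₁, ∀ z ∈ C.word, z < G₁.n := fun C hC =>
    hsmall C (by simp [hC]) (hM₁ C hC) ((hpw₃ C hC X (by simp)).le.trans hXhead)
  have hPs : ∀ C ∈ P, ∀ z ∈ C.word, z < G₁.n := fun C hC =>
    hsmall C (by simp [hC]) (hM₂ C (by simp [hC])) (hP C hC)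
  have hQs : ∀ C ∈ Q, ∀ z ∈ C.word, G₁.n - 1 + 1 < z := by
    intro C hC z hz
    have := (hM.isValid C (by simp [hC])).isTreeWord.head_le z hz
    have := hQ C hC
    omega
  obtain ⟨R', rfl, hR'⟩ := exists_shift_eq hQs
  obtain ⟨u, w, hXw, hu, hun, hw⟩ : ∃ u w : List ℕ, X.word = u ++ w.map (· + (G₁.n - 1)) ∧
      (∀ z ∈ u, z ≤ G₁.n) ∧ G₁.n ∈ u ∧ ∀ z ∈ w, 2 ≤ z := by
    rcases hXv.isTreeWord.sum_cases with h | h | h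
    · exact absurd (h _ hX) (lt_irrefl _)
    · exact absurd (h _ hX) (lt_irrefl _)
    · exact h
  have hulen : 1 ≤ u.length := List.length_pos_of_mem hun
  have hsum := hXv.comp_sum
  rw [hXw, List.length_append, List.length_map] at hsum
  -- `p` is the part that covers the last letter of `u`.
  obtain ⟨α, p, β, hcomp, hα, hp⟩ := List.exists_split_sum hulen (l := X.comp) (by omega)
  have hune : u ≠ [] := List.ne_nil_of_mem hun
  have huhead : X.word.headD 0 = u.headD 0 := by
    rw [hXw]
    cases u <;> simp_all
  have hwords : (M₁ ++ X :: (P ++ R'.map (Block.shift (G₁.n - 1)))).flatMap Block.word =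
      M₁.flatMap Block.word ++ ((u ++ w.map (· + (G₁.n - 1))) ++ (P.flatMap Block.word ++
        (R'.flatMap Block.word).map (· + (G₁.n - 1)))) := by
    simp only [List.flatMap_append, List.flatMap_cons, List.flatMap_word_shift, hXw]
  have hnd := hM.nodup
  have hmem := hM.mem_iff
  rw [hwords] at hnd
  simp only [hwords, LabelledGraph.sum_n] at hmem
  set C : Block := ⟨u, α ++ [p], X.r⟩ with hCdef
  -- The first part of `D` consists of the overhang of `p` beyond `u` together with the glueing
  -- vertex.
  set D : Block := ⟨1 :: w, (α.sum + p - u.length + 1) :: β, 1⟩ with hDdef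
  have hsm : ∀ z ∈ (M₁ ++ C :: P).flatMap Block.word, z ≤ G₁.n := by
    intro z hz
    simp only [List.flatMap_append, List.flatMap_cons, List.mem_append, List.mem_flatMap] at hz
    rcases hz with ⟨C, hC, hz⟩ | hz | ⟨C, hC, hz⟩
    · exact (hM₁s C hC z hz).le
    · exact hu z hz
    · exact (hPs C hC z hz).le
  have hbig : ∀ z ∈ w ++ R'.flatMap Block.word, 2 ≤ z := by
    intro z hz
    simp only [List.mem_append, List.mem_flatMap] at hz
    rcases hz with hz | ⟨C, hC, hz⟩
    · exact hw z hz
    · exact hR' C hC z hz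
  have hmem' : ∀ v, v ∈ (M₁ ++ C :: P).flatMap Block.word ∨
      v ∈ (w ++ R'.flatMap Block.word).map (· + (G₁.n - 1)) ↔
        v ∈ Set.Icc 1 (G₁.n + G₂.n - 1) := by
    intro v
    rw [← hmem v]
    simp only [List.flatMap_append, List.flatMap_cons, List.mem_append, List.map_append, hCdef]
    tauto
  have hM₁m : ∀ C ∈ M₁, G₁.n ∉ C.word := hM₁
  refine ⟨M₁ ++ C :: P, D :: R', ⟨?_, ?_, ?_, ?_⟩, by simp [SimpleBlocks, hDdef],
    ⟨?_, ?_, ?_, ?_, ?_⟩, ?_⟩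
  · intro E hE
    rcases List.mem_cons.1 hE with rfl | hE
    · refine ⟨?_, ?_, ?_, le_rfl, by simp [hDdef]⟩
      · exact IsTreeWord.of_sum_append_right (hXw ▸ hXv.isTreeWord) hu hun hw
      · intro q hq
        rcases List.mem_cons.1 hq with rfl | hq
        · omega
        · exact hXv.comp_pos q (by simp [hcomp, hq])
      · rw [hcomp] at hsum
        simp only [List.sum_append, List.sum_cons] at hsum
        simp only [hDdef, List.sum_cons, List.length_cons]
        omega
    · have hEv := hM.isValid (E.shift (G₁.n - 1)) (by
        simp only [List.mem_append, List.mem_cons, List.mem_map]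
        exact Or.inr (Or.inr (Or.inr ⟨E, hE, rfl⟩)))
      refine ⟨hEv.isTreeWord.of_sum_right fun z hz => ?_, hEv.comp_pos, ?_, hEv.one_le_r,
        hEv.r_le⟩
      · have := hR' E hE z hz
        omega
      · simpa [Block.shift] using hEv.comp_sum
  · have h₁ : (w ++ R'.flatMap Block.word).Nodup := by
      refine List.Nodup.of_map (· + (G₁.n - 1)) ?_
      rw [List.map_append]
      refine hnd.sublist ?_
      refine List.Sublist.trans ?_ (List.sublist_append_right _ _)
      exact List.Sublist.append (List.sublist_append_right _ _) (List.sublist_append_right _ _)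
    rw [List.flatMap_cons, hDdef, List.cons_append, List.nodup_cons]
    refine ⟨fun h => ?_, h₁⟩
    have := hbig 1 h
    omega
  · intro v
    rw [List.flatMap_cons, hDdef, List.cons_append, List.mem_cons]
    by_cases hv : v ≤ 1
    · constructor
      · rintro (rfl | h)
        · exact ⟨le_rfl, hpos₂⟩
        · have := hbig v h
          omega
      · rintro ⟨h, -⟩
        left; omega
    · have h₁ := hmem' (v + (G₁.n - 1))
      have h₂ : v + (G₁.n - 1) ∉ (M₁ ++ C :: P).flatMap Block.word := by
        intro h
        have := hsm _ h
        omega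
      have h₃ : v + (G₁.n - 1) ∈ (w ++ R'.flatMap Block.word).map (· + (G₁.n - 1)) ↔
          v ∈ w ++ R'.flatMap Block.word := by
        rw [List.mem_map]
        constructor
        · rintro ⟨y, hy, h⟩
          rwa [show v = y by omega]
        · intro h
          exact ⟨v, h, rfl⟩
      rw [h₃] at h₁
      simp only [h₂, false_or, Set.mem_Icc] at h₁
      rw [h₁, Set.mem_Icc]
      omega
  · rw [List.pairwise_cons]
    refine ⟨?_, ?_⟩
    · intro E hE
      have hEv := (hM.isValid (E.shift (G₁.n - 1)) (by
        simp only [List.mem_append, List.mem_cons, List.mem_map]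
        exact Or.inr (Or.inr (Or.inr ⟨E, hE, rfl⟩)))).isTreeWord.ne_nil
      have := hR' E hE (E.word.headD 0) (by
        cases hw : E.word with
        | nil => simp [Block.shift, hw] at hEv
        | cons a l => simp)
      simp only [hDdef, List.headD_cons]
      omega
    · have h := (List.pairwise_append.1 hpw₂).2.1
      rw [List.pairwise_map] at h
      refine List.Pairwise.imp_of_mem ?_ h
      intro E E' hE hE' hlt
      have hne : ∀ E ∈ R', E.word ≠ [] := by
        intro E hE h0
        have hEv := (hM.isValid (E.shift (G₁.n - 1)) (by
          simp only [List.mem_append, List.mem_cons, List.mem_map]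
          exact Or.inr (Or.inr (Or.inr ⟨E, hE, rfl⟩)))).isTreeWord.ne_nil
        simp [Block.shift, h0] at hEv
      have h₃ := hne E hE
      have h₄ := hne E' hE'
      cases hw : E.word with
      | nil => exact absurd hw h₃
      | cons p l =>
        cases hw' : E'.word with
        | nil => exact absurd hw' h₄
        | cons p' l' => simpa [Block.shift, hw, hw'] using hlt
  · intro E hE
    have hrest : ∀ E ∈ M₁ ++ X :: (P ++ R'.map (Block.shift (G₁.n - 1))),
        (∀ z ∈ E.word, z < G₁.n) → IsLeftBlock G₁ (firstPartOf (D :: R') - 1) E := by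
      intro E hE hz
      have hEv := hM.isValid E hE
      have hn : G₁.n ∉ E.word := fun h => lt_irrefl _ (hz _ h)
      exact ⟨hEv.isTreeWord.of_sum_left fun z h => (hz z h).le, hEv.comp_pos,
        by simpa [hn] using hEv.comp_sum, fun h => absurd h hn, hEv.one_le_r, hEv.r_le⟩
    simp only [List.mem_append, List.mem_cons] at hE
    rcases hE with hE | rfl | hE
    · exact hrest E (by simp [hE]) (hM₁s E hE)
    · have hfp : firstPartOf (D :: R') = α.sum + p - u.length + 1 := rfl
      refine ⟨IsTreeWord.of_sum_append_left (hXw ▸ hXv.isTreeWord) hu hune, ?_, ?_, ?_,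
        hXv.one_le_r, ?_⟩
      · intro q hq
        exact hXv.comp_pos q (by
          rw [hcomp]
          simp only [hCdef, List.mem_append, List.mem_cons] at hq ⊢
          tauto)
      · simp only [hCdef, hun, if_true, hfp, List.sum_append, List.sum_singleton]
        omega
      · intro _
        rw [hfp]
        simp only [hCdef, List.getLastD_concat]
        omega
      · have := hXv.r_le
        rw [hcomp] at this
        cases α <;> simpa [hCdef] using this
    · exact hrest E (by simp [hE]) (hPs E hE)
  · refine hnd.sublist ?_
    rw [List.flatMap_append, List.flatMap_cons]
    refine List.Sublist.append (List.Sublist.refl _) ?_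
    exact List.Sublist.append (List.sublist_append_left _ _) (List.sublist_append_left _ _)
  · intro v
    by_cases hv : v ≤ G₁.n
    · have h₁ : v ∉ (w ++ R'.flatMap Block.word).map (· + (G₁.n - 1)) := by
        intro h
        obtain ⟨y, hy, rfl⟩ := List.mem_map.1 h
        have := hbig y hy
        omega
      have := hmem' v
      simp only [h₁, or_false, Set.mem_Icc] at this
      rw [this, Set.mem_Icc]
      omega
    · constructor
      · intro h
        exact absurd (hsm v h) hv
      · rintro ⟨-, h⟩
        exact absurd h hv
  · have h := hM.heads
    rw [← List.cons_append, ← List.append_assoc] at h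
    have h := (List.pairwise_append.1 h).1
    rw [List.pairwise_append, List.pairwise_cons] at h ⊢
    refine ⟨h.1, ⟨fun E hE => ?_, h.2.1.2⟩, ?_⟩
    · rw [hCdef, ← huhead]
      exact h.2.1.1 E hE
    · intro E hE E' hE'
      rcases List.mem_cons.1 hE' with rfl | hE'
      · rw [hCdef, ← huhead]
        exact h.2.2 E hE X (by simp)
      · exact h.2.2 E hE E' (by simp [hE'])
  · cases M₁ with
    | nil =>
      have := hs X (by simp)
      simpa [SimpleBlocks, hCdef] using this
    | cons E M₁ => simpa [SimpleBlocks] using hs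
  · rw [combine_split hun hM₁m (fun E hE h => lt_irrefl _ (hPs E hE _ h))]
    have hXe : (⟨u ++ w.map (· + (G₁.n - 1)), X.comp, X.r⟩ : Block) = X := by
      rw [← hXw]
    simp only [hCdef, hDdef, List.tail_cons, List.append_assoc, List.singleton_append, ← hcomp, hXe]

theorem combine_left_cancel {R L L' : List Block} (hR : IsForest G₂ R)
    (h : combine G₁.n L R = combine G₁.n L' R) :
    L = L' := by
  have hpos := G₁.pos
  obtain ⟨D, R, rfl, hD, -⟩ := hR.exists_cons
  have h₁ := (hR.two_le hD).1
  simp only [combine] at h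
  have h := List.append_cancel_right h
  have hn : G₁.n ∉ D.word.tail.map (· + (G₁.n - 1)) := by
    intro hm
    obtain ⟨y, hy, hy'⟩ := List.mem_map.1 hm
    have := h₁ y hy
    omega
  have hinj : Function.Injective (Block.attach G₁.n D) := by
    intro C C' hCC
    have hmem : ∀ C, G₁.n ∈ (Block.attach G₁.n D C).word ↔ G₁.n ∈ C.word := by
      intro C
      by_cases hC : G₁.n ∈ C.word <;> simp [Block.attach, hC]
    by_cases hC : G₁.n ∈ C.word
    · have hC' : G₁.n ∈ C'.word := by rw [← hmem, ← hCC, hmem]; exact hC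
      simp only [Block.attach, hC, hC', if_true, Block.mk.injEq] at hCC
      exact Block.ext (List.append_cancel_right hCC.1) (List.append_cancel_right hCC.2.1) hCC.2.2
    · have hC' : G₁.n ∉ C'.word := by rw [← hmem, ← hCC, hmem]; exact hC
      simpa only [Block.attach, hC, hC', if_false] using hCC
  exact List.map_injective_iff.2 hinj h

end decompose

/-! ### Restriction and segment number of a glued triple -/

/-- The second inequality says that the sum drops below `k` once the last part of `α` is omitted. -/
theorem sInf_take_sum {α β : List ℕ} {k : ℕ} (hα : α ≠ []) (h₁ : k ≤ α.sum)
    (h₂ : α.sum < k + α.getLastD 0) :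
    sInf {j | k ≤ ((α ++ β).take j).sum} = α.length := by
  refine IsLeast.csInf_eq ⟨by simpa using h₁, ?_⟩
  intro j hj
  by_contra! hlt
  rcases List.eq_nil_or_concat α with rfl | ⟨α, p, rfl⟩
  · exact hα rfl
  simp only [List.concat_eq_append, List.length_append, List.length_singleton] at hlt
  simp only [List.concat_eq_append, List.sum_append, List.sum_singleton, List.getLastD_concat] at h₂
  have h₃ : ((α.concat p ++ β).take j) = α.take j := by
    rw [List.concat_eq_append, List.append_assoc, List.take_append_of_le_length (by omega)]
  have h₄ : (α.take j).sum ≤ α.sum := (List.take_sublist j α).sum_le_sum (by simp)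
  simp only [Set.mem_ofPred_eq, h₃] at hj
  omega

section restriction

variable {G₁ G₂ : LabelledGraph}

theorem TreeTriple.numVerts_eq {G : LabelledGraph} (S : TreeTriple G) (m : ℕ) :
    S.numVerts m = (S.list.filter (· ≤ m)).length := by
  have h : S.verts ∩ Set.Icc 1 m = ((S.list.filter (· ≤ m)).toFinset : Set ℕ) := by
    ext v
    simp only [Set.mem_inter_iff, Set.mem_Icc, List.coe_toFinset, List.mem_filter,
      decide_eq_true_eq, Set.mem_ofPred_eq, S.mem_list]
    constructor
    · rintro ⟨h₁, h₂⟩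
      exact ⟨h₁, h₂.2⟩
    · rintro ⟨h₁, h₂⟩
      exact ⟨h₁, (S.isDecreasing.subset h₁).1, h₂⟩
  rw [numVerts, h, Set.ncard_coe_finset, List.toFinset_card_of_nodup]
  exact S.isValid_toBlock.isTreeWord.nodup.filter _

theorem TreeTriple.isPresent_iff {G : LabelledGraph} (S : TreeTriple G) (m : ℕ) :
    S.IsPresent m ↔ S.list.headD 0 ≤ m := by
  have hw := S.isValid_toBlock.isTreeWord
  constructor
  · rintro ⟨v, h₁, h₂⟩
    exact (hw.head_le v (S.mem_list.2 h₁)).trans h₂.2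
  · intro h
    exact ⟨_, S.mem_list.1 hw.headD_mem, (hw.mem_Icc _ hw.headD_mem).1, h⟩

theorem isRestriction_unique {F : SimpleForestTriple (G₁.sum G₂)} {F₁ F₂ : SimpleForestTriple G₂}
    (h₁ : IsRestriction F F₁) (h₂ : IsRestriction F F₂) : F₁ = F₂ := by
  have hpos := G₁.pos
  have hpos₂ := G₂.pos
  obtain ⟨S, hS, hSn, S₁, l₁, hF₁, hw₁, hc₁, hr₁, hl₁⟩ := h₁
  obtain ⟨S', hS', hSn', S₂, l₂, hF₂, hw₂, hc₂, hr₂, hl₂⟩ := h₂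
  obtain rfl : S = S' := (F.1.cover G₁.n ⟨hpos, by rw [LabelledGraph.sum_n]; omega⟩).unique
    ⟨hS, hSn⟩ ⟨hS', hSn'⟩
  have hadd : Function.Injective fun z : ℕ => z + (G₁.n - 1) := add_left_injective _
  obtain rfl : S₁ = S₂ := TreeTriple.toBlock_injective (Block.ext
    (List.map_injective_iff.2 hadd (hw₁.symm.trans hw₂)) (hc₁.trans hc₂.symm)
    (hr₁.trans hr₂.symm))
  obtain rfl : l₁ = l₂ := by
    clear hF₁ hF₂
    generalize List.filter _ F.1.triples = l at hl₁ hl₂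
    induction hl₁ generalizing l₂ with
    | nil => exact (List.forall₂_nil_left_iff.1 hl₂).symm
    | cons h _ ih =>
      obtain ⟨c, l, h', hl, rfl⟩ := List.forall₂_cons_left_iff.1 hl₂
      rw [ih _ hl]
      congr 1
      exact TreeTriple.toBlock_injective (Block.ext
        (List.map_injective_iff.2 hadd (h.1.symm.trans h'.1)) (h.2.1.trans h'.2.1.symm)
        (h.2.2.trans h'.2.2.symm))
  exact Subtype.ext (ForestTriple.blocks_injective (by
    rw [ForestTriple.blocks, ForestTriple.blocks, hF₁, hF₂]))

/-- The structure of the tree containing the glueing vertex in a glued forest triple. -/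
theorem exists_triple_of_combine {F : ForestTriple (G₁.sum G₂)} {R L₁ L₂ : List Block}
    {B : ℕ} {C D : Block} (hR : IsForest G₂ (D :: R)) (hL : IsLeft G₁ B (L₁ ++ C :: L₂))
    (hD : D.word = 1 :: D.word.tail)
    (hC : G₁.n ∈ C.word) (hL₁ : ∀ C ∈ L₁, G₁.n ∉ C.word) (hL₂ : ∀ C ∈ L₂, G₁.n ∉ C.word)
    (hF : F.blocks = combine G₁.n (L₁ ++ C :: L₂) (D :: R)) :
    ∃ T₁ S T₂ T₃, F.triples = T₁ ++ S :: (T₂ ++ T₃) ∧ T₁.map TreeTriple.toBlock = L₁ ∧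
      T₂.map TreeTriple.toBlock = L₂ ∧ T₃.map TreeTriple.toBlock = R.map (Block.shift (G₁.n - 1)) ∧
      S.list = C.word ++ D.word.tail.map (· + (G₁.n - 1)) ∧ S.comp = C.comp ++ D.comp.tail ∧
      S.r = C.r ∧ S.numVerts G₁.n = C.word.length ∧ S.seg G₁.n = C.comp.length ∧
      (∀ T ∈ T₁, T.IsPresent G₁.n ∧ G₁.n ∉ T.verts) ∧ S.IsPresent G₁.n ∧ G₁.n ∈ S.verts ∧
      (∀ T ∈ T₂, T.IsPresent G₁.n ∧ G₁.n ∉ T.verts) ∧ ∀ T ∈ T₃, ¬ T.IsPresent G₁.n := by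
  have hpos := G₁.pos
  obtain ⟨h₁, h₂⟩ := hR.two_le hD
  rw [combine_split hC hL₁ hL₂, ForestTriple.blocks] at hF
  obtain ⟨T₁, T', hT, hT₁, hT'⟩ := List.map_eq_append_iff.1 hF
  obtain ⟨S, T', rfl, hS, hT'⟩ := List.map_eq_cons_iff.1 hT'
  obtain ⟨T₂, T₃, rfl, hT₂, hT₃⟩ := List.map_eq_append_iff.1 hT'
  have hSw : S.list = C.word ++ D.word.tail.map (· + (G₁.n - 1)) := congrArg Block.word hS
  have hSc : S.comp = C.comp ++ D.comp.tail := congrArg Block.comp hS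
  have hSr : S.r = C.r := congrArg Block.r hS
  have hCL := hL.isLeftBlock C (by simp)
  have hSn : G₁.n ∈ S.verts := S.mem_list.1 (by rw [hSw]; simp [hC])
  have hnum : S.numVerts G₁.n = C.word.length := by
    rw [S.numVerts_eq, hSw, List.filter_append, List.filter_eq_self.2, List.filter_eq_nil_iff.2,
      List.append_nil]
    · intro a ha
      obtain ⟨y, hy, rfl⟩ := List.mem_map.1 ha
      have := h₁ y hy
      simp only [decide_eq_true_eq]
      omega
    · intro a ha
      simpa using (hCL.isTreeWord.mem_Icc a ha).2
  have hleft : ∀ T : TreeTriple (G₁.sum G₂), T.toBlock ∈ L₁ ++ L₂ →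
      T.IsPresent G₁.n ∧ G₁.n ∉ T.verts := by
    intro T hT
    have hTL : IsLeftBlock G₁ B T.toBlock := hL.isLeftBlock _ (by
      simp only [List.mem_append, List.mem_cons] at hT ⊢; tauto)
    refine ⟨(T.isPresent_iff _).2 (hTL.isTreeWord.mem_Icc _ hTL.isTreeWord.headD_mem).2, ?_⟩
    rw [← T.mem_list]
    rcases List.mem_append.1 hT with hT | hT
    · exact hL₁ _ hT
    · exact hL₂ _ hT
  refine ⟨T₁, S, T₂, T₃, hT, hT₁, hT₂, hT₃, hSw, hSc, hSr, hnum, ?_, ?_,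
    ⟨G₁.n, hSn, hpos, le_rfl⟩, hSn, ?_, ?_⟩
  · rw [TreeTriple.seg, hnum, hSc]
    have h₃ := hCL.comp_sum
    have h₄ := hCL.lt_last hC
    simp only [hC, if_true] at h₃
    exact sInf_take_sum hCL.comp_ne_nil (by omega) (by omega)
  · intro T hT
    exact hleft T (List.mem_append_left _ (hT₁ ▸ List.mem_map_of_mem hT))
  · intro T hT
    exact hleft T (List.mem_append_right _ (hT₂ ▸ List.mem_map_of_mem hT))
  · intro T hT
    rw [T.isPresent_iff]
    have : T.toBlock ∈ R.map (Block.shift (G₁.n - 1)) := hT₃ ▸ List.mem_map_of_mem hT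
    obtain ⟨E, hE, hTE⟩ := List.mem_map.1 this
    have hlist : T.list = E.word.map (· + (G₁.n - 1)) := (congrArg Block.word hTE).symm
    have hmem := T.isValid_toBlock.isTreeWord.headD_mem
    have hmem : T.list.headD 0 ∈ E.word.map (· + (G₁.n - 1)) := by
      rw [← hlist]; exact hmem
    obtain ⟨y, hy, hy'⟩ := List.mem_map.1 hmem
    have := h₂ y (List.mem_flatMap.2 ⟨E, hE, hy⟩)
    omega

/-- The left composition sums to `k + B`, so the first part required of the restriction, namely the
sum minus `k` plus one, is `B + 1`, the first part of `F'`. -/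
theorem isRestriction_of_combine {F : SimpleForestTriple (G₁.sum G₂)} {F' : SimpleForestTriple G₂}
    {L : List Block} (hL : IsLeft G₁ (F'.1.firstPart - 1) L)
    (hF : F.1.blocks = combine G₁.n L F'.1.blocks) : IsRestriction F F' := by
  classical
  have hpos := G₁.pos
  have hR := F'.1.isForest_blocks
  have hs := (F'.1.isSimple_iff).1 F'.2
  obtain ⟨D, R, hDR, hD, hc, hb, hf⟩ := hR.exists_cons
  rw [F'.1.firstPart_eq] at hL
  rw [hDR] at hR hF hL hs hf
  obtain ⟨L₁, C, L₂, rfl, hC, hL₁, hL₂⟩ := hL.exists_split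
  obtain ⟨T₁, S, T₂, T₃, hT, hT₁, hT₂, hT₃, hSw, hSc, hSr, hnum, hseg, hp₁, hpS, hSn, hp₂, hp₃⟩ :=
    exists_triple_of_combine hR hL hD hC hL₁ hL₂ hF
  obtain ⟨S', l, hF', hS', hl⟩ := List.map_eq_cons_iff.1 hDR
  have hS'w : S'.list = D.word := congrArg Block.word hS'
  have hS'c : S'.comp = D.comp := congrArg Block.comp hS'
  have hS'r : S'.r = D.r := congrArg Block.r hS'
  have hCL := hL.isLeftBlock C (by simp)
  refine ⟨S, by simp [hT], hSn, S', l, hF', ?_, ?_, ?_, ?_⟩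
  · rw [hnum, hSw, List.drop_left, hS'w, hD, List.map_cons, List.tail_cons,
      Nat.add_sub_cancel' hpos]
  · have h₃ := hCL.comp_sum
    simp only [hC, if_true, hf] at h₃
    rw [hseg, hnum, hSc, List.drop_left, List.take_left, hS'c, h₃]
    nth_rewrite 1 [hc]
    congr 1
    omega
  · rw [hS'r]; exact hs D (by simp)
  · have hfilter : F.1.triples.filter (fun S => ¬ S.IsPresent G₁.n) = T₃ := by
      rw [hT, List.filter_append, List.filter_cons, List.filter_append,
        List.filter_eq_nil_iff.2 (fun T h => by simpa using (hp₁ T h).1),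
        List.filter_eq_nil_iff.2 (fun T h => by simpa using (hp₂ T h).1),
        List.filter_eq_self.2 (fun T h => by simpa using hp₃ T h)]
      simp [hpS]
    rw [hfilter]
    rw [← hl, List.map_map] at hT₃
    have h := List.forall₂_map_left_iff.1 (List.forall₂_map_right_iff.1
      ((congrFun₂ List.forall₂_eq_eq_eq _ _).mpr hT₃))
    refine h.imp fun T T' h => ?_
    exact ⟨congrArg Block.word h, (congrArg Block.comp h).symm, (congrArg Block.r h).symm⟩

/-- This turns the bound on the segment number into a condition on the left part alone. -/
theorem seg_of_combine {F : ForestTriple (G₁.sum G₂)} {R L : List Block} {B : ℕ}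
    (hR : IsForest G₂ R) (hL : IsLeft G₁ B L) (hF : F.blocks = combine G₁.n L R) :
    F.seg G₁.n = (L.map fun C => C.comp.length).sum := by
  classical
  obtain ⟨D, R, rfl, hD, hc, hb, hf⟩ := hR.exists_cons
  obtain ⟨L₁, C, L₂, rfl, hC, hL₁, hL₂⟩ := hL.exists_split
  obtain ⟨T₁, S, T₂, T₃, hT, rfl, rfl, hT₃, hSw, hSc, hSr, hnum, hseg, hp₁, hpS, hSn, hp₂, hp₃⟩ :=
    exists_triple_of_combine hR hL hD hC hL₁ hL₂ hF
  have hfilter : F.triples.filter (fun S => S.IsPresent G₁.n) = T₁ ++ S :: T₂ := by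
    rw [hT, List.filter_append, List.filter_cons, List.filter_append,
      List.filter_eq_self.2 (fun T h => by simpa using (hp₁ T h).1),
      List.filter_eq_self.2 (fun T h => by simpa using (hp₂ T h).1),
      List.filter_eq_nil_iff.2 (fun T h => by simpa using hp₃ T h)]
    simp [hpS]
  have hmap : ∀ l : List (TreeTriple (G₁.sum G₂)), (∀ T ∈ l, G₁.n ∉ T.verts) →
      l.map (fun S => if G₁.n ∈ S.verts then S.seg G₁.n else S.comp.length) =
        (l.map TreeTriple.toBlock).map fun C => C.comp.length := by
    intro l hl
    rw [List.map_map]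
    refine List.map_congr_left fun T hT => ?_
    simp [hl T hT, TreeTriple.toBlock]
  rw [ForestTriple.seg]
  convert_to ((F.triples.filter fun S => S.IsPresent G₁.n).map _).sum = _
  rw [hfilter, List.map_append, List.map_cons, hmap T₁ (fun T h => (hp₁ T h).2),
    hmap T₂ (fun T h => (hp₂ T h).2)]
  simp [hSn, hseg]

end restriction

/-! ### Sign-reversing involutions -/

/-- There is a sign-reversing involution without fixed points on `s` that preserves `key`. -/
def Cancels {α κ : Type*} (s : Set α) (key : α → κ) (sgn : α → ℤ) : Prop :=
  ∃ ψ : α → α, ∀ x ∈ s, ψ x ∈ s ∧ ψ (ψ x) = x ∧ key (ψ x) = key x ∧ sgn (ψ x) = -sgn x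

namespace Cancels

variable {α β κ κ' ι : Type*} {s : Set α} {key : α → κ} {sgn : α → ℤ}

theorem of_fibers (c : α → ι) (h : ∀ i, Cancels {x ∈ s | c x = i} key sgn) :
    Cancels s key sgn := by
  choose ψ hψ using h
  refine ⟨fun x => ψ (c x) x, fun x hx => ?_⟩
  obtain ⟨h₁, h₂, h₃, h₄⟩ := hψ (c x) x ⟨hx, rfl⟩
  refine ⟨h₁.1, ?_, h₃, h₄⟩
  show ψ (c (ψ (c x) x)) (ψ (c x) x) = x
  rw [h₁.2, h₂]

/-- Only elements with equal `key'` are compared, so `g` may change the statistics and the sign in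
any way that is constant on the fibres of `key'`. -/
theorem transport {t : Set β} {key' : β → κ'} {sgn' : β → ℤ} (h : Cancels t key' sgn')
    (g : β → α) (hmaps : ∀ y ∈ t, g y ∈ s) (hinj : Set.InjOn g t) (hsurj : ∀ x ∈ s, ∃ y ∈ t, g y = x)
    (hkey : ∀ y ∈ t, ∀ z ∈ t, key' y = key' z → key (g y) = key (g z))
    (hsgn : ∀ y ∈ t, ∀ z ∈ t, key' y = key' z → sgn' y = -sgn' z → sgn (g y) = -sgn (g z)) :
    Cancels s key sgn := by
  classical
  obtain ⟨ψ, hψ⟩ := h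
  rcases isEmpty_or_nonempty β with hβ | hβ
  · exact ⟨id, fun x hx => (hβ.false (hsurj x hx).choose).elim⟩
  choose! f hf using hsurj
  have hfg : ∀ y ∈ t, f (g y) = y := fun y hy =>
    hinj (hf _ (hmaps y hy)).1 hy (hf _ (hmaps y hy)).2
  refine ⟨fun x => g (ψ (f x)), fun x hx => ?_⟩
  obtain ⟨h₁, h₂⟩ := hf x hx
  obtain ⟨h₃, h₄, h₅, h₆⟩ := hψ _ h₁
  refine ⟨hmaps _ h₃, ?_, ?_, ?_⟩
  · show g (ψ (f (g (ψ (f x))))) = x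
    rw [hfg _ h₃, h₄, h₂]
  · rw [hkey _ h₃ _ h₁ h₅, h₂]
  · rw [hsgn _ h₃ _ h₁ h₅ h₆, h₂]

theorem mono_key {key' : α → κ'} (h : Cancels s key sgn)
    (hk : ∀ x ∈ s, ∀ y ∈ s, key x = key y → key' x = key' y) : Cancels s key' sgn := by
  refine h.transport id (fun _ h => h) (Set.injOn_id _) (fun x hx => ⟨x, hx, rfl⟩) hk ?_
  intro y _ z _ _ h
  exact h

/-- There are as many elements of sign `1` as of sign `-1`, and an arbitrary bijection between the
two sets gives the involution. -/
theorem of_sum_eq_zero {s : Finset α} (hs : ∀ x ∈ s, sgn x = 1 ∨ sgn x = -1)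
    (h : ∑ x ∈ s, sgn x = 0) (hk : ∀ x ∈ s, ∀ y ∈ s, key x = key y) :
    Cancels (↑s : Set α) key sgn := by
  classical
  have hcard : (s.filter (sgn · = 1)).card = (s.filter (sgn · = -1)).card := by
    have h₁ : ∀ x ∈ s, sgn x = (if sgn x = 1 then 1 else 0) - (if sgn x = -1 then 1 else 0) := by
      intro x hx
      rcases hs x hx with h | h <;> simp [h]
    rw [Finset.sum_congr rfl h₁, Finset.sum_sub_distrib, Finset.sum_boole, Finset.sum_boole] at h
    have := sub_eq_zero.1 h
    exact_mod_cast this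
  let e := Finset.equivOfCardEq hcard
  have he : ∀ x (hx : x ∈ s.filter (sgn · = 1)), (e ⟨x, hx⟩ : α) ∈ s ∧ sgn (e ⟨x, hx⟩) = -1 :=
    fun x hx => Finset.mem_filter.1 (e ⟨x, hx⟩).2
  have he' : ∀ x (hx : x ∈ s.filter (sgn · = -1)), (e.symm ⟨x, hx⟩ : α) ∈ s ∧
      sgn (e.symm ⟨x, hx⟩) = 1 := fun x hx => Finset.mem_filter.1 (e.symm ⟨x, hx⟩).2
  refine ⟨fun x => if hx : x ∈ s.filter (sgn · = 1) then e ⟨x, hx⟩ else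
    if hx : x ∈ s.filter (sgn · = -1) then e.symm ⟨x, hx⟩ else x, fun x hx => ?_⟩
  have hx' : x ∈ s := hx
  rcases hs x hx with h | h
  · have hP : x ∈ s.filter (sgn · = 1) := by simp [hx', h]
    have h₁ := he x hP
    have hP' : (e ⟨x, hP⟩ : α) ∉ s.filter (sgn · = 1) := by simp [h₁]
    have hN' : (e ⟨x, hP⟩ : α) ∈ s.filter (sgn · = -1) := (e ⟨x, hP⟩).2
    simp only [hP, hP', hN', dif_pos, dif_neg, not_false_eq_true]
    refine ⟨h₁.1, by simp, hk _ h₁.1 _ hx, by rw [h₁.2, h]⟩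
  · have hP : x ∉ s.filter (sgn · = 1) := by simp [h]
    have hN : x ∈ s.filter (sgn · = -1) := by simp [hx', h]
    have h₁ := he' x hN
    have hP' : (e.symm ⟨x, hN⟩ : α) ∈ s.filter (sgn · = 1) := (e.symm ⟨x, hN⟩).2
    simp only [hP, hP', hN, dif_pos, dif_neg, not_false_eq_true]
    refine ⟨h₁.1, by simp, hk _ h₁.1 _ hx, by rw [h₁.2, h]; rfl⟩

open Polynomial in
-- Each coefficient of the polynomial is the sum of the signs over one weight.
theorem of_genFun_eq_zero {s : Finset α} {w : α → ℕ} (hs : ∀ x ∈ s, sgn x = 1 ∨ sgn x = -1)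
    (h : ∑ x ∈ s, (C (sgn x) * X ^ w x : ℤ[X]) = 0) : Cancels (↑s : Set α) w sgn := by
  classical
  refine of_fibers w fun n => ?_
  have hset : {x ∈ (↑s : Set α) | w x = n} = ↑(s.filter (w · = n)) := by ext; simp
  rw [hset]
  refine of_sum_eq_zero (fun x hx => hs x (Finset.mem_filter.1 hx).1) ?_ ?_
  · have := congrArg (fun p => coeff p n) h
    simp only [finsetSum_coeff, coeff_C_mul, coeff_X_pow, coeff_zero] at this
    rw [Finset.sum_filter]
    refine Eq.trans ?_ this
    refine Finset.sum_congr rfl fun x _ => ?_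
    by_cases hx : w x = n
    · simp [hx]
    · simp [hx, Ne.symm hx]
  · intro x hx y hy
    rw [(Finset.mem_filter.1 hx).2, (Finset.mem_filter.1 hy).2]

end Cancels

/-! ### Counting words by inversions -/

section words

/-- The words in which each letter of `S` occurs exactly once. -/
def words (S : Finset ℕ) : Finset (List ℕ) := S.val.lists.toFinset

theorem mem_words {S : Finset ℕ} {l : List ℕ} :
    l ∈ words S ↔ l.Nodup ∧ ∀ x, x ∈ l ↔ x ∈ S := by
  rw [words, Multiset.mem_toFinset, Multiset.mem_lists_iff]
  constructor
  · intro h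
    have h : S.val = ↑l := h
    refine ⟨by rw [← Multiset.coe_nodup, ← h]; exact S.nodup, fun x => ?_⟩
    rw [← Finset.mem_val, h, Multiset.mem_coe]
  · rintro ⟨h₁, h₂⟩
    show S.val = ↑l
    rw [Multiset.Nodup.ext S.nodup (Multiset.coe_nodup.2 h₁)]
    intro x
    rw [Multiset.mem_coe, h₂, Finset.mem_val]

theorem length_of_mem_words {S : Finset ℕ} {l : List ℕ} (h : l ∈ words S) : l.length = S.card := by
  have : l.toFinset = S := by ext x; simp [(mem_words.1 h).2]
  rw [← this, List.toFinset_card_of_nodup (mem_words.1 h).1]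

theorem cons_mem_words {S : Finset ℕ} {x : ℕ} {l : List ℕ} :
    x :: l ∈ words S ↔ x ∈ S ∧ l ∈ words (S.erase x) := by
  simp only [mem_words, List.nodup_cons, List.mem_cons, Finset.mem_erase]
  constructor
  · rintro ⟨⟨h₁, h₂⟩, h₃⟩
    refine ⟨(h₃ x).1 (Or.inl rfl), h₂, fun y => ?_⟩
    rw [← h₃ y]
    constructor
    · intro h
      exact ⟨fun h' => h₁ (h' ▸ h), Or.inr h⟩
    · rintro ⟨h, h' | h'⟩
      · exact absurd h' h
      · exact h'
  · rintro ⟨h₁, h₂, h₃⟩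
    refine ⟨⟨fun h => ((h₃ x).1 h).1 rfl, h₂⟩, fun y => ?_⟩
    rw [h₃ y]
    by_cases h : y = x
    · simp [h, h₁]
    · simp [h]

theorem words_empty : words ∅ = {[]} := by
  ext l
  rw [mem_words, Finset.mem_singleton]
  constructor
  · rintro ⟨-, h⟩
    exact List.eq_nil_iff_forall_not_mem.2 (by simpa using h)
  · rintro rfl; simp

theorem sum_words {M : Type*} [AddCommMonoid M] {S : Finset ℕ} (hS : S.Nonempty)
    (f : List ℕ → M) : ∑ l ∈ words S, f l = ∑ x ∈ S, ∑ l ∈ words (S.erase x), f (x :: l) := by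
  rw [Finset.sum_sigma']
  symm
  refine Finset.sum_bij (fun p _ => p.1 :: p.2) ?_ ?_ ?_ ?_
  · rintro ⟨x, l⟩ h
    simpa [cons_mem_words] using h
  · rintro ⟨x, l⟩ _ ⟨x', l'⟩ _ h
    simp only [List.cons.injEq] at h
    obtain ⟨rfl, rfl⟩ := h
    rfl
  · intro l hl
    cases l with
    | nil =>
      obtain ⟨x, hx⟩ := hS
      simpa using ((mem_words.1 hl).2 x).2 hx
    | cons x l => exact ⟨⟨x, l⟩, by simpa [cons_mem_words] using hl, rfl⟩
  · intros; rfl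

/-- The number of inversions of a word. -/
def invs : List ℕ → ℕ
  | [] => 0
  | x :: l => l.countP (· < x) + invs l

theorem countP_lt_of_mem_words {S : Finset ℕ} {l : List ℕ} (h : l ∈ words S) (x : ℕ) :
    l.countP (· < x) = (S.filter (· < x)).card := by
  have h₁ : (l.filter (· < x)).toFinset = S.filter (· < x) := by
    ext y; simp [(mem_words.1 h).2]
  rw [← h₁, List.toFinset_card_of_nodup ((mem_words.1 h).1.filter _), List.countP_eq_length_filter]

open Polynomial

/-- The `q`-analogue of `n`. -/
noncomputable def qNum (n : ℕ) : ℤ[X] := ∑ i ∈ Finset.range n, X ^ i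

/-- The `q`-factorial. -/
noncomputable def qFact : ℕ → ℤ[X]
  | 0 => 1
  | n + 1 => qNum (n + 1) * qFact n

theorem qFact_eq {n : ℕ} (hn : 1 ≤ n) : qFact n = qNum n * qFact (n - 1) := by
  obtain ⟨m, rfl⟩ := Nat.exists_eq_add_of_le' hn
  rfl

theorem sum_X_pow_card_lt (S : Finset ℕ) :
    ∑ x ∈ S, (X ^ (S.filter (· < x)).card : ℤ[X]) = qNum S.card := by
  induction S using Finset.induction_on_max with
  | empty => simp [qNum]
  | insert a S ha ih =>
    have haS : a ∉ S := fun h => lt_irrefl _ (ha a h)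
    rw [Finset.sum_insert haS, Finset.card_insert_of_notMem haS, qNum, Finset.sum_range_succ,
      ← qNum, ← ih, add_comm]
    congr 1
    · refine Finset.sum_congr rfl fun x hx => ?_
      rw [Finset.filter_insert, if_neg (by have := ha x hx; omega)]
    · rw [Finset.filter_insert, if_neg (lt_irrefl _), Finset.filter_true_of_mem ha]

open Classical in
/-- The generating function by inversions of the words with letters `S` that satisfy `P`. -/
noncomputable def gf (S : Finset ℕ) (P : List ℕ → Prop) : ℤ[X] :=
  ∑ l ∈ words S, if P l then X ^ invs l else 0

theorem gf_congr {S : Finset ℕ} {P Q : List ℕ → Prop} (h : ∀ l ∈ words S, (P l ↔ Q l)) :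
    gf S P = gf S Q := by
  refine Finset.sum_congr rfl fun l hl => ?_
  by_cases hP : P l
  · rw [if_pos hP, if_pos ((h l hl).1 hP)]
  · rw [if_neg hP, if_neg (fun hQ => hP ((h l hl).2 hQ))]

theorem gf_split {S : Finset ℕ} (P Q : List ℕ → Prop) :
    gf S P = gf S (fun l => P l ∧ Q l) + gf S (fun l => P l ∧ ¬ Q l) := by
  rw [gf, gf, gf, ← Finset.sum_add_distrib]
  refine Finset.sum_congr rfl fun l _ => ?_
  by_cases hP : P l <;> by_cases hQ : Q l <;> simp [hP, hQ]

theorem gf_false {S : Finset ℕ} {P : List ℕ → Prop} (h : ∀ l ∈ words S, ¬ P l) : gf S P = 0 :=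
  Finset.sum_eq_zero fun l hl => if_neg (h l hl)

theorem gf_cons {S : Finset ℕ} (hS : S.Nonempty) (P : List ℕ → Prop) :
    gf S P = ∑ x ∈ S, X ^ (S.filter (· < x)).card * gf (S.erase x) (fun l => P (x :: l)) := by
  rw [gf, sum_words hS]
  refine Finset.sum_congr rfl fun x hx => ?_
  rw [gf, Finset.mul_sum]
  refine Finset.sum_congr rfl fun l hl => ?_
  have h : (S.erase x).filter (· < x) = S.filter (· < x) := by
    ext y
    simp only [Finset.mem_filter, Finset.mem_erase]
    constructor
    · rintro ⟨⟨-, h₁⟩, h₂⟩; exact ⟨h₁, h₂⟩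
    · rintro ⟨h₁, h₂⟩; exact ⟨⟨by omega, h₁⟩, h₂⟩
  have e : invs (x :: l) = (S.filter (· < x)).card + invs l := by
    rw [invs, countP_lt_of_mem_words hl, h]
  rw [e, pow_add]
  by_cases hP : P (x :: l) <;> simp [hP]

theorem gf_true (S : Finset ℕ) : gf S (fun _ => True) = qFact S.card := by
  induction hn : S.card generalizing S with
  | zero =>
    rw [Finset.card_eq_zero] at hn
    simp [hn, gf, words_empty, invs, qFact]
  | succ n ih =>
    have hS : S.Nonempty := Finset.card_pos.1 (by omega)
    rw [gf_cons hS, qFact, ← hn, ← sum_X_pow_card_lt, Finset.sum_mul]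
    refine Finset.sum_congr rfl fun x hx => ?_
    rw [ih _ (by rw [Finset.card_erase_of_mem hx]; omega)]

/-- The first letter of the word is its smallest one. -/
def MinHead (l : List ℕ) : Prop := ∀ z ∈ l, l.headD 0 ≤ z

theorem gf_minHead {S : Finset ℕ} {b : ℕ} (hb : b ∈ S) (hmin : ∀ x ∈ S, b ≤ x)
    (P : List ℕ → Prop) :
    gf S (fun l => MinHead l ∧ P l) = gf (S.erase b) (fun l => P (b :: l)) := by
  rw [gf_cons ⟨b, hb⟩, Finset.sum_eq_single b]
  · rw [Finset.filter_false_of_mem (by intro x hx; have := hmin x hx; omega)]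
    simp only [Finset.card_empty, pow_zero, one_mul]
    refine gf_congr fun l hl => and_iff_right ?_
    intro z hz
    rcases List.mem_cons.1 hz with rfl | hz
    · exact le_rfl
    · exact hmin z (Finset.mem_of_mem_erase (((mem_words.1 hl).2 z).1 hz))
  · intro x hx hxb
    rw [gf_false, mul_zero]
    rintro l hl ⟨h, -⟩
    have := h b (List.mem_cons_of_mem _ (((mem_words.1 hl).2 b).2 (Finset.mem_erase.2
      ⟨hxb.symm, hb⟩)))
    have := hmin x hx
    simp only [List.headD_cons] at *
    omega
  · exact fun h => absurd hb h

theorem gf_minHead_true {S : Finset ℕ} (hS : S.Nonempty) :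
    gf S (fun l => MinHead l) = qFact (S.card - 1) := by
  have h := gf_minHead (S.min'_mem hS) (fun x hx => S.min'_le x hx) (fun _ => True)
  simp only [and_true] at h
  rw [h, gf_true, Finset.card_erase_of_mem (S.min'_mem hS)]

theorem sum_X_pow_card_lt_ne_max {S : Finset ℕ} {a : ℕ} (ha : a ∈ S) (hmax : ∀ x ∈ S, x ≤ a) :
    ∑ x ∈ S.erase a, (X ^ (S.filter (· < x)).card : ℤ[X]) = qNum (S.card - 1) := by
  rw [← Finset.card_erase_of_mem ha, ← sum_X_pow_card_lt]
  refine Finset.sum_congr rfl fun x hx => ?_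
  congr 2
  ext y
  simp only [Finset.mem_filter, Finset.mem_erase]
  have := hmax x (Finset.mem_of_mem_erase hx)
  have := (Finset.mem_erase.1 hx).1
  constructor
  · rintro ⟨h₁, h₂⟩
    exact ⟨⟨by omega, h₁⟩, h₂⟩
  · rintro ⟨⟨-, h₁⟩, h₂⟩
    exact ⟨h₁, h₂⟩

/-- Removing a first letter other than the maximum `a` contributes `[|S|-1]`, because `a` is smaller
than none of the other letters. This is the induction step for the counts with `a` in a late
position. -/
theorem gf_cons_max {S : Finset ℕ} {a : ℕ} (ha : a ∈ S) (hmax : ∀ x ∈ S, x ≤ a)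
    {P : List ℕ → Prop} (hP : ∀ l ∈ words (S.erase a), ¬ P (a :: l)) {q : ℤ[X]}
    (hq : ∀ x ∈ S.erase a, gf (S.erase x) (fun l => P (x :: l)) = q) :
    gf S P = qNum (S.card - 1) * q := by
  rw [gf_cons ⟨a, ha⟩, ← Finset.add_sum_erase S _ ha, gf_false hP, mul_zero, zero_add,
    ← sum_X_pow_card_lt_ne_max ha hmax, Finset.sum_mul]
  exact Finset.sum_congr rfl fun x hx => by rw [hq x hx]

/-- With `n = |S|` and positions counted from `0`, the maximum in position `i` makes `n - 1 - i`
inversions. The positions from `m` on give `[n - m]`, and the other letters are free. -/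
theorem gf_mem_drop {S : Finset ℕ} {a m : ℕ} (ha : a ∈ S) (hmax : ∀ x ∈ S, x ≤ a)
    (hm : m < S.card) :
    gf S (fun l => a ∈ l.drop m) = qNum (S.card - m) * qFact (S.card - 1) := by
  induction m generalizing S with
  | zero =>
    rw [gf_congr (Q := fun _ => True), gf_true, qFact_eq (by omega), Nat.sub_zero]
    intro l hl
    simpa [(mem_words.1 hl).2] using ha
  | succ m ih =>
    rw [gf_cons_max ha hmax (q := qNum (S.card - (m + 1)) * qFact (S.card - 1 - 1)),
      qFact_eq (n := S.card - 1) (by omega)]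
    · ring
    · intro l hl h
      have := ((mem_words.1 hl).2 a).1 (List.mem_of_mem_drop h)
      simp at this
    · intro x hx
      have hx' := Finset.mem_erase.1 hx
      have hc : (S.erase x).card = S.card - 1 := Finset.card_erase_of_mem hx'.2
      have := ih (S := S.erase x) (Finset.mem_erase.2 ⟨hx'.1.symm, ha⟩)
        (fun y hy => hmax y (Finset.mem_of_mem_erase hy)) (by omega)
      simp only [List.drop_succ_cons]
      rw [this, hc]
      congr 2
      omega

/-- Compared with `gf_mem_drop`, requiring the last `|S| - m` letters to begin with their least one
removes the factor `[|S| - m]`. -/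
theorem gf_mem_drop_minHead {S : Finset ℕ} {a m : ℕ} (ha : a ∈ S) (hmax : ∀ x ∈ S, x ≤ a)
    (hm : m < S.card) :
    gf S (fun l => a ∈ l.drop m ∧ MinHead (l.drop m)) = qFact (S.card - 1) := by
  induction m generalizing S with
  | zero =>
    rw [gf_congr (Q := fun l => MinHead l), gf_minHead_true ⟨a, ha⟩]
    intro l hl
    simp [(mem_words.1 hl).2, ha]
  | succ m ih =>
    rw [gf_cons_max ha hmax (q := qFact (S.card - 1 - 1)), ← qFact_eq (by omega)]
    · rintro l hl ⟨h, -⟩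
      have := ((mem_words.1 hl).2 a).1 (List.mem_of_mem_drop h)
      simp at this
    · intro x hx
      have hx' := Finset.mem_erase.1 hx
      have hc : (S.erase x).card = S.card - 1 := Finset.card_erase_of_mem hx'.2
      have := ih (S := S.erase x) (Finset.mem_erase.2 ⟨hx'.1.symm, ha⟩)
        (fun y hy => hmax y (Finset.mem_of_mem_erase hy)) (by omega)
      simp only [List.drop_succ_cons]
      rw [this, hc]

theorem gf_head_max {S : Finset ℕ} {a : ℕ} (ha : a ∈ S) (hmax : ∀ x ∈ S, x ≤ a) :
    gf S (fun l => l.head? = some a) = X ^ (S.card - 1) * qFact (S.card - 1) := by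
  rw [gf_cons ⟨a, ha⟩, Finset.sum_eq_single a]
  · have h : S.filter (· < a) = S.erase a := by
      ext y
      simp only [Finset.mem_filter, Finset.mem_erase]
      constructor
      · rintro ⟨h₁, h₂⟩; exact ⟨by omega, h₁⟩
      · rintro ⟨h₁, h₂⟩; exact ⟨h₂, lt_of_le_of_ne (hmax y h₂) h₁⟩
    rw [h, Finset.card_erase_of_mem ha, gf_congr (Q := fun _ => True) (by simp), gf_true,
      Finset.card_erase_of_mem ha]
  · intro x hx hxa
    rw [gf_false, mul_zero]
    intro l _
    simpa using hxa
  · exact fun h => absurd ha h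

/-- A condition on the first `m` letters leaves the order of the other `n - m` free, where `n =
|S|`. These contribute `(n-m)! = [n-m](n-m-1)!`, and the second factor counts the orders beginning
with the least letter. -/
theorem gf_take_minHead {S : Finset ℕ} {m : ℕ} (hm : m < S.card) (Q : List ℕ → Prop) :
    qNum (S.card - m) * gf S (fun l => Q (l.take m) ∧ MinHead (l.drop m)) =
      gf S (fun l => Q (l.take m)) := by
  induction m generalizing S Q with
  | zero =>
    have hS : S.Nonempty := Finset.card_pos.1 hm
    by_cases hQ : Q []
    · simp only [List.take_zero, List.drop_zero, hQ, true_and, Nat.sub_zero]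
      rw [gf_minHead_true hS, gf_true, ← qFact_eq hm]
    · rw [gf_false (by simp [hQ]), gf_false (by simp [hQ]), mul_zero]
  | succ m ih =>
    have hS : S.Nonempty := Finset.card_pos.1 (by omega)
    rw [gf_cons hS, gf_cons hS, Finset.mul_sum]
    refine Finset.sum_congr rfl fun x hx => ?_
    have hc : (S.erase x).card = S.card - 1 := Finset.card_erase_of_mem hx
    simp only [List.take_succ_cons, List.drop_succ_cons]
    rw [← ih (S := S.erase x) (by omega) (fun l => Q (x :: l)), hc,
      show S.card - 1 - m = S.card - (m + 1) by omega]
    ring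

end words

/-! ### Forest triples as lists of parts -/

/-- A part of the composition of a tree triple, with the segment of the tree list that it covers;
`flag` is the integer `r` of the triple if the part is the first one, and `none` otherwise. -/
structure Piece where
  flag : Option ℕ
  seg : List ℕ

namespace Piece

/-- The contribution to the sign. -/
def sign (x : Piece) : ℤ := if x.flag.isNone then -1 else 1

/-- The contribution of `r` to the weight. -/
def rank (x : Piece) : ℕ := x.flag.getD 1 - 1

end Piece

/-- Whether a tree that contains `a` is being read after the part `x`. -/
def nextCur (a : ℕ) (cur : Bool) (x : Piece) : Bool := decide (a ∈ x.seg) || (cur && x.flag.isNone)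

/-- Whether the current tree ends before the remaining parts `l`. -/
def closes : List Piece → Bool
  | [] => true
  | x :: _ => x.flag.isSome

/-- The size of a part: the last part of the tree containing `a` gets `B` extra vertices. -/
def partSize (a B : ℕ) (cur : Bool) (x : Piece) (l : List Piece) : ℕ :=
  x.seg.length + if nextCur a cur x && closes l then B else 0

/-- The sizes of the parts. -/
def sizes (a B : ℕ) : Bool → List Piece → List ℕ
  | _, [] => []
  | cur, x :: l => partSize a B cur x l :: sizes a B (nextCur a cur x) l

/-- The list of parts encodes the end of a forest triple of a complete graph, with remaining
letters `S`. -/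
def Good (a B : ℕ) : Bool → Finset ℕ → List Piece → Prop
  | _, S, [] => S = ∅
  | cur, S, x :: l => x.seg ≠ [] ∧ x.seg.Nodup ∧ (∀ z ∈ x.seg, z ∈ S) ∧
      (∀ r, x.flag = some r → 1 ≤ r ∧ r ≤ partSize a B cur x l ∧ ∀ z ∈ S, x.seg.headD 0 ≤ z) ∧
      Good a B (nextCur a cur x) (S \ x.seg.toFinset) l

/-- The sign of a list of parts. -/
def partSign (l : List Piece) : ℤ := (l.map Piece.sign).prod

/-- The weight of a list of parts. -/
def partWeight (l : List Piece) : ℕ := invs (l.flatMap Piece.seg) + (l.map Piece.rank).sum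

/-- The statistics to be preserved. -/
def partKey (a B : ℕ) (cur : Bool) (l : List Piece) : Multiset ℕ × ℕ × Bool :=
  (↑(sizes a B cur l), partWeight l, cur && closes l)

section parts

variable {a B : ℕ} {cur : Bool} {S : Finset ℕ} {l : List Piece}

theorem Piece.sign_cases (x : Piece) : x.sign = 1 ∨ x.sign = -1 := by
  unfold Piece.sign
  split <;> simp

theorem partSign_cases (l : List Piece) : partSign l = 1 ∨ partSign l = -1 := by
  induction l with
  | nil => simp [partSign]
  | cons x l ih =>
    rw [partSign, List.map_cons, List.prod_cons]
    rcases x.sign_cases with h | h <;> rcases ih with h' | h' <;> rw [partSign] at h' <;> simp [h, h']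

theorem Good.mem_words (h : Good a B cur S l) : l.flatMap Piece.seg ∈ words S := by
  induction l generalizing cur S with
  | nil =>
    have h : S = ∅ := h
    simp [h, words_empty]
  | cons x l ih =>
    obtain ⟨-, h₁, h₂, -, h₃⟩ := h
    have ih := _root_.mem_words.1 (ih h₃)
    rw [_root_.mem_words, List.flatMap_cons, List.nodup_append]
    refine ⟨⟨h₁, ih.1, ?_⟩, fun z => ?_⟩
    · rintro z hz z' hz' rfl
      have := (ih.2 z).1 hz'
      simp [hz] at this
    · rw [List.mem_append, ih.2, Finset.mem_sdiff, List.mem_toFinset]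
      by_cases hz : z ∈ x.seg
      · simp [hz, h₂ z hz]
      · simp [hz]

/-- The inversions between `u` and `v` depend only on the letters of `v`. Thus, once a leading part
is fixed, the weight changes exactly as that of the tail does. -/
theorem invs_append_add {u v v' : List ℕ} (h : v.Perm v') :
    invs (u ++ v) + invs v' = invs (u ++ v') + invs v := by
  induction u with
  | nil => simp [add_comm]
  | cons x u ih =>
    have := h.countP_eq (· < x)
    simp only [List.cons_append, invs, List.countP_append]
    omega

theorem perm_of_mem_words {v v' : List ℕ} (h : v ∈ words S) (h' : v' ∈ words S) : v.Perm v' := by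
  rw [List.perm_ext_iff_of_nodup (_root_.mem_words.1 h).1 (_root_.mem_words.1 h').1]
  intro z
  rw [(_root_.mem_words.1 h).2, (_root_.mem_words.1 h').2]

/-- The lists of parts of length `n`; if `forb` holds, then the first part may not continue a tree
with the letter `a`. -/
def partSet (a B : ℕ) (forb : Prop) (cur : Bool) (S : Finset ℕ) (n : ℕ) : Set (List Piece) :=
  {l | Good a B cur S l ∧ l.length = n ∧
    (forb → ∀ x ∈ l.head?, x.flag = none → x.seg.head? ≠ some a)}

theorem Cancels.restrict {α κ : Type*} {s t : Set α} {key : α → κ} {sgn : α → ℤ}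
    (h : Cancels s key sgn) (hts : t ⊆ s) (ht : ∀ x ∈ t, ∀ y ∈ s, key y = key x → y ∈ t) :
    Cancels t key sgn := by
  obtain ⟨ψ, hψ⟩ := h
  refine ⟨ψ, fun x hx => ?_⟩
  obtain ⟨h₁, h₂, h₃, h₄⟩ := hψ x (hts hx)
  exact ⟨ht x hx _ h₁ h₃, h₂, h₃, h₄⟩

theorem Cancels.of_forall_notMem {α κ : Type*} {s : Set α} {key : α → κ} {sgn : α → ℤ}
    (h : ∀ x, x ∉ s) : Cancels s key sgn := ⟨id, fun x hx => absurd hx (h x)⟩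

/-- A cancellation of the remaining parts gives one of the lists that begin with a given part. -/
theorem cancels_cons_of_forb {forb forb' : Prop} {n : ℕ} (x : Piece)
    (h : Cancels (partSet a B forb' (nextCur a cur x) (S \ x.seg.toFinset) n)
      (partKey a B (nextCur a cur x)) partSign) :
    Cancels {l | ∃ l', l = x :: l' ∧ l ∈ partSet a B forb cur S (n + 1) ∧
        (forb' → ∀ y ∈ l'.head?, y.flag = none → y.seg.head? ≠ some a)}
      (fun l => (partKey a B cur l, (sizes a B cur l).head?)) partSign := by
  -- The size of `x` depends on the tail only through the bit saying whether the tree containing `a`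
  -- closes right after `x`. This is why `partKey` records that bit.
  have hcl : ∀ l l' : List Piece,
      partKey a B (nextCur a cur x) l = partKey a B (nextCur a cur x) l' →
        partSize a B cur x l = partSize a B cur x l' := by
    intro l l' hk
    rw [partSize, partSize, show (nextCur a cur x && closes l) = (nextCur a cur x && closes l') from
      congrArg (fun k => k.2.2) hk]
  -- For fixed `x`, a valid tail may be prefixed by `x` only if the `r` of `x` is at most the size
  -- of `x`, and equal keys give equal sizes. So the admissible tails are closed under equality of
  -- keys.
  have h' := h.restrict (t := {l | x :: l ∈ partSet a B forb cur S (n + 1) ∧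
        (forb' → ∀ y ∈ l.head?, y.flag = none → y.seg.head? ≠ some a)}) ?_ ?_
  · refine h'.transport (x :: ·) ?_ ?_ ?_ ?_ ?_
    · intro l hl
      exact ⟨l, rfl, hl⟩
    · intro l _ l' _ hl
      exact (List.cons.inj hl).2
    · rintro _ ⟨l, rfl, hl⟩
      exact ⟨l, hl, rfl⟩
    · intro l hl l' hl' hk
      have hw := hl.1.1.2.2.2.2.mem_words
      have hw' := hl'.1.1.2.2.2.2.mem_words
      have hi := invs_append_add (u := x.seg) (perm_of_mem_words hw hw')
      have h₁ : (↑(sizes a B _ l) : Multiset ℕ) = ↑(sizes a B _ l') := congrArg Prod.fst hk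
      have h₂ : partWeight l = partWeight l' := congrArg (fun k => k.2.1) hk
      simp only [partWeight] at h₂
      simp only [partKey, sizes, hcl l l' hk, ← Multiset.cons_coe, h₁, partWeight,
        List.flatMap_cons, List.map_cons, List.sum_cons, closes, Prod.mk.injEq, true_and, and_true,
        List.head?_cons]
      omega
    · intro l _ l' _ _ hs
      rw [partSign, partSign, List.map_cons, List.map_cons, List.prod_cons, List.prod_cons]
      rw [partSign, partSign] at hs
      rw [hs]
      ring
  · rintro l ⟨⟨hl, hn, -⟩, hf⟩
    exact ⟨hl.2.2.2.2, by simpa using hn, hf⟩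
  · rintro l ⟨⟨hl, hn, hf⟩, -⟩ l' ⟨hl', hn', hf'⟩ hk
    refine ⟨⟨⟨hl.1, hl.2.1, hl.2.2.1, ?_, hl'⟩, by simpa using hn', by simpa using hf⟩, hf'⟩
    intro r hr
    rw [hcl l' l hk]
    exact hl.2.2.2.1 r hr

theorem cancels_cons {forb : Prop} {n : ℕ} (x : Piece)
    (h : Cancels (partSet a B False (nextCur a cur x) (S \ x.seg.toFinset) n)
      (partKey a B (nextCur a cur x)) partSign) :
    Cancels {l ∈ partSet a B forb cur S (n + 1) | l.head? = some x} (partKey a B cur) partSign := by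
  have h' := (cancels_cons_of_forb (forb := forb) x h).mono_key (key' := partKey a B cur)
    fun l _ l' _ hk => congrArg Prod.fst hk
  convert h' using 1
  ext l
  constructor
  · rintro ⟨hl, hx⟩
    cases l with
    | nil => simp at hx
    | cons y l =>
      obtain rfl : y = x := by simpa using hx
      exact ⟨l, rfl, hl, False.elim⟩
  · rintro ⟨l', rfl, hl, -⟩
    exact ⟨hl, rfl⟩

end parts

/-! ### Generating functions of lists of two parts -/

section pairs

open Polynomial

/-- The two-element list of pieces with flags `i.1` obtained by cutting the word `i.2` after `k`
letters. -/
def pair (k : ℕ) (i : (Option ℕ × Option ℕ) × List ℕ) : List Piece :=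
  [⟨i.1.1, i.2.take k⟩, ⟨i.1.2, i.2.drop k⟩]

theorem pair_injective (k : ℕ) : Function.Injective (pair k) := by
  rintro ⟨⟨f, g⟩, D⟩ ⟨⟨f', g'⟩, D'⟩ h
  simp only [pair, List.cons.injEq, Piece.mk.injEq, and_true] at h
  obtain ⟨⟨rfl, h₁⟩, rfl, h₂⟩ := h
  rw [← List.take_append_drop k D, h₁, h₂, List.take_append_drop]

theorem exists_pair {l : List Piece} (h : l.length = 2) :
    ∃ k f g D, l = pair k ((f, g), D) ∧ (D.take k).length = k := by
  obtain ⟨x, y, rfl⟩ := List.length_eq_two.1 h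
  exact ⟨x.seg.length, x.flag, y.flag, x.seg ++ y.seg, by simp [pair], by simp⟩

/-- The factor contributed by a flag to the generating function. -/
noncomputable def flagTerm (f : Option ℕ) : ℤ[X] :=
  C (if f.isNone then -1 else 1) * X ^ (f.getD 1 - 1)

/-- The possible flags of a piece. -/
def flags (n : ℕ) : Finset (Option ℕ) := (Finset.Icc 1 n).insertNone

/-- The possible flags of a piece that begins a new tree. -/
def someFlags (n : ℕ) : Finset (Option ℕ) := (Finset.Icc 1 n).map .some

theorem sum_X_pow_Icc (n : ℕ) : ∑ r ∈ Finset.Icc 1 n, (X ^ (r - 1) : ℤ[X]) = qNum n := by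
  rw [qNum, Finset.range_eq_Ico, Finset.sum_Ico_eq_sum_range, ← Finset.Ico_succ_right_eq_Icc,
    Finset.sum_Ico_eq_sum_range]
  simp

theorem sum_someFlags {n : ℕ} {F : Option ℕ → ℤ[X]} {q : ℤ[X]} (h : ∀ r, F (some r) = q) :
    ∑ f ∈ someFlags n, flagTerm f * F f = qNum n * q := by
  rw [someFlags, Finset.sum_map, ← sum_X_pow_Icc, Finset.sum_mul]
  refine Finset.sum_congr rfl fun r _ => ?_
  simp [flagTerm, h]

theorem sum_flags {n : ℕ} {F : Option ℕ → ℤ[X]} {q : ℤ[X]} (h : ∀ r, F (some r) = q) :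
    ∑ f ∈ flags n, flagTerm f * F f = qNum n * q - F none := by
  rw [flags, Finset.sum_insertNone, ← sum_X_pow_Icc, Finset.sum_mul, sub_eq_neg_add]
  congr 1
  · simp [flagTerm]
  · refine Finset.sum_congr rfl fun r _ => ?_
    simp [flagTerm, h]

open Classical in
/-- The data for `pair` with flags in `A` and `A'` and letters `S` that satisfy `P`. -/
noncomputable def pairData (A A' : Finset (Option ℕ)) (S : Finset ℕ)
    (P : Option ℕ → Option ℕ → List ℕ → Prop) : Finset ((Option ℕ × Option ℕ) × List ℕ) :=
  ((A ×ˢ A') ×ˢ words S).filter fun i => P i.1.1 i.1.2 i.2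

theorem mem_pairData {A A' : Finset (Option ℕ)} {S : Finset ℕ}
    {P : Option ℕ → Option ℕ → List ℕ → Prop} {f g : Option ℕ} {D : List ℕ} :
    ((f, g), D) ∈ pairData A A' S P ↔ f ∈ A ∧ g ∈ A' ∧ D ∈ words S ∧ P f g D := by
  simp only [pairData, Finset.mem_filter, Finset.mem_product]
  tauto

theorem sum_pairData (A A' : Finset (Option ℕ)) (S : Finset ℕ)
    (P : Option ℕ → Option ℕ → List ℕ → Prop) (k : ℕ) :
    ∑ i ∈ pairData A A' S P, (C (partSign (pair k i)) * X ^ partWeight (pair k i) : ℤ[X]) =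
      ∑ f ∈ A, flagTerm f * ∑ g ∈ A', flagTerm g * gf S (P f g) := by
  classical
  rw [pairData, Finset.sum_filter, Finset.sum_product, Finset.sum_product]
  refine Finset.sum_congr rfl fun f _ => ?_
  rw [Finset.mul_sum]
  refine Finset.sum_congr rfl fun g _ => ?_
  rw [gf, Finset.mul_sum, Finset.mul_sum]
  refine Finset.sum_congr rfl fun D _ => ?_
  by_cases hP : P f g D
  · simp only [hP, if_true, partSign, partWeight, pair, flagTerm, Piece.sign, Piece.rank,
      List.map_cons, List.map_nil, List.prod_cons, List.prod_nil, List.flatMap_cons,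
      List.flatMap_nil, List.append_nil, List.take_append_drop, List.sum_cons, List.sum_nil,
      pow_add, C_mul, mul_one, pow_zero]
    ring
  · simp [hP]

/-- Two families are needed: with `y` ordinary letters and `z` letters in the part that gets the
extra vertices, the cut comes after `y` or after `z` letters, depending on which part comes first.
-/
theorem cancels_pairs {P : Set (List Piece)} {y z : ℕ}
    {s t : Finset ((Option ℕ × Option ℕ) × List ℕ)}
    (hP : ∀ l, l ∈ P ↔ (∃ i ∈ s, pair y i = l) ∨ ∃ i ∈ t, pair z i = l)
    (hdisj : ∀ i ∈ s, ∀ j ∈ t, pair y i ≠ pair z j)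
    (hsum : ∑ i ∈ s, (C (partSign (pair y i)) * X ^ partWeight (pair y i) : ℤ[X]) +
      ∑ i ∈ t, (C (partSign (pair z i)) * X ^ partWeight (pair z i) : ℤ[X]) = 0) :
    Cancels P partWeight partSign := by
  classical
  have hPe : P = ↑(s.image (pair y) ∪ t.image (pair z)) := by
    ext l
    simp only [hP, Finset.coe_union, Finset.coe_image, Set.mem_union, Set.mem_image, Finset.mem_coe]
  rw [hPe]
  refine Cancels.of_genFun_eq_zero (fun l _ => partSign_cases l) ?_
  rw [Finset.sum_union, Finset.sum_image (pair_injective y).injOn,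
    Finset.sum_image (pair_injective z).injOn, hsum]
  rw [Finset.disjoint_left]
  intro l h₁ h₂
  obtain ⟨i, hi, rfl⟩ := Finset.mem_image.1 h₁
  obtain ⟨j, hj, h⟩ := Finset.mem_image.1 h₂
  exact hdisj i hi j hj h.symm

end pairs

section bases

open Polynomial

variable {a B : ℕ} {S : Finset ℕ}

/-- In a list of two pieces, the number of letters of the piece that gets the extra vertices. -/
def markedLength (a : ℕ) (cur : Bool) : List Piece → ℕ
  | [x, y] => if nextCur a cur x && y.flag.isSome then x.seg.length else y.seg.length
  | _ => 0

theorem good_pair {cur : Bool} {k : ℕ} {f g : Option ℕ} {D : List ℕ} :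
    Good a B cur S (pair k ((f, g), D)) ↔ D ∈ words S ∧ D.take k ≠ [] ∧ D.drop k ≠ [] ∧
      (∀ r, f = some r → 1 ≤ r ∧ r ≤ partSize a B cur ⟨f, D.take k⟩ [⟨g, D.drop k⟩] ∧ MinHead D) ∧
      ∀ r, g = some r → 1 ≤ r ∧
        r ≤ partSize a B (nextCur a cur ⟨f, D.take k⟩) ⟨g, D.drop k⟩ [] ∧ MinHead (D.drop k) := by
  have hhead : D.take k ≠ [] → (D.take k).headD 0 = D.headD 0 := by
    intro h
    cases D with
    | nil => simp at h
    | cons x D => cases k <;> simp at *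
  have hrest : D ∈ words S → ∀ z, z ∈ S \ (D.take k).toFinset ↔ z ∈ D.drop k := by
    intro hD z
    have h := (mem_words.1 hD).1
    rw [← List.take_append_drop k D, List.nodup_append] at h
    rw [Finset.mem_sdiff, List.mem_toFinset, ← (mem_words.1 hD).2]
    nth_rewrite 1 [← List.take_append_drop k D]
    rw [List.mem_append]
    constructor
    · tauto
    · intro hz
      exact ⟨Or.inr hz, fun h' => h.2.2 z h' z hz rfl⟩
  constructor
  · intro h
    have hD := h.mem_words
    simp only [pair, List.flatMap_cons, List.flatMap_nil, List.append_nil,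
      List.take_append_drop] at hD
    obtain ⟨h₁, h₂, h₃, h₄, h₅, h₆, h₇, h₈, h₉⟩ := h
    refine ⟨hD, h₁, h₅, fun r hr => ?_, fun r hr => ?_⟩
    · obtain ⟨h, h', h''⟩ := h₄ r hr
      refine ⟨h, h', fun z hz => ?_⟩
      rw [← hhead h₁]
      exact h'' z (((mem_words.1 hD).2 z).1 hz)
    · obtain ⟨h, h', h''⟩ := h₈ r hr
      exact ⟨h, h', fun z hz => h'' z ((hrest hD z).2 hz)⟩
  · rintro ⟨hD, h₁, h₂, h₃, h₄⟩
    have hw := mem_words.1 hD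
    have hnd := hw.1
    rw [← List.take_append_drop k D, List.nodup_append] at hnd
    refine ⟨h₁, hnd.1, fun z hz => (hw.2 z).1 (List.mem_of_mem_take hz), ?_, h₂, hnd.2.1,
      fun z hz => (hrest hD z).2 hz, ?_, ?_⟩
    · intro r hr
      obtain ⟨h, h', h''⟩ := h₃ r hr
      refine ⟨h, h', fun z hz => ?_⟩
      rw [hhead h₁]
      exact h'' z ((hw.2 z).2 hz)
    · intro r hr
      obtain ⟨h, h', h''⟩ := h₄ r hr
      exact ⟨h, h', fun z hz => h'' z ((hrest hD z).1 hz)⟩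
    · show (S \ (D.take k).toFinset) \ (D.drop k).toFinset = ∅
      ext z
      rw [Finset.mem_sdiff, hrest hD, List.mem_toFinset]
      simp

/-- In a list of two pieces exactly one gets the extra vertices. -/
theorem partSize_pair {cur : Bool} {k : ℕ} {f g : Option ℕ} {D : List ℕ} (hD : D ∈ words S)
    (hcur : cur = true ↔ a ∉ S) (hk : (D.take k).length = k) :
    (nextCur a cur ⟨f, D.take k⟩ && g.isSome) = true ∧
        partSize a B cur ⟨f, D.take k⟩ [⟨g, D.drop k⟩] = k + B ∧
        partSize a B (nextCur a cur ⟨f, D.take k⟩) ⟨g, D.drop k⟩ [] = S.card - k ∧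
        markedLength a cur (pair k ((f, g), D)) = k ∨
      (nextCur a cur ⟨f, D.take k⟩ && g.isSome) = false ∧
        partSize a B cur ⟨f, D.take k⟩ [⟨g, D.drop k⟩] = k ∧
        (cur = false ∨ f = none →
          partSize a B (nextCur a cur ⟨f, D.take k⟩) ⟨g, D.drop k⟩ [] = S.card - k + B) ∧
        markedLength a cur (pair k ((f, g), D)) = S.card - k := by
  have hw := mem_words.1 hD
  have hnd := hw.1
  rw [← List.take_append_drop k D, List.nodup_append] at hnd
  have hlen : (D.drop k).length = S.card - k := by rw [List.length_drop, length_of_mem_words hD]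
  have hmem : a ∈ S ↔ a ∈ D.take k ∨ a ∈ D.drop k := by
    rw [← hw.2, ← List.mem_append, List.take_append_drop]
  have hdisj : a ∈ D.take k → a ∉ D.drop k := fun h h' => hnd.2.2 a h a h' rfl
  by_cases hm : (nextCur a cur ⟨f, D.take k⟩ && g.isSome) = true
  · left
    refine ⟨hm, ?_, ?_, ?_⟩
    · simp [partSize, closes, hm, hk]
    · have : nextCur a (nextCur a cur ⟨f, D.take k⟩) ⟨g, D.drop k⟩ = false := by
        cases g with
        | none => simp at hm
        | some r =>
          have : a ∉ D.drop k := by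
            cases cur with
            | false => simp [nextCur] at hm; exact hdisj hm
            | true => exact fun h => hcur.1 rfl (hmem.2 (Or.inr h))
          simp [nextCur, this]
      simp [partSize, this, hlen]
    · simp only [markedLength, pair, hm, if_true, hk]
  · rw [Bool.not_eq_true] at hm
    right
    refine ⟨hm, ?_, fun hf => ?_, ?_⟩
    · simp [partSize, closes, hm, hk]
    · have : nextCur a (nextCur a cur ⟨f, D.take k⟩) ⟨g, D.drop k⟩ = true := by
        cases cur with
        | false =>
          have ha : a ∈ S := by simpa using hcur
          rw [hmem] at ha
          cases g with
          | none => simpa [nextCur, or_comm] using ha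
          | some r =>
            simp [nextCur] at hm
            simp [nextCur, ha.resolve_left hm]
        -- A tree containing `a` is pending and, as its letters are already used, a flagged first
        -- part would close it and leave both parts without extra vertices; hence the assumption on
        -- `f`.
        | true =>
          have hf : f = none := by simpa using hf
          subst hf
          cases g with
          | none => simp [nextCur]
          | some r => simp [nextCur] at hm
      simp [partSize, closes, this, hlen]
    · simp only [markedLength, pair, hm, Bool.false_eq_true, if_false, hlen]

end bases

section bases

open Polynomial

variable {a B : ℕ} {cur : Bool} {forb : Prop} {S : Finset ℕ}

/-- The condition on the first piece of a list of two pieces with letters `D`. -/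
def FirstCond (a : ℕ) (forb : Prop) (cur : Bool) (f : Option ℕ) (D : List ℕ) : Prop :=
  (cur = true → f = none) ∧ (forb → f = none → D.head? ≠ some a) ∧ (f.isSome → MinHead D)

/-- The condition on two pieces, cut after `y` letters, the second of which gets the extra
vertices. -/
def SecondMarked (a y : ℕ) (forb : Prop) (cur : Bool) (f g : Option ℕ) (D : List ℕ) : Prop :=
  FirstCond a forb cur f D ∧
    (g.isSome → nextCur a cur ⟨f, D.take y⟩ = false ∧ MinHead (D.drop y))

/-- The condition on two pieces, cut after `z` letters, the first of which gets the extra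
vertices. -/
def FirstMarked (a z : ℕ) (forb : Prop) (cur : Bool) (f _g : Option ℕ) (D : List ℕ) : Prop :=
  FirstCond a forb cur f D ∧ nextCur a cur ⟨f, D.take z⟩ = true ∧ MinHead (D.drop z)

theorem mem_flags {n : ℕ} {f : Option ℕ} : f ∈ flags n ↔ ∀ r, f = some r → 1 ≤ r ∧ r ≤ n := by
  cases f <;> simp [flags]

theorem mem_someFlags {n : ℕ} {f : Option ℕ} :
    f ∈ someFlags n ↔ f.isSome ∧ ∀ r, f = some r → 1 ≤ r ∧ r ≤ n := by
  cases f <;> simp [someFlags]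

/-- Each `r` is bounded by the size of its part, which is `y` or `z + B`. If the first part gets the
extra vertices, then the tree containing `a` ends there, so the second part must be flagged; this
explains `someFlags`. -/
theorem mem_partSet_two (hcur : cur = true ↔ a ∉ S) {y z : ℕ} (hy : 1 ≤ y) (hz : 1 ≤ z)
    (hyz : y + z = S.card) (l : List Piece) :
    (l ∈ partSet a B forb cur S 2 ∧ (cur = true → ∀ x ∈ l.head?, x.flag = none)) ∧
        markedLength a cur l = z ↔
      (∃ i ∈ pairData (flags y) (flags (z + B)) S (SecondMarked a y forb cur), pair y i = l) ∨
        ∃ i ∈ pairData (flags (z + B)) (someFlags y) S (FirstMarked a z forb cur),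
          pair z i = l := by
  have hhead : ∀ {k : ℕ} {D : List ℕ}, 1 ≤ k → (D.take k).head? = D.head? := by
    intro k D hk
    obtain ⟨k, rfl⟩ := Nat.exists_eq_succ_of_ne_zero (by omega : k ≠ 0)
    cases D <;> simp
  have htake : ∀ {k : ℕ} {D : List ℕ}, D ∈ words S → k ≤ S.card → (D.take k).length = k := by
    intro k D hD hk
    rw [List.length_take, length_of_mem_words hD]
    omega
  have hne : ∀ {k : ℕ} {D : List ℕ}, D ∈ words S → 1 ≤ k → k < S.card →
      D.take k ≠ [] ∧ D.drop k ≠ [] := by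
    intro k D hD hk hk'
    have := length_of_mem_words hD
    rw [← List.length_pos_iff, ← List.length_pos_iff, List.length_take, List.length_drop]
    omega
  constructor
  · rintro ⟨⟨⟨hg, hn, hf⟩, hc⟩, hm⟩
    obtain ⟨k, f, g, D, rfl, hk⟩ := exists_pair hn
    obtain ⟨hD, hne₁, hne₂, h₁, h₂⟩ := good_pair.1 hg
    have hk₁ : 1 ≤ k := by
      rw [← hk]
      exact List.length_pos_iff.2 hne₁
    have hk₂ : k < S.card := by
      have := List.length_pos_iff.2 hne₂
      rw [List.length_drop, length_of_mem_words hD] at this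
      omega
    have hfc : FirstCond a forb cur f D := by
      refine ⟨fun h => hc h _ rfl, fun h h' => ?_, fun h => ?_⟩
      · have := hf h _ rfl h'
        rwa [hhead hk₁] at this
      · obtain ⟨r, rfl⟩ := Option.isSome_iff_exists.1 h
        exact (h₁ r rfl).2.2
    have hcf : cur = false ∨ f = none := by
      cases cur with
      | false => exact Or.inl rfl
      | true => exact Or.inr (hfc.1 rfl)
    rcases partSize_pair (B := B) (f := f) (g := g) hD hcur hk with
      ⟨hm₁, hm₂, hm₃, hm₄⟩ | ⟨hm₁, hm₂, hm₃, hm₄⟩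
    · obtain rfl : k = z := hm₄.symm.trans hm
      rw [Bool.and_eq_true] at hm₁
      refine Or.inr ⟨((f, g), D), mem_pairData.2 ⟨?_, ?_, hD, hfc, hm₁.1, ?_⟩, rfl⟩
      · rw [mem_flags]
        intro r hr
        rw [← hm₂]
        exact ⟨(h₁ r hr).1, (h₁ r hr).2.1⟩
      · rw [mem_someFlags]
        refine ⟨hm₁.2, fun r hr => ?_⟩
        have := h₂ r hr
        rw [hm₃] at this
        omega
      · obtain ⟨r, rfl⟩ := Option.isSome_iff_exists.1 hm₁.2
        exact (h₂ r rfl).2.2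
    · obtain rfl : k = y := by
        have := hm₄.symm.trans hm
        omega
      have hm₃ := hm₃ hcf
      refine Or.inl ⟨((f, g), D), mem_pairData.2 ⟨?_, ?_, hD, hfc, fun hg => ⟨?_, ?_⟩⟩, rfl⟩
      · rw [mem_flags]
        intro r hr
        rw [hm₂] at h₁
        exact ⟨(h₁ r hr).1, (h₁ r hr).2.1⟩
      · rw [mem_flags]
        intro r hr
        have := h₂ r hr
        rw [hm₃] at this
        omega
      · simpa [hg] using hm₁
      · obtain ⟨r, rfl⟩ := Option.isSome_iff_exists.1 hg
        exact (h₂ r rfl).2.2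
  · rintro (⟨⟨⟨f, g⟩, D⟩, hi, rfl⟩ | ⟨⟨⟨f, g⟩, D⟩, hi, rfl⟩)
    · obtain ⟨hf, hg, hD, ⟨h₁, h₂, h₃⟩, h₄⟩ := mem_pairData.1 hi
      have hcf : cur = false ∨ f = none := by
        cases cur with
        | false => exact Or.inl rfl
        | true => exact Or.inr (h₁ rfl)
      have hk := htake hD (by omega : y ≤ S.card)
      have hm : (nextCur a cur ⟨f, D.take y⟩ && g.isSome) = false := by
        cases g with
        | none => simp
        | some r => simp [(h₄ rfl).1]
      rcases partSize_pair (B := B) (f := f) (g := g) hD hcur hk with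
        ⟨hm₁, hm₂, hm₃, hm₄⟩ | ⟨hm₁, hm₂, hm₃, hm₄⟩
      · rw [hm] at hm₁
        simp at hm₁
      have hm₃ := hm₃ hcf
      rw [mem_flags] at hf hg
      obtain ⟨hne₁, hne₂⟩ := hne hD hy (by omega)
      refine ⟨⟨⟨good_pair.2 ⟨hD, hne₁, hne₂, fun r hr => ?_, fun r hr => ?_⟩, rfl, ?_⟩, ?_⟩, ?_⟩
      · rw [hm₂]
        exact ⟨(hf r hr).1, (hf r hr).2, h₃ (by simp [hr])⟩
      · rw [hm₃]
        have := hg r hr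
        exact ⟨this.1, by omega, (h₄ (by simp [hr])).2⟩
      · rintro h x hx hn
        obtain rfl := Option.some.inj hx
        rw [hhead hy]
        exact h₂ h hn
      · rintro h x hx
        obtain rfl := Option.some.inj hx
        exact h₁ h
      · rw [hm₄]
        omega
    · obtain ⟨hf, hg, hD, ⟨h₁, h₂, h₃⟩, h₄, h₅⟩ := mem_pairData.1 hi
      have hk := htake hD (by omega : z ≤ S.card)
      rw [mem_flags] at hf
      rw [mem_someFlags] at hg
      rcases partSize_pair (B := B) (f := f) (g := g) hD hcur hk with
        ⟨hm₁, hm₂, hm₃, hm₄⟩ | ⟨hm₁, hm₂, hm₃, hm₄⟩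
      swap
      · rw [h₄, hg.1] at hm₁
        simp at hm₁
      obtain ⟨hne₁, hne₂⟩ := hne hD hz (by omega)
      refine ⟨⟨⟨good_pair.2 ⟨hD, hne₁, hne₂, fun r hr => ?_, fun r hr => ?_⟩, rfl, ?_⟩, ?_⟩, ?_⟩
      · rw [hm₂]
        exact ⟨(hf r hr).1, (hf r hr).2, h₃ (by simp [hr])⟩
      · rw [hm₃]
        have := hg.2 r hr
        exact ⟨this.1, by omega, h₅⟩
      · rintro h x hx hn
        obtain rfl := Option.some.inj hx
        rw [hhead hz]
        exact h₂ h hn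
      · rintro h x hx
        obtain rfl := Option.some.inj hx
        exact h₁ h
      · exact hm₄

theorem sizes_two (hcur : cur = true ↔ a ∉ S) {l : List Piece} (hl : l ∈ partSet a B forb cur S 2)
    (hc : cur = true → ∀ x ∈ l.head?, x.flag = none) :
    (↑(sizes a B cur l) : Multiset ℕ) =
        {S.card - markedLength a cur l, markedLength a cur l + B} ∧
      1 ≤ markedLength a cur l ∧ markedLength a cur l < S.card := by
  obtain ⟨hg, hn, -⟩ := hl
  obtain ⟨k, f, g, D, rfl, hk⟩ := exists_pair hn
  obtain ⟨hD, hne₁, hne₂, -⟩ := good_pair.1 hg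
  have hk₁ : 1 ≤ k := by
    rw [← hk]
    exact List.length_pos_iff.2 hne₁
  have hk₂ : k < S.card := by
    have := List.length_pos_iff.2 hne₂
    rw [List.length_drop, length_of_mem_words hD] at this
    omega
  have hcf : cur = false ∨ f = none := by
    cases cur with
    | false => exact Or.inl rfl
    | true => exact Or.inr (hc rfl _ rfl)
  rcases partSize_pair (B := B) (f := f) (g := g) hD hcur hk with
    ⟨hm₁, hm₂, hm₃, hm₄⟩ | ⟨hm₁, hm₂, hm₃, hm₄⟩
  · rw [hm₄]
    refine ⟨?_, by omega, by omega⟩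
    simp only [pair, sizes, hm₂, hm₃]
    rw [Multiset.pair_comm]
    rfl
  · rw [hm₄]
    refine ⟨?_, by omega, by omega⟩
    simp only [pair, sizes, hm₂, hm₃ hcf]
    rw [show S.card - (S.card - k) = k by omega]
    rfl

/-- A cancellation of generating functions gives one of lists of two pieces. -/
theorem cancels_two (hcur : cur = true ↔ a ∉ S)
    (h : ∀ y z, 1 ≤ y → 1 ≤ z → y + z = S.card →
      ∑ f ∈ flags y, flagTerm f * ∑ g ∈ flags (z + B), flagTerm g *
          gf S (SecondMarked a y forb cur f g) +
        ∑ f ∈ flags (z + B), flagTerm f * ∑ g ∈ someFlags y, flagTerm g *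
          gf S (FirstMarked a z forb cur f g) = 0) :
    Cancels {l ∈ partSet a B forb cur S 2 | cur = true → ∀ x ∈ l.head?, x.flag = none}
      (partKey a B cur) partSign := by
  refine Cancels.of_fibers (markedLength a cur) fun z => ?_
  by_cases hz : 1 ≤ z ∧ z < S.card
  · obtain ⟨y, hy⟩ : ∃ y, y = S.card - z := ⟨_, rfl⟩
    have h₁ := cancels_pairs (mem_partSet_two (B := B) (forb := forb) hcur (y := y) (z := z)
      (by omega) hz.1 (by omega)) ?_ ?_
    · refine h₁.mono_key ?_
      rintro l ⟨⟨hl, hlc⟩, hlz⟩ l' ⟨⟨hl', hlc'⟩, hlz'⟩ hk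
      have hc : ∀ l : List Piece, l.length = 2 → (cur = true → ∀ x ∈ l.head?, x.flag = none) →
          (cur && closes l) = false := by
        intro l hl hx
        cases l with
        | nil => simp at hl
        | cons x l =>
          cases cur with
          | false => simp
          | true => simp [closes, hx rfl x rfl]
      rw [partKey, partKey, (sizes_two hcur hl hlc).1, (sizes_two hcur hl' hlc').1, hlz, hlz', hk,
        hc l hl.2.1 hlc, hc l' hl'.2.1 hlc']
    · rintro ⟨⟨f, g⟩, D⟩ hi ⟨⟨f', g'⟩, D'⟩ hj hij
      simp only [pair, List.cons.injEq, Piece.mk.injEq, and_true] at hij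
      obtain ⟨⟨rfl, h₁⟩, rfl, h₂⟩ := hij
      obtain ⟨-, -, -, -, h₃⟩ := mem_pairData.1 hi
      obtain ⟨-, h₄, -, -, h₅, -⟩ := mem_pairData.1 hj
      rw [← h₁, (h₃ (mem_someFlags.1 h₄).1).1] at h₅
      simp at h₅
    · rw [sum_pairData, sum_pairData]
      exact h y z (by omega) hz.1 (by omega)
  · refine Cancels.of_forall_notMem ?_
    rintro l ⟨⟨hl, hlc⟩, rfl⟩
    exact hz (sizes_two hcur hl hlc).2

end bases

/-! ### Cancellation of the last parts -/

section bases

open Polynomial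

variable {a B : ℕ} {cur : Bool} {forb : Prop} {S : Finset ℕ}

theorem mem_take_iff_of_mem_words {D : List ℕ} (hD : D ∈ words S) (ha : a ∈ S) (k : ℕ) :
    a ∉ D.take k ↔ a ∈ D.drop k := by
  have h := (mem_words.1 hD).1
  have ha := ((mem_words.1 hD).2 a).2 ha
  rw [← List.take_append_drop k D] at h ha
  rw [List.nodup_append] at h
  rw [List.mem_append] at ha
  exact ⟨fun h' => ha.resolve_left h', fun h₁ h₂ => h.2.2 a h₂ a h₁ rfl⟩

theorem head?_ne_of_mem_words {D : List ℕ} (hD : D ∈ words S) (ha : a ∉ S) :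
    D.head? ≠ some a := fun h => ha (((mem_words.1 hD).2 a).1 (List.mem_of_mem_head? h))

/-- The first part continues the tree containing `a`. If the second part continues it too, the
contribution is `+n!` with `n = |S|`. If the second part begins a new tree, the `[y]` choices of `r`
turn the words whose last `y` letters begin with their least one into all words, for a contribution
of `-n!`. -/
theorem cancels_two_of_cur (ha : a ∉ S) :
    Cancels {l ∈ partSet a B forb true S 2 | ∀ x ∈ l.head?, x.flag = none}
      (partKey a B true) partSign := by
  have h := cancels_two (a := a) (B := B) (cur := true) (forb := forb) (S := S) (by simpa using ha) ?_
  · simpa using h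
  intro y z hy hz hyz
  have hy' : S.card - z = y := by omega
  have h₁ : ∀ f g, (f, g) ≠ (none, none) → gf S (SecondMarked a y forb true f g) = 0 := by
    intro f g hfg
    refine gf_false ?_
    rintro D - ⟨⟨h₁, -⟩, h₂⟩
    obtain rfl := h₁ rfl
    cases g with
    | none => exact hfg rfl
    | some r => simpa [nextCur] using (h₂ rfl).1
  have h₂ : gf S (SecondMarked a y forb true none none) = qFact S.card := by
    rw [← gf_true]
    refine gf_congr fun D hD => ?_
    simp [SecondMarked, FirstCond, head?_ne_of_mem_words hD ha]
  have h₃ : ∀ r g, gf S (FirstMarked a z forb true (some r) g) = 0 := by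
    intro r g
    refine gf_false ?_
    rintro D - ⟨⟨h₁, -⟩, -⟩
    simpa using h₁ rfl
  have h₄ : ∀ g, qNum y * gf S (FirstMarked a z forb true none g) = qFact S.card := by
    intro g
    have := gf_take_minHead (S := S) (m := z) (by omega) (fun _ => True)
    rw [hy', gf_true] at this
    rw [← this]
    congr 1
    refine gf_congr fun D hD => ?_
    simp [FirstMarked, FirstCond, head?_ne_of_mem_words hD ha, nextCur]
  rw [sum_flags (q := 0), sum_flags (q := 0), sum_flags (q := 0), h₂,
    sum_someFlags (q := gf S (FirstMarked a z forb true none none)), h₄]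
  · ring
  · intro r
    rfl
  · intro r
    simp [h₃]
  · intro r
    exact h₁ _ _ (by simp)
  · intro r
    refine Finset.sum_eq_zero fun g _ => ?_
    rw [h₁ _ _ (by simp), mul_zero]

theorem take_eq_cons {k : ℕ} (hk : 1 ≤ k) (b : ℕ) (l : List ℕ) :
    (b :: l).take k = b :: l.take (k - 1) := by
  obtain ⟨k, rfl⟩ := Nat.exists_eq_succ_of_ne_zero (by omega : k ≠ 0)
  rfl

theorem drop_cons_eq {k : ℕ} (hk : 1 ≤ k) (b : ℕ) (l : List ℕ) :
    (b :: l).drop k = l.drop (k - 1) := by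
  obtain ⟨k, rfl⟩ := Nat.exists_eq_succ_of_ne_zero (by omega : k ≠ 0)
  rfl

theorem head?_take {k : ℕ} (hk : 1 ≤ k) (l : List ℕ) : (l.take k).head? = l.head? := by
  obtain ⟨k, rfl⟩ := Nat.exists_eq_succ_of_ne_zero (by omega : k ≠ 0)
  cases l <;> simp

theorem gf_minHead_mem_drop_minHead (ha : a ∈ S) (hmax : ∀ x ∈ S, x ≤ a) {y : ℕ} (hy : 1 ≤ y)
    (hy' : y < S.card) :
    gf S (fun l => MinHead l ∧ a ∈ l.drop y ∧ MinHead (l.drop y)) = qFact (S.card - 2) := by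
  have hS : S.Nonempty := ⟨a, ha⟩
  obtain ⟨b, hb, hmin⟩ : ∃ b ∈ S, ∀ x ∈ S, b ≤ x := ⟨_, S.min'_mem hS, fun x hx => S.min'_le x hx⟩
  obtain ⟨c, hc, hcb⟩ := Finset.exists_mem_ne (by omega : 1 < S.card) b
  have hab : a ≠ b := by
    rintro rfl
    exact hcb (le_antisymm (hmax c hc) (hmin c hc))
  have hcard := Finset.card_erase_of_mem hb
  rw [gf_minHead hb hmin]
  simp only [drop_cons_eq hy]
  rw [gf_mem_drop_minHead (Finset.mem_erase.2 ⟨hab, ha⟩)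
    (fun x hx => hmax x (Finset.mem_of_mem_erase hx)) (by omega), hcard]
  rfl

/-- Remove the leading least letter `b`, and use the factor `[y]` to drop the condition on the last
`y` letters. What remains are the words on the other letters with `a` not among the last `y`, the
complement of `gf_mem_drop`. -/
theorem gf_minHead_mem_take_minHead (ha : a ∈ S) (hmax : ∀ x ∈ S, x ≤ a) {y z : ℕ} (hy : 1 ≤ y)
    (hz : 1 ≤ z) (hyz : y + z = S.card) :
    qNum y * gf S (fun l => MinHead l ∧ a ∈ l.take z ∧ MinHead (l.drop z)) =
      qFact (S.card - 1) - qNum y * qFact (S.card - 2) := by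
  have hS : S.Nonempty := ⟨a, ha⟩
  obtain ⟨b, hb, hmin⟩ : ∃ b ∈ S, ∀ x ∈ S, b ≤ x := ⟨_, S.min'_mem hS, fun x hx => S.min'_le x hx⟩
  obtain ⟨c, hc, hcb⟩ := Finset.exists_mem_ne (by omega : 1 < S.card) b
  have hab : a ≠ b := by
    rintro rfl
    exact hcb (le_antisymm (hmax c hc) (hmin c hc))
  have hcard := Finset.card_erase_of_mem hb
  have ha' : a ∈ S.erase b := Finset.mem_erase.2 ⟨hab, ha⟩
  have hy' : (S.erase b).card - (z - 1) = y := by omega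
  rw [gf_minHead hb hmin]
  simp only [drop_cons_eq hz, take_eq_cons hz, List.mem_cons, hab, false_or]
  have h₁ := gf_take_minHead (S := S.erase b) (m := z - 1) (by omega) (a ∈ ·)
  rw [hy'] at h₁
  have h₂ := gf_split (S := S.erase b) (fun _ => True) (fun l => a ∈ l.take (z - 1))
  simp only [true_and] at h₂
  have h₃ := gf_mem_drop (m := z - 1) ha' (fun x hx => hmax x (Finset.mem_of_mem_erase hx))
    (by omega)
  rw [gf_true, gf_congr (Q := fun l => a ∈ l.drop (z - 1))
    (fun l hl => mem_take_iff_of_mem_words hl ha' _), h₃, hy'] at h₂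
  rw [h₁, ← hcard, h₂, show S.card - 2 = (S.erase b).card - 1 by omega]
  ring

/-- Let `n = |S|` and let `s`, `u` stand for flagged and unflagged. If the second part gets the
extra vertices, the flags `ss`, `su`, `us`, `uu` contribute `[y][z+B](n-2)!`, `-[y](n-1)!`,
`-[z+B](n-1)!` and `W + [y](n-1)!`. If the first part gets them, `ss` and `us` contribute
`[z+B]((n-1)! - [y](n-2)!)` and `-W`. The total is zero whatever `W` is, so the condition `forb`,
which affects only `W`, does no harm. -/
theorem cancels_two_of_mem (ha : a ∈ S) (hmax : ∀ x ∈ S, x ≤ a) :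
    Cancels (partSet a B forb false S 2) (partKey a B false) partSign := by
  have h := cancels_two (a := a) (B := B) (cur := false) (forb := forb) (S := S) (by simpa using ha)
    ?_
  · simpa using h
  intro y z hy hz hyz
  have hy' : S.card - z = y := by omega
  set W := gf S (fun D => a ∈ D.take z ∧ (forb → D.head? ≠ some a)) with hW
  have hne : ∀ {D : List ℕ} {k : ℕ}, 1 ≤ k → a ∉ D.take k → D.head? ≠ some a := by
    intro D k hk h h'
    rw [← head?_take hk] at h'
    exact h (List.mem_of_mem_head? h')
  have e₁ : ∀ r r', gf S (SecondMarked a y forb false (some r) (some r')) = qFact (S.card - 2) := by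
    intro r r'
    rw [← gf_minHead_mem_drop_minHead ha hmax hy (by omega)]
    refine gf_congr fun D hD => ?_
    simp [SecondMarked, FirstCond, nextCur, mem_take_iff_of_mem_words hD ha]
  have e₂ : ∀ r, gf S (SecondMarked a y forb false (some r) none) = qFact (S.card - 1) := by
    intro r
    rw [← gf_minHead_true ⟨a, ha⟩]
    refine gf_congr fun D hD => ?_
    simp [SecondMarked, FirstCond]
  have e₃ : ∀ r, gf S (SecondMarked a y forb false none (some r)) = qFact (S.card - 1) := by
    intro r
    rw [← gf_mem_drop_minHead ha hmax (m := y) (by omega)]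
    refine gf_congr fun D hD => ?_
    rw [← mem_take_iff_of_mem_words hD ha]
    have := hne (D := D) hy
    simp only [SecondMarked, FirstCond, nextCur, ne_eq]
    simp
    tauto
  -- If `a` is not among the first `z ≥ 1` letters, it is not the first letter, so `forb` imposes
  -- nothing.
  have e₄ : gf S (SecondMarked a y forb false none none) = W + qNum y * qFact (S.card - 1) := by
    rw [gf_split _ (fun D => a ∈ D.take z), hW, ← hy', ← gf_mem_drop ha hmax (by omega)]
    congr 1
    · refine gf_congr fun D hD => ?_
      simp [SecondMarked, FirstCond]
      tauto
    · refine gf_congr fun D hD => ?_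
      rw [← mem_take_iff_of_mem_words hD ha]
      have := hne (D := D) hz
      simp [SecondMarked, FirstCond]
      tauto
  have e₅ : ∀ r r', gf S (FirstMarked a z forb false (some r) (some r')) =
      gf S (fun l => MinHead l ∧ a ∈ l.take z ∧ MinHead (l.drop z)) := by
    intro r r'
    refine gf_congr fun D hD => ?_
    simp [FirstMarked, FirstCond, nextCur]
  have e₆ : ∀ r, gf S (FirstMarked a z forb false none (some r)) =
      gf S (fun l => (a ∈ l.take z ∧ (forb → (l.take z).head? ≠ some a)) ∧ MinHead (l.drop z)) := by
    intro r
    refine gf_congr fun D hD => ?_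
    simp [FirstMarked, FirstCond, nextCur, head?_take hz]
    tauto
  have e₇ := gf_take_minHead (S := S) (m := z) (by omega)
    (fun l => a ∈ l ∧ (forb → l.head? ≠ some a))
  have e₈ := gf_minHead_mem_take_minHead ha hmax hy hz hyz
  rw [hy'] at e₇
  simp only [head?_take hz] at e₆ e₇
  rw [← hW] at e₇
  rw [sum_flags (q := qNum (z + B) * qFact (S.card - 2) - qFact (S.card - 1)),
    sum_flags (F := fun f => ∑ g ∈ someFlags y, flagTerm g * gf S (FirstMarked a z forb false f g))
      (q := qFact (S.card - 1) - qNum y * qFact (S.card - 2)),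
    sum_flags e₃, sum_someFlags e₆, e₄, e₇]
  · ring
  · intro r
    rw [sum_someFlags (e₅ r), e₈]
  · intro r
    rw [sum_flags (e₁ r), e₂]

/-- Unflagged parts contribute `-n!` and flagged ones `[n](n-1)!`, with `n = |S|`. -/
theorem cancels_one (ha : a ∉ S) :
    Cancels (partSet a B forb false S 1) (partKey a B false) partSign := by
  classical
  rcases S.eq_empty_or_nonempty with rfl | hS
  · refine Cancels.of_forall_notMem ?_
    rintro l ⟨hg, hn, -⟩
    obtain ⟨x, rfl⟩ := List.length_eq_one_iff.1 hn
    obtain ⟨h₁, -, h₂, -⟩ := hg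
    obtain ⟨z, hz⟩ := List.exists_mem_of_ne_nil _ h₁
    simpa using h₂ z hz
  let e : Option ℕ × List ℕ → List Piece := fun i => [⟨i.1, i.2⟩]
  have he : Function.Injective e := by
    rintro ⟨f, D⟩ ⟨f', D'⟩ h
    simpa [e] using h
  let s := (flags S.card ×ˢ words S).filter fun i => i.1.isSome → MinHead i.2
  have hsize : ∀ f D, partSize a B false ⟨f, D⟩ [] = D.length + if a ∈ D then B else 0 := by
    intro f D
    simp [partSize, nextCur, closes]
  have hset : partSet a B forb false S 1 = ↑(s.image e) := by
    ext l
    simp only [Finset.coe_image, Set.mem_image, Finset.mem_coe, s, Finset.mem_filter,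
      Finset.mem_product, Prod.exists, e]
    constructor
    · rintro ⟨hg, hn, -⟩
      obtain ⟨⟨f, D⟩, rfl⟩ := List.length_eq_one_iff.1 hn
      have hD : D ∈ words S := by simpa using hg.mem_words
      have haD : a ∉ D := fun h => ha (((mem_words.1 hD).2 a).1 h)
      obtain ⟨-, -, -, h, -⟩ := hg
      simp only [hsize, haD, if_false, add_zero, length_of_mem_words hD] at h
      refine ⟨f, D, ⟨⟨?_, hD⟩, ?_⟩, rfl⟩
      · rw [mem_flags]
        exact fun r hr => ⟨(h r hr).1, (h r hr).2.1⟩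
      · intro hf z hz
        obtain ⟨r, rfl⟩ := Option.isSome_iff_exists.1 hf
        exact (h r rfl).2.2 z (((mem_words.1 hD).2 z).1 hz)
    · rintro ⟨f, D, ⟨⟨hf, hD⟩, hm⟩, rfl⟩
      have haD : a ∉ D := fun h => ha (((mem_words.1 hD).2 a).1 h)
      have hw := mem_words.1 hD
      rw [mem_flags] at hf
      refine ⟨⟨?_, hw.1, fun z hz => (hw.2 z).1 hz, fun r hr => ?_, ?_⟩, rfl, ?_⟩
      · rintro rfl
        obtain ⟨z, hz⟩ := hS
        simpa using (hw.2 z).2 hz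
      · rw [hsize, if_neg haD, length_of_mem_words hD]
        exact ⟨(hf r hr).1, (hf r hr).2, fun z hz => hm (Option.isSome_iff_exists.2 ⟨r, hr⟩) z ((hw.2 z).2 hz)⟩
      · show S \ D.toFinset = ∅
        ext z
        simp [hw.2]
      · rintro - x hx -
        obtain rfl := Option.some.inj hx
        exact head?_ne_of_mem_words hD ha
  have h₁ : Cancels (partSet a B forb false S 1) partWeight partSign := by
    rw [hset]
    refine Cancels.of_genFun_eq_zero (fun l _ => partSign_cases l) ?_
    rw [Finset.sum_image he.injOn, Finset.sum_filter, Finset.sum_product]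
    have h₂ : ∀ f, (∑ D ∈ words S, if (f, D).1.isSome → MinHead (f, D).2 then
        (C (partSign (e (f, D))) * X ^ partWeight (e (f, D)) : ℤ[X]) else 0) =
          flagTerm f * gf S (fun D => f.isSome → MinHead D) := by
      intro f
      rw [gf, Finset.mul_sum]
      refine Finset.sum_congr rfl fun D _ => ?_
      by_cases h : f.isSome → MinHead D
      · rw [if_pos h, if_pos h]
        simp only [e, partSign, partWeight, flagTerm, Piece.sign, Piece.rank, List.map_cons,
          List.map_nil, List.prod_cons, List.prod_nil, List.flatMap_cons, List.flatMap_nil,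
          List.append_nil, List.sum_cons, List.sum_nil, pow_add, mul_one, pow_zero]
        ring
      · rw [if_neg h, if_neg h, mul_zero]
    rw [Finset.sum_congr rfl fun f _ => h₂ f, sum_flags (q := qFact (S.card - 1))]
    · simp only [Option.isSome_none, Bool.false_eq_true, false_imp_iff]
      rw [gf_true, qFact_eq hS.card_pos, sub_self]
    · intro r
      simp only [Option.isSome_some, true_imp_iff]
      exact gf_minHead_true hS
  refine h₁.mono_key fun l hl l' hl' hk => ?_
  have hs : ∀ l ∈ partSet a B forb false S 1, sizes a B false l = [S.card] := by
    rintro l ⟨hg, hn, -⟩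
    obtain ⟨⟨f, D⟩, rfl⟩ := List.length_eq_one_iff.1 hn
    have hD : D ∈ words S := by simpa using hg.mem_words
    have haD : a ∉ D := fun h => ha (((mem_words.1 hD).2 a).1 h)
    simp [sizes, hsize, haD, length_of_mem_words hD]
  simp only [partKey, hs l hl, hs l' hl', hk, Bool.false_and]

/-- Induction on the number of parts, fixing the first part. The induction ends with one part if `a`
is used up and its tree is no longer pending; otherwise two parts must be kept together, either
because `a` is still unread or because the first of them continues its tree. -/
theorem cancels_partSet {n : ℕ} (hcur : cur = true → a ∉ S) (hmax : a ∈ S → ∀ x ∈ S, x ≤ a)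
    (hn : 2 ≤ n ∨ n = 1 ∧ cur = false ∧ a ∉ S) :
    Cancels (partSet a B forb cur S n) (partKey a B cur) partSign := by
  induction n generalizing cur S forb with
  | zero => omega
  | succ n ih =>
    rcases Nat.eq_zero_or_pos n with rfl | hn₀
    · obtain ⟨-, rfl, ha⟩ := hn.resolve_left (by omega)
      exact cancels_one ha
    by_cases h₁ : n = 1 ∧ a ∈ S
    · obtain ⟨rfl, ha⟩ := h₁
      obtain rfl : cur = false := by
        cases cur with
        | false => rfl
        | true => exact absurd ha (hcur rfl)
      exact cancels_two_of_mem ha (hmax ha)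
    -- The excluded case would leave a single part while the tree containing `a` is pending.
    -- Flagging or unflagging that part would move the extra vertices, so nothing cancels there.
    have peel : ∀ x : Piece, ¬ (n = 1 ∧ cur = true ∧ x.flag = none) →
        Cancels {l ∈ partSet a B forb cur S (n + 1) | l.head? = some x} (partKey a B cur)
          partSign := by
      intro x hx
      by_cases hseg : ∀ z ∈ x.seg, z ∈ S
      swap
      · refine Cancels.of_forall_notMem ?_
        rintro l ⟨hl, hlx⟩
        cases l with
        | nil => simp at hlx
        | cons y l =>
          obtain rfl : y = x := by simpa using hlx
          exact hseg hl.1.2.2.1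
      refine cancels_cons x (ih ?_ ?_ ?_)
      · intro h
        simp only [nextCur, Bool.or_eq_true, decide_eq_true_eq, Bool.and_eq_true] at h
        rw [Finset.mem_sdiff, List.mem_toFinset]
        rcases h with h | h
        · exact fun h' => h'.2 h
        · exact fun h' => hcur h.1 h'.1
      · exact fun h z hz => hmax (Finset.mem_sdiff.1 h).1 z (Finset.mem_sdiff.1 hz).1
      · rcases Nat.lt_or_ge 1 n with hn₁ | hn₁
        · exact Or.inl hn₁
        · obtain rfl : n = 1 := by omega
          have ha : a ∉ S := by simpa using h₁
          refine Or.inr ⟨rfl, ?_, fun h => ha (Finset.mem_sdiff.1 h).1⟩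
          have ha' : a ∉ x.seg := fun h => ha (hseg a h)
          cases cur with
          | false => simp [nextCur, ha']
          | true => 
            simp only [true_and] at hx
            cases hf : x.flag with
            | none => exact absurd hf hx
            | some r => simp [nextCur, ha', hf]
    by_cases h₂ : n = 1 ∧ cur = true
    · obtain ⟨rfl, rfl⟩ := h₂
      have h₃ := cancels_two_of_cur (B := B) (forb := forb) (hcur rfl)
      -- A first part that continues the tree containing `a` needs `cancels_two_of_cur`; a flagged
      -- one closes that tree and can be fixed.
      refine Cancels.of_fibers (fun l => ∀ x ∈ l.head?, x.flag = none) fun p => ?_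
      by_cases hp : p
      · have : p = True := by simp [hp]
        subst this
        simpa using h₃
      · have : p = False := by simp [hp]
        subst this
        refine Cancels.of_fibers List.head? fun o => ?_
        cases o with
        | none =>
          refine Cancels.of_forall_notMem ?_
          rintro l ⟨⟨hl, -⟩, hlx⟩
          have := hl.2.1
          rw [List.head?_eq_none_iff] at hlx
          simp [hlx] at this
        | some x =>
          by_cases hx : x.flag = none
          · refine Cancels.of_forall_notMem ?_
            rintro l ⟨⟨hl, hl'⟩, hlx⟩
            simp [hlx, hx] at hl'
          · have h := peel x (fun h => hx h.2.2)
            convert h using 1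
            ext l
            constructor
            · rintro ⟨⟨h₁, h₂⟩, h₃⟩
              exact ⟨h₁, h₃⟩
            · rintro ⟨h₁, h₃⟩
              exact ⟨⟨h₁, by simp [h₃, hx]⟩, h₃⟩
    · refine Cancels.of_fibers List.head? fun o => ?_
      cases o with
      | none =>
        refine Cancels.of_forall_notMem ?_
        rintro l ⟨hl, hlx⟩
        have := hl.2.1
        rw [List.head?_eq_none_iff] at hlx
        simp [hlx] at this
      | some x => exact peel x (fun h => h₂ ⟨h.1, h.2.1⟩)

end bases

/-! ### Left parts of the almost complete graph, as lists of parts -/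

section top

open Polynomial

variable {a ε B : ℕ} {l : List Piece}

/-- The lists of parts that encode the forest triples of `almostComplete a ε`, where `B` extra
vertices are attached to the tree containing `a`. -/
def topSet (a ε B : ℕ) : Set (List Piece) :=
  {l | Good a B false (Finset.Icc 1 a) l ∧ ∃ x l', l = x :: l' ∧ x.flag = some 1 ∧
    (ε = 1 → x.seg.tail.head? ≠ some a ∧
      (x.seg.tail = [] → ∀ y ∈ l'.head?, y.flag = none → y.seg.head? ≠ some a))}

/-- The lists of parts that encode fixed points. -/
def TopFixed (a ε B : ℕ) (l : List Piece) : Prop :=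
  (∀ x ∈ l, x.flag.isSome) ∧ l.length ≤ 2 ∧
    ∀ x y, l = [x, y] → (∀ r, y.flag = some r → a ∈ y.seg → a - ε ≤ r) ∧
      (a ∈ x.seg → a ≤ x.seg.length + B)

/-- The statistics of a list of parts to be preserved. -/
def topKey (a B : ℕ) (l : List Piece) : Multiset ℕ × ℕ × Option ℕ :=
  (↑(sizes a B false l), partWeight l, (sizes a B false l).head?)

/-- The first part is fixed and at least two parts remain. If `ε = 1` and the first part is the
single letter `1`, a continuation must not begin with `a`; the parameter `forb` exists for this
case. -/
theorem cancels_topSet_of_three_le {n : ℕ} (hn : 3 ≤ n) :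
    Cancels {l ∈ topSet a ε B | l.length = n} (topKey a B) partSign := by
  obtain ⟨n, rfl⟩ := Nat.exists_eq_add_of_le' (by omega : 1 ≤ n)
  refine Cancels.of_fibers List.head? fun o => ?_
  cases o with
  | none =>
    refine Cancels.of_forall_notMem ?_
    rintro l ⟨⟨-, hl⟩, hlx⟩
    rw [List.head?_eq_none_iff] at hlx
    simp [hlx] at hl
  | some x =>
    by_cases hx : x.flag = some 1 ∧ (ε = 1 → x.seg.tail.head? ≠ some a)
    · have h := cancels_cons_of_forb (a := a) (B := B) (cur := false) (S := Finset.Icc 1 a)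
        (forb := False) (forb' := ε = 1 ∧ x.seg.tail = []) x (n := n)
        (cancels_partSet ?_ ?_ (Or.inl (by omega)))
      · have h' := h.mono_key (key' := topKey a B) ?_
        · convert h' using 1
          ext l
          constructor
          · rintro ⟨⟨⟨hg, y, l', rfl, h₁, h₂⟩, hl⟩, hlx⟩
            obtain rfl : y = x := by simpa using hlx
            exact ⟨l', rfl, ⟨hg, hl, False.elim⟩, fun h => (h₂ h.1).2 h.2⟩
          · rintro ⟨l', rfl, ⟨hg, hl, -⟩, h₂⟩
            exact ⟨⟨⟨hg, x, l', rfl, hx.1, fun h => ⟨hx.2 h, fun h' => h₂ ⟨h, h'⟩⟩⟩, hl⟩, rfl⟩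
        · rintro l - l' - h
          simp only [partKey, Prod.mk.injEq] at h
          simp only [topKey, Prod.mk.injEq]
          tauto
      · intro h h'
        simp only [nextCur, Bool.false_and, Bool.or_false, decide_eq_true_eq] at h
        simp [h] at h'
      · intro _ z hz
        simp only [Finset.mem_sdiff, Finset.mem_Icc] at hz
        exact hz.1.2
    · refine Cancels.of_forall_notMem ?_
      rintro l ⟨⟨⟨-, y, l', rfl, h₁, h₂⟩, -⟩, hlx⟩
      obtain rfl : y = x := by simpa using hlx
      exact hx ⟨h₁, fun h => (h₂ h).1⟩

/-- The condition on two pieces, cut after `f` letters, the second of which contains `a`. -/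
def TopSecond (a ε f : ℕ) (g : Option ℕ) (D : List ℕ) : Prop :=
  MinHead D ∧ (g = none → ε = 1 → D.tail.head? ≠ some a) ∧
    (g.isSome → a ∈ D.drop f ∧ MinHead (D.drop f))

/-- The condition on two pieces, cut after `k` letters, the first of which contains `a`. -/
def TopFirst (a ε k : ℕ) (D : List ℕ) : Prop :=
  MinHead D ∧ (ε = 1 → D.tail.head? ≠ some a) ∧ a ∈ D.take k ∧ MinHead (D.drop k)

theorem mem_topSet_pair {k : ℕ} {f g : Option ℕ} {D : List ℕ} (hk : 1 ≤ k) :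
    pair k ((f, g), D) ∈ topSet a ε B ↔ Good a B false (Finset.Icc 1 a) (pair k ((f, g), D)) ∧
      f = some 1 ∧ (ε = 1 → (g = none ∨ 2 ≤ k) → D.tail.head? ≠ some a) := by
  rw [topSet, Set.mem_ofPred_eq, and_congr_right_iff]
  intro hg
  obtain ⟨-, hne, hne', -⟩ := good_pair.1 hg
  obtain ⟨k, rfl⟩ := Nat.exists_eq_add_of_le' hk
  cases D with
  | nil => simp at hne
  | cons d D =>
    have h₁ : (pair (k + 1) ((f, g), d :: D)) = ⟨f, d :: D.take k⟩ :: [⟨g, D.drop k⟩] := rfl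
    rw [h₁]
    constructor
    · rintro ⟨x, l', h, h₂, h₃⟩
      obtain ⟨rfl, rfl⟩ := List.cons.inj h
      refine ⟨h₂, fun hε h => ?_⟩
      cases k with
      | zero => exact (h₃ hε).2 rfl _ rfl (h.resolve_right (by omega))
      | succ k =>
        have := (h₃ hε).1
        rwa [List.tail_cons, head?_take (by omega)] at this
    · rintro ⟨h₂, h₃⟩
      refine ⟨_, _, rfl, h₂, fun hε => ?_⟩
      cases k with
      | zero =>
        refine ⟨by simp, fun _ y hy hn => ?_⟩
        obtain rfl := Option.some.inj hy
        exact h₃ hε (Or.inl hn)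
      | succ k =>
        rw [List.tail_cons, head?_take (by omega)]
        refine ⟨h₃ hε (Or.inr (by omega)), fun h => ?_⟩
        cases D with
        | nil => simp at hne'
        | cons => simp at h

/-- A first part with `a` has `f - B` letters, and one without `a` has `f`. Since `f < a`, no list
of the first kind is fixed, while a flagged second part is not fixed exactly if its `r` is below `a
- ε`; hence the minimum. For `f ≤ B` the truncated difference is `0` and the second family is empty.
-/
theorem mem_topSet_two {f g : ℕ} (hf : f < a) (hg : g + f = a + B)
    (hf₁ : 1 ≤ f) :
    (((l ∈ topSet a ε B ∧ ¬ TopFixed a ε B l) ∧ l.length = 2) ∧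
        (sizes a B false l).head? = some f) ↔
      (∃ i ∈ pairData {some 1} (flags (min g (a - 1 - ε))) (Finset.Icc 1 a)
        (fun _ g D => TopSecond a ε f g D), pair f i = l) ∨
        ∃ i ∈ pairData {some 1} (someFlags g) (Finset.Icc 1 a)
          (fun _ _ D => TopFirst a ε (f - B) D), pair (f - B) i = l := by
  have hcur : false = true ↔ a ∉ Finset.Icc 1 a := by
    simp
    omega
  have hcard : (Finset.Icc 1 a).card = a := by simp
  have ha' : a ∈ Finset.Icc 1 a := by simp; omega
  have hnd : ∀ {D : List ℕ}, D ∈ words (Finset.Icc 1 a) → MinHead D → ∃ D', D = 1 :: D' := by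
    intro D hD hm
    cases D with
    | nil =>
      have := length_of_mem_words hD
      simp at this
      omega
    | cons d D =>
      have h1 := hm 1 (((mem_words.1 hD).2 1).2 (by simp; omega))
      have h2 := ((mem_words.1 hD).2 d).1 (by simp)
      simp only [List.headD_cons, Finset.mem_Icc] at h1 h2
      exact ⟨D, by rw [show d = 1 by omega]⟩
  constructor
  · rintro ⟨⟨⟨hl, hfix⟩, hn⟩, hs⟩
    obtain ⟨k, u, v, D, rfl, hk⟩ := exists_pair hn
    have hgood := hl.1
    obtain ⟨hD, hne₁, hne₂, h₁, h₂⟩ := good_pair.1 hgood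
    have hk₁ : 1 ≤ k := by
      rw [← hk]
      exact List.length_pos_iff.2 hne₁
    have hk₂ : k < a := by
      have := List.length_pos_iff.2 hne₂
      rw [List.length_drop, length_of_mem_words hD, hcard] at this
      omega
    obtain ⟨-, rfl, hc⟩ := (mem_topSet_pair hk₁).1 hl
    have hmin := (h₁ 1 rfl).2.2
    have hs : partSize a B false ⟨some 1, D.take k⟩ [⟨v, D.drop k⟩] = f := by
      simpa [pair, sizes] using hs
    rcases partSize_pair (B := B) (f := some 1) (g := v) hD hcur hk with
      ⟨hm₁, hm₂, hm₃, -⟩ | ⟨hm₁, hm₂, hm₃, -⟩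
    · right
      obtain rfl : k = f - B := by omega
      rw [Bool.and_eq_true] at hm₁
      have hat : a ∈ D.take (f - B) := by simpa [nextCur] using hm₁.1
      have hk' : 2 ≤ f - B := by
        obtain ⟨D', rfl⟩ := hnd hD hmin
        by_contra h
        rw [show f - B = 1 by omega] at hat
        simp at hat
        omega
      refine ⟨((some 1, v), D), mem_pairData.2 ⟨by simp, ?_, hD, hmin,
        fun h => hc h (Or.inr hk'), hat, ?_⟩, rfl⟩
      · rw [mem_someFlags]
        refine ⟨hm₁.2, fun r hr => ?_⟩
        have := h₂ r hr
        rw [hm₃] at this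
        omega
      · obtain ⟨r, rfl⟩ := Option.isSome_iff_exists.1 hm₁.2
        exact (h₂ r rfl).2.2
    · left
      obtain rfl : k = f := by omega
      have hm₃ := hm₃ (Or.inl rfl)
      have hmem : v.isSome → a ∈ D.drop k := by
        intro hv
        rw [← mem_take_iff_of_mem_words hD ha']
        simpa [nextCur, hv] using hm₁
      refine ⟨((some 1, v), D), mem_pairData.2 ⟨by simp, ?_, hD, hmin,
        fun h h' => hc h' (Or.inl h), fun hv => ⟨hmem hv, ?_⟩⟩, rfl⟩
      · rw [mem_flags]
        intro r hr
        have := h₂ r hr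
        rw [hm₃] at this
        subst hr
        refine ⟨this.1, ?_⟩
        by_contra hlt
        refine hfix ⟨by simp [pair], le_of_eq rfl, ?_⟩
        intro x y hxy
        simp only [pair, List.cons.injEq, and_true] at hxy
        obtain ⟨rfl, rfl⟩ := hxy
        refine ⟨fun r' hr' _ => ?_, fun h => ?_⟩
        · obtain rfl := Option.some.inj hr'
          omega
        · exact absurd h ((mem_take_iff_of_mem_words hD ha' _).2 (hmem rfl))
      · obtain ⟨r, rfl⟩ := Option.isSome_iff_exists.1 hv
        exact (h₂ r rfl).2.2
  · rintro (⟨⟨⟨u, v⟩, D⟩, hi, rfl⟩ | ⟨⟨⟨u, v⟩, D⟩, hi, rfl⟩)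
    · obtain ⟨hu, hv, hD, h₁, h₂, h₃⟩ := mem_pairData.1 hi
      obtain rfl := Finset.mem_singleton.1 hu
      have hlen := length_of_mem_words hD
      have hk : (D.take f).length = f := by
        rw [List.length_take]
        omega
      have hm : (nextCur a false ⟨some 1, D.take f⟩ && v.isSome) = false := by
        cases v with
        | none => simp
        | some r => simpa [nextCur, mem_take_iff_of_mem_words hD ha'] using (h₃ rfl).1
      rcases partSize_pair (B := B) (f := some 1) (g := v) hD hcur hk with
        ⟨hm₁, hm₂, hm₃, -⟩ | ⟨hm₁, hm₂, hm₃, -⟩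
      · rw [hm] at hm₁
        simp at hm₁
      have hm₃ := hm₃ (Or.inl rfl)
      rw [mem_flags] at hv
      refine ⟨⟨⟨(mem_topSet_pair hf₁).2 ⟨good_pair.2 ⟨hD, ?_, ?_, ?_, ?_⟩, rfl, ?_⟩, ?_⟩, rfl⟩, ?_⟩
      · rw [← List.length_pos_iff]
        omega
      · rw [← List.length_pos_iff, List.length_drop]
        omega
      · intro r hr
        obtain rfl := Option.some.inj hr
        rw [hm₂]
        exact ⟨le_rfl, hf₁, h₁⟩
      · intro r hr
        rw [hm₃]
        have := hv r hr
        exact ⟨this.1, by omega, (h₃ (by simp [hr])).2⟩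
      -- When the second part is flagged and `f ≥ 2`, the letter `a` lies beyond the cut and so
      -- cannot be the second letter.
      · intro hε' h
        cases v with
        | none => exact h₂ rfl hε'
        | some r =>
          have h2 : 2 ≤ f := h.resolve_left (by simp)
          have had := (h₃ rfl).1
          rw [← mem_take_iff_of_mem_words hD ha'] at had
          intro h'
          obtain ⟨D', rfl⟩ := hnd hD h₁
          rw [take_eq_cons hf₁] at had
          rw [List.tail_cons, ← head?_take (k := f - 1) (by omega)] at h'
          exact had (List.mem_cons_of_mem _ (List.mem_of_mem_head? h'))
      · intro hfix
        obtain ⟨h₄, -, h₅⟩ := hfix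
        have hvs : v.isSome := h₄ ⟨v, D.drop f⟩ (by simp [pair])
        obtain ⟨r, rfl⟩ := Option.isSome_iff_exists.1 hvs
        have := (h₅ _ _ rfl).1 r rfl (h₃ rfl).1
        have := hv r rfl
        omega
      · simp [pair, sizes, hm₂]
    · obtain ⟨hu, hv, hD, h₁, h₂, h₃, h₄⟩ := mem_pairData.1 hi
      obtain rfl := Finset.mem_singleton.1 hu
      have hlen := length_of_mem_words hD
      have hk' : 2 ≤ f - B := by
        obtain ⟨D', rfl⟩ := hnd hD h₁
        by_contra h
        have : f - B = 0 ∨ f - B = 1 := by omega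
        rcases this with h | h <;> rw [h] at h₃ <;> simp at h₃
        omega
      have hk : (D.take (f - B)).length = f - B := by
        rw [List.length_take]
        omega
      rw [mem_someFlags] at hv
      have hm : (nextCur a false ⟨some 1, D.take (f - B)⟩ && v.isSome) = true := by
        simp [nextCur, h₃, hv.1]
      rcases partSize_pair (B := B) (f := some 1) (g := v) hD hcur hk with
        ⟨hm₁, hm₂, hm₃, -⟩ | ⟨hm₁, hm₂, hm₃, -⟩
      swap
      · rw [hm] at hm₁
        simp at hm₁
      refine ⟨⟨⟨(mem_topSet_pair (by omega)).2 ⟨good_pair.2 ⟨hD, ?_, ?_, ?_, ?_⟩, rfl,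
        fun h _ => h₂ h⟩, ?_⟩, rfl⟩, ?_⟩
      · rw [← List.length_pos_iff]
        omega
      · rw [← List.length_pos_iff, List.length_drop]
        omega
      · intro r hr
        obtain rfl := Option.some.inj hr
        rw [hm₂]
        exact ⟨le_rfl, by omega, h₁⟩
      · intro r hr
        rw [hm₃]
        have := hv.2 r hr
        exact ⟨this.1, by omega, h₄⟩
      · rintro ⟨-, -, h₅⟩
        have := (h₅ _ _ rfl).2 h₃
        simp only [hk] at this
        omega
      · simp only [pair, sizes, hm₂, List.head?_cons]
        congr 1
        omega

theorem gf_minHead_Icc (ha : 1 ≤ a) (P : List ℕ → Prop) :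
    gf (Finset.Icc 1 a) (fun l => MinHead l ∧ P l) =
      gf (Finset.Icc 2 a) (fun l => P (1 :: l)) := by
  rw [gf_minHead (b := 1) (by simpa using ha) (fun x hx => (Finset.mem_Icc.1 hx).1)]
  congr 1
  ext x
  simp only [Finset.mem_erase, Finset.mem_Icc]
  omega

/-- A flagged second part contributes `[min(g, a-1-ε)](a-2)!`, an unflagged one `-W`, and a first
part containing `a` contributes `W - [g](a-2)!` if it has at least two letters. -/
theorem cancels_topSet_two_of_head? (hε : ε = 0 ∨ ε = 1) {f g : ℕ} (hf : f < a)
    (hg : g + f = a + B) (hf₁ : 1 ≤ f) :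
    Cancels {l | ((l ∈ topSet a ε B ∧ ¬ TopFixed a ε B l) ∧ l.length = 2) ∧
        (sizes a B false l).head? = some f} partWeight partSign := by
  have hcard : (Finset.Icc 2 a).card = a - 1 := by simp
  have ha : a ∈ Finset.Icc 2 a := by
    rw [Finset.mem_Icc]
    omega
  have hmax : ∀ x ∈ Finset.Icc 2 a, x ≤ a := fun x hx => (Finset.mem_Icc.1 hx).2
  refine cancels_pairs (fun l => mem_topSet_two hf hg hf₁) ?_ ?_
  · rintro ⟨⟨u, v⟩, D⟩ hi ⟨⟨u', v'⟩, D'⟩ hj hij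
    simp only [pair, List.cons.injEq, Piece.mk.injEq, and_true] at hij
    obtain ⟨⟨-, h₁⟩, rfl, h₂⟩ := hij
    obtain ⟨-, -, hD, -, -, h₃⟩ := mem_pairData.1 hi
    obtain ⟨-, h₄, -, -, -, h₅, -⟩ := mem_pairData.1 hj
    have := (h₃ (mem_someFlags.1 h₄).1).1
    rw [← mem_take_iff_of_mem_words hD (by simp; omega)] at this
    rw [← h₁] at h₅
    exact this h₅
  rw [sum_pairData, sum_pairData, Finset.sum_singleton, Finset.sum_singleton, ← mul_add]
  set W := gf (Finset.Icc 2 a) (fun l => ε = 1 → l.head? ≠ some a) with hW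
  have e₁ : ∀ r, gf (Finset.Icc 1 a) (TopSecond a ε f (some r)) = qFact (a - 2) := by
    intro r
    have h := gf_mem_drop_minHead (m := f - 1) ha hmax (by omega)
    rw [hcard, ← gf_congr (P := fun l => a ∈ (1 :: l).drop f ∧ MinHead ((1 :: l).drop f)) ?_,
      ← gf_minHead_Icc (by omega) (fun l => a ∈ l.drop f ∧ MinHead (l.drop f))] at h
    · refine Eq.trans (gf_congr fun D hD => ?_) h
      simp [TopSecond]
    · intro l _
      rw [drop_cons_eq hf₁]
  have e₂ : gf (Finset.Icc 1 a) (TopSecond a ε f none) = W := by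
    refine Eq.trans (gf_congr fun D hD => ?_)
      (gf_minHead_Icc (by omega) (fun l => ε = 1 → l.tail.head? ≠ some a))
    simp [TopSecond]
  rw [sum_flags e₁, e₂]
  -- The first part begins with `1`, so it needs two letters to contain `a`. With fewer, `g ≥ a - 1`
  -- and the minimum is `a - 1 - ε`; with two or more, `g ≤ a - 2` and the minimum is `g`.
  rcases Nat.lt_or_ge (f - B) 2 with hk | hk
  · have e₃ : gf (Finset.Icc 1 a) (TopFirst a ε (f - B)) = 0 := by
      refine gf_false fun D hD ⟨h₁, h₂, h₃, h₄⟩ => ?_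
      have h1 := h₁ 1 (((mem_words.1 hD).2 1).2 (by simp; omega))
      cases D with
      | nil => simp at h₃
      | cons d D =>
        have h2 := ((mem_words.1 hD).2 d).1 (by simp)
        simp only [List.headD_cons, Finset.mem_Icc] at h1 h2
        have : f - B = 0 ∨ f - B = 1 := by omega
        rcases this with h | h <;> rw [h] at h₃ <;> simp at h₃
        omega
    -- For `ε = 1`, removing the words that begin with `a` subtracts `q^(a-2) (a-2)!` from
    -- `[a-1](a-2)!`, leaving `[a-2](a-2)!`.
    have e₄ : W = qNum (min g (a - 1 - ε)) * qFact (a - 2) := by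
      have h₁ := gf_split (S := Finset.Icc 2 a) (fun _ => True) (fun l => l.head? = some a)
      simp only [true_and] at h₁
      rw [gf_true, gf_head_max ha hmax, hcard, show a - 1 - 1 = a - 2 by omega] at h₁
      rcases hε with rfl | rfl
      · simp only [zero_ne_one, false_imp_iff] at hW
        rw [hW, gf_true, hcard, show min g (a - 1 - 0) = a - 1 by omega,
          qFact_eq (by omega : 1 ≤ a - 1), show a - 1 - 1 = a - 2 by omega]
      · simp only [true_imp_iff, ne_eq] at hW
        rw [← hW, qFact_eq (by omega : 1 ≤ a - 1), show a - 1 - 1 = a - 2 by omega] at h₁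
        rw [show min g (a - 1 - 1) = a - 2 by omega]
        have h₂ : qNum (a - 1) = qNum (a - 2) + X ^ (a - 2) := by
          rw [qNum, qNum, show a - 1 = a - 2 + 1 by omega, Finset.sum_range_succ]
        rw [h₂] at h₁
        linear_combination -h₁
    simp [e₃, e₄]
  · have hy : (Finset.Icc 2 a).card - (f - B - 1) = g := by omega
    have e₃ : qNum g * gf (Finset.Icc 1 a) (TopFirst a ε (f - B)) =
        W - qNum g * qFact (a - 2) := by
      have h₁ := gf_take_minHead (S := Finset.Icc 2 a) (m := f - B - 1) (by omega)
        (fun l => a ∈ l ∧ (ε = 1 → l.head? ≠ some a))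
      have h₂ := gf_split (S := Finset.Icc 2 a) (fun l => ε = 1 → l.head? ≠ some a)
        (fun l => a ∈ l.take (f - B - 1))
      have h₃ := gf_mem_drop (m := f - B - 1) ha hmax (by omega)
      rw [hy] at h₁ h₃
      have h₄ : gf (Finset.Icc 1 a) (TopFirst a ε (f - B)) = gf (Finset.Icc 2 a)
          (fun l => (a ∈ l.take (f - B - 1) ∧ (ε = 1 → (l.take (f - B - 1)).head? ≠ some a)) ∧
            MinHead (l.drop (f - B - 1))) := by
        refine (gf_minHead_Icc (by omega) _).trans (gf_congr fun D hD => ?_)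
        rw [take_eq_cons (by omega), drop_cons_eq (by omega), head?_take (by omega), List.tail_cons,
          List.mem_cons]
        have : a ≠ 1 := by omega
        tauto
      rw [h₄, h₁, ← hW] at *
      rw [hcard] at h₃
      rw [show a - 1 - 1 = a - 2 by omega] at h₃
      rw [h₂, ← h₃]
      rw [gf_congr (P := fun l => (ε = 1 → l.head? ≠ some a) ∧ a ∉ l.take (f - B - 1))
        (Q := fun l => a ∈ l.drop (f - B - 1)), gf_congr (Q := fun l =>
          (ε = 1 → l.head? ≠ some a) ∧ a ∈ l.take (f - B - 1))]
      · ring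
      · intro l _
        rw [head?_take (by omega)]
        tauto
      -- If `a` is not among the first `f - B - 1 ≥ 1` letters, then it is not the first letter and
      -- the condition for `ε = 1` is automatic.
      · intro l hl
        rw [← mem_take_iff_of_mem_words hl ha]
        refine ⟨fun h => h.2, fun h => ⟨fun _ h' => h ?_, h⟩⟩
        rw [← head?_take (k := f - B - 1) (by omega)] at h'
        exact List.mem_of_mem_head? h'
    rw [sum_someFlags (fun r => rfl), e₃, show min g (a - 1 - ε) = g by omega]
    ring

/-- A single part is always fixed. Lists of two parts are handled for each size of the first part,
and longer lists are never fixed. -/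
theorem cancels_topSet (ha : 1 ≤ a) (hε : ε = 0 ∨ ε = 1) :
    Cancels {l ∈ topSet a ε B | ¬ TopFixed a ε B l} (topKey a B) partSign := by
  have hcur : false = true ↔ a ∉ Finset.Icc 1 a := by
    simp
    omega
  have hcard : (Finset.Icc 1 a).card = a := by simp
  refine Cancels.of_fibers List.length fun n => ?_
  have hn : n = 0 ∨ n = 1 ∨ n = 2 ∨ 3 ≤ n := by omega
  rcases hn with rfl | rfl | rfl | hn
  · refine Cancels.of_forall_notMem ?_
    rintro l ⟨⟨⟨-, x, l', rfl, -⟩, -⟩, hl⟩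
    simp at hl
  · refine Cancels.of_forall_notMem ?_
    rintro l ⟨⟨⟨-, x, l', rfl, hx, -⟩, hf⟩, hl⟩
    obtain rfl : l' = [] := by simpa using hl
    exact hf ⟨by simp [hx], by simp, by simp⟩
  · refine Cancels.of_fibers (fun l => (sizes a B false l).head?) fun o => ?_
    cases o with
    | none =>
      refine Cancels.of_forall_notMem ?_
      rintro l ⟨⟨⟨⟨-, x, l', rfl, -⟩, -⟩, -⟩, hl⟩
      simp [sizes] at hl
    | some f =>
      by_cases hf : 1 ≤ f ∧ f < a
      · have h := cancels_topSet_two_of_head? (B := B) hε hf.2 (g := a + B - f) (by omega) hf.1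
        refine h.mono_key fun l hl l' hl' hk => ?_
        have hs : ∀ l, ((l ∈ topSet a ε B ∧ ¬ TopFixed a ε B l) ∧ l.length = 2) ∧
            (sizes a B false l).head? = some f → sizes a B false l = [f, a + B - f] := by
          rintro l ⟨⟨⟨hl, -⟩, hn⟩, hl'⟩
          obtain ⟨h₁, h₂, h₃⟩ := sizes_two (a := a) (B := B) (forb := False) hcur
            (l := l) ⟨hl.1, hn, False.elim⟩ (by simp)
          obtain ⟨x, y, rfl⟩ := List.length_eq_two.1 hn
          have h₄ := congrArg Multiset.sum h₁
          simp only [sizes, List.head?_cons, Option.some.injEq, Multiset.sum_coe, List.sum_cons,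
            List.sum_nil, Multiset.insert_eq_cons, Multiset.sum_cons,
            Multiset.sum_singleton] at hl' h₄ ⊢
          rw [hl'] at h₄ ⊢
          congr 2
          omega
        simp only [topKey, hs l hl, hs l' hl', hk]
      -- With two parts the first has fewer than `a` letters. If its size is nevertheless at least
      -- `a`, it contains `a` and the extra vertices, and the list is fixed.
      · refine Cancels.of_forall_notMem ?_
        rintro l ⟨⟨⟨hl, hfix⟩, hn⟩, hs⟩
        obtain ⟨k, u, v, D, rfl, hk⟩ := exists_pair hn
        obtain ⟨hD, hne₁, hne₂, h₁, h₂⟩ := good_pair.1 hl.1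
        have hk₁ : 1 ≤ k := by
          rw [← hk]
          exact List.length_pos_iff.2 hne₁
        have hk₂ : k < a := by
          have := List.length_pos_iff.2 hne₂
          rw [List.length_drop, length_of_mem_words hD, hcard] at this
          omega
        obtain ⟨-, rfl, -⟩ := (mem_topSet_pair hk₁).1 hl
        have hs : partSize a B false ⟨some 1, D.take k⟩ [⟨v, D.drop k⟩] = f := by
          simpa [pair, sizes] using hs
        rcases partSize_pair (B := B) (f := some 1) (g := v) hD hcur hk with
          ⟨hm₁, hm₂, -, -⟩ | ⟨hm₁, hm₂, -, -⟩
        · rw [Bool.and_eq_true] at hm₁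
          refine hfix ⟨by simp [pair, hm₁.2], le_of_eq rfl, ?_⟩
          intro x y hxy
          simp only [pair, List.cons.injEq, and_true] at hxy
          obtain ⟨rfl, rfl⟩ := hxy
          refine ⟨fun r hr h => ?_, fun h => ?_⟩
          · refine absurd ?_ ((mem_take_iff_of_mem_words hD (by simpa using ha) k).2 h)
            simpa [nextCur] using hm₁.1
          · simp only [hk]
            omega
        · omega
  · refine (cancels_topSet_of_three_le (a := a) (ε := ε) (B := B) hn).restrict ?_ ?_
    · rintro l ⟨⟨h₁, -⟩, h₂⟩
      exact ⟨h₁, h₂⟩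
    · rintro l - l' ⟨h₁, h₂⟩ -
      exact ⟨⟨h₁, fun h => by have := h.2.1; omega⟩, h₂⟩

end top

/-! ### From lists of parts to lists of blocks -/

/-- Adds a block to `L`, or keeps it pending if it continues a tree begun before. -/
def addBlock (w c : List ℕ) (L : List Block) : Option ℕ → (List ℕ × List ℕ) × List Block
  | none => ((w, c), L)
  | some r => (([], []), ⟨w, c, r⟩ :: L)

/-- The blocks encoded by a list of parts. The first component holds the words and sizes of the
parts that belong to a tree begun before. -/
def unparts (a B : ℕ) : Bool → List Piece → (List ℕ × List ℕ) × List Block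
  | _, [] => (([], []), [])
  | cur, x :: l =>
    let p := unparts a B (nextCur a cur x) l
    addBlock (x.seg ++ p.1.1) (partSize a B cur x l :: p.1.2) p.2 x.flag

section unparts

variable {a B : ℕ} {cur : Bool} {S : Finset ℕ} {l : List Piece}

theorem unparts_cons_none {s : List ℕ} : unparts a B cur (⟨none, s⟩ :: l) =
    ((s ++ (unparts a B (nextCur a cur ⟨none, s⟩) l).1.1,
      partSize a B cur ⟨none, s⟩ l :: (unparts a B (nextCur a cur ⟨none, s⟩) l).1.2),
      (unparts a B (nextCur a cur ⟨none, s⟩) l).2) := rfl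

theorem unparts_cons_some {r : ℕ} {s : List ℕ} : unparts a B cur (⟨some r, s⟩ :: l) =
    (([], []), ⟨s ++ (unparts a B (nextCur a cur ⟨some r, s⟩) l).1.1,
      partSize a B cur ⟨some r, s⟩ l :: (unparts a B (nextCur a cur ⟨some r, s⟩) l).1.2, r⟩ ::
      (unparts a B (nextCur a cur ⟨some r, s⟩) l).2) := rfl

theorem unparts_word (cur : Bool) (l : List Piece) :
    (unparts a B cur l).1.1 ++ (unparts a B cur l).2.flatMap Block.word = l.flatMap Piece.seg := by
  induction l generalizing cur with
  | nil => rfl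
  | cons x l ih =>
    obtain ⟨_ | r, s⟩ := x
    · simp [unparts_cons_none, ih]
    · simp [unparts_cons_some, ih]

theorem unparts_comp (cur : Bool) (l : List Piece) :
    (unparts a B cur l).1.2 ++ (unparts a B cur l).2.flatMap Block.comp = sizes a B cur l := by
  induction l generalizing cur with
  | nil => rfl
  | cons x l ih =>
    obtain ⟨_ | r, s⟩ := x
    · simp [unparts_cons_none, ih, sizes]
    · simp [unparts_cons_some, ih, sizes]

theorem unparts_rank (cur : Bool) (l : List Piece) :
    ((unparts a B cur l).2.map fun C => C.r - 1).sum = (l.map Piece.rank).sum := by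
  induction l generalizing cur with
  | nil => rfl
  | cons x l ih =>
    obtain ⟨_ | r, s⟩ := x
    · simp [unparts_cons_none, ih, Piece.rank]
    · simp [unparts_cons_some, ih, Piece.rank]

theorem unparts_sign (cur : Bool) (l : List Piece) :
    (-1 : ℤ) ^ ((unparts a B cur l).1.2.length + excess (unparts a B cur l).2) = partSign l := by
  induction l generalizing cur with
  | nil => rfl
  | cons x l ih =>
    obtain ⟨_ | r, s⟩ := x
    · have := ih (nextCur a cur ⟨none, s⟩)
      rw [partSign, List.map_cons, List.prod_cons, ← partSign, ← this, unparts_cons_none]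
      simp [Piece.sign, pow_add, pow_succ]
    · have := ih (nextCur a cur ⟨some r, s⟩)
      rw [partSign, List.map_cons, List.prod_cons, ← partSign, ← this, unparts_cons_some]
      simp [Piece.sign, excess]

theorem length_sizes (cur : Bool) (l : List Piece) : (sizes a B cur l).length = l.length := by
  induction l generalizing cur with
  | nil => rfl
  | cons x l ih => simp [sizes, ih]

theorem unparts_fst (h : closes l = true) : (unparts a B cur l).1 = ([], []) := by
  cases l with
  | nil => rfl
  | cons x l =>
    obtain ⟨_ | r, s⟩ := x
    · simp [closes] at h
    · rfl

theorem unparts_fst_ne (h : closes l = false) : (unparts a B cur l).1.2 ≠ [] := by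
  cases l with
  | nil => simp [closes] at h
  | cons x l =>
    obtain ⟨_ | r, s⟩ := x
    · simp [unparts_cons_none]
    · simp [closes] at h

/-- The properties of a tree triple in a forest triple of a complete graph with largest vertex `a`
that carries `B` extra vertices. -/
structure IsPart (a B : ℕ) (C : Block) : Prop where
  ne_nil : C.word ≠ []
  head_le : ∀ z ∈ C.word, C.word.headD 0 ≤ z
  comp_pos : ∀ p ∈ C.comp, 1 ≤ p
  comp_sum : C.comp.sum = C.word.length + if a ∈ C.word then B else 0
  lt_last : a ∈ C.word → B < C.comp.getLastD 0
  one_le_r : 1 ≤ C.r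
  r_le : C.r ≤ C.comp.headD 0

/-- The extra vertices are put on the last part of the tree, so they are counted once: by `x` if the
tree closes after `x`, and by the pending parts otherwise. In both cases the last part exceeds `B`,
as every segment is nonempty. -/
theorem Good.pending {x : Piece} (h : Good a B cur S (x :: l)) :
    let p := unparts a B (nextCur a cur x) l
    (∀ n ∈ p.1.2, 1 ≤ n) → (p.1.2 ≠ [] → p.1.2.sum = p.1.1.length +
        (if nextCur a cur x = true ∨ a ∈ p.1.1 then B else 0) ∧
        (nextCur a cur x = true ∨ a ∈ p.1.1 → B < p.1.2.getLastD 0)) →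
      (∀ n ∈ partSize a B cur x l :: p.1.2, 1 ≤ n) ∧
      (partSize a B cur x l :: p.1.2).sum = (x.seg ++ p.1.1).length +
        (if nextCur a cur x = true ∨ a ∈ p.1.1 then B else 0) ∧
        (nextCur a cur x = true ∨ a ∈ p.1.1 →
          B < (partSize a B cur x l :: p.1.2).getLastD 0) := by
  intro p h₁ h₂
  have hpos : 1 ≤ x.seg.length := List.length_pos_iff.2 h.1
  refine ⟨?_, ?_⟩
  · intro n hn
    rcases List.mem_cons.1 hn with rfl | hn
    · rw [partSize]
      omega
    · exact h₁ n hn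
  · cases hc : closes l with
    | true =>
      have hp : p.1 = ([], []) := unparts_fst hc
      rw [hp]
      simp only [partSize, hc, Bool.and_true, List.sum_cons, List.sum_nil, List.append_nil,
        List.not_mem_nil, or_false, List.getLastD_cons]
      refine ⟨rfl, fun h => ?_⟩
      simp [h]
      omega
    | false =>
      have hp : p.1.2 ≠ [] := unparts_fst_ne hc
      obtain ⟨h₃, h₄⟩ := h₂ hp
      simp only [partSize, hc, Bool.and_false, List.sum_cons, h₃, List.length_append]
      refine ⟨by simp; omega, fun h => ?_⟩
      have := h₄ h
      obtain ⟨y, c, hyc⟩ := List.exists_cons_of_ne_nil hp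
      rw [hyc] at this ⊢
      simpa using this

theorem Good.unparts_pending (h : Good a B cur S l) :
    (∀ n ∈ (unparts a B cur l).1.2, 1 ≤ n) ∧ ((unparts a B cur l).1.2 ≠ [] →
      (unparts a B cur l).1.2.sum = (unparts a B cur l).1.1.length +
        (if cur = true ∨ a ∈ (unparts a B cur l).1.1 then B else 0) ∧
        (cur = true ∨ a ∈ (unparts a B cur l).1.1 → B < (unparts a B cur l).1.2.getLastD 0)) := by
  induction l generalizing cur S with
  | nil => simp [unparts]
  | cons x l ih =>
    have ih := ih h.2.2.2.2
    obtain ⟨_ | r, s⟩ := x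
    · obtain ⟨h₁, h₂⟩ := h.pending ih.1 ih.2
      have hiff : nextCur a cur ⟨none, s⟩ = true ∨
            a ∈ (unparts a B (nextCur a cur ⟨none, s⟩) l).1.1 ↔
          cur = true ∨ a ∈ s ++ (unparts a B (nextCur a cur ⟨none, s⟩) l).1.1 := by
        simp only [nextCur, Bool.or_eq_true, decide_eq_true_eq, Option.isNone_none, Bool.and_true,
          List.mem_append]
        tauto
      simp only [hiff] at h₂
      exact ⟨h₁, fun _ => h₂⟩
    · simp [unparts_cons_some]

theorem Good.isPart (h : Good a B cur S l) : ∀ C ∈ (unparts a B cur l).2, IsPart a B C := by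
  induction l generalizing cur S with
  | nil => simp [unparts]
  | cons x l ih =>
    have ih := ih h.2.2.2.2
    have hw := h.mem_words
    have hpend := h.pending h.2.2.2.2.unparts_pending.1 h.2.2.2.2.unparts_pending.2
    obtain ⟨_ | r, s⟩ := x
    · exact ih
    · rw [unparts_cons_some]
      intro C hC
      rcases List.mem_cons.1 hC with rfl | hC
      · obtain ⟨h₁, h₂, h₃⟩ := hpend
        have hiff : nextCur a cur ⟨some r, s⟩ = true ∨
              a ∈ (unparts a B (nextCur a cur ⟨some r, s⟩) l).1.1 ↔
            a ∈ s ++ (unparts a B (nextCur a cur ⟨some r, s⟩) l).1.1 := by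
          simp only [nextCur, Bool.or_eq_true, decide_eq_true_eq, Option.isNone_some,
            Bool.and_false, List.mem_append]
          simp
        simp only [hiff] at h₂ h₃
        obtain ⟨hne, -, -, hr, -⟩ := h
        obtain ⟨y, s, rfl⟩ := List.exists_cons_of_ne_nil hne
        obtain ⟨hr₁, hr₂, hr₃⟩ := hr r rfl
        refine ⟨by simp, fun z hz => ?_, h₁, h₂, h₃, hr₁, hr₂⟩
        refine hr₃ z (((_root_.mem_words.1 hw).2 z).1 ?_)
        rw [← unparts_word (a := a) (B := B) cur, unparts_cons_some, List.nil_append,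
          List.flatMap_cons]
        exact List.mem_append_left _ hz
      · exact ih C hC

theorem Good.heads (h : Good a B cur S l) :
    (unparts a B cur l).2.Pairwise fun C D => C.word.headD 0 < D.word.headD 0 := by
  induction l generalizing cur S with
  | nil => simp [unparts]
  | cons x l ih =>
    have hp := h.2.2.2.2.isPart
    have ih := ih h.2.2.2.2
    have hw := h.2.2.2.2.mem_words
    obtain ⟨_ | r, s⟩ := x
    · exact ih
    · rw [unparts_cons_some]
      refine List.pairwise_cons.2 ⟨fun D hD => ?_, ih⟩
      obtain ⟨hne, -, -, hr, -⟩ := h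
      obtain ⟨y, s, rfl⟩ := List.exists_cons_of_ne_nil hne
      obtain ⟨z, w, hD'⟩ := List.exists_cons_of_ne_nil (hp D hD).ne_nil
      have hz := ((_root_.mem_words.1 hw).2 z).1 (by
        rw [← unparts_word (a := a) (B := B)]
        exact List.mem_append_right _ (List.mem_flatMap.2 ⟨D, hD, by simp [hD']⟩))
      rw [Finset.mem_sdiff] at hz
      have h₁ := (hr r rfl).2.2 z hz.1
      rw [hD']
      simp only [List.headD_cons, List.cons_append] at h₁ ⊢
      refine lt_of_le_of_ne h₁ ?_
      rintro rfl
      simp at hz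

/-- The end of the first segment can be recovered. If no pending parts remain after it, the segment
is the whole word; otherwise its size involves no extra vertices and is the number of its letters.
-/
theorem unparts_injective {l' : List Piece} (h : unparts a B cur l = unparts a B cur l') :
    l = l' := by
  induction l generalizing cur l' with
  | nil =>
    cases l' with
    | nil => rfl
    | cons y l' => obtain ⟨_ | r, s⟩ := y <;> simp [unparts, addBlock] at h
  | cons x l ih =>
    cases l' with
    | nil => obtain ⟨_ | r, s⟩ := x <;> simp [unparts, addBlock] at h
    | cons y l' =>
      have key : ∀ f s s', s ++ (unparts a B (nextCur a cur ⟨f, s⟩) l).1.1 =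
            s' ++ (unparts a B (nextCur a cur ⟨f, s'⟩) l').1.1 →
          partSize a B cur ⟨f, s⟩ l = partSize a B cur ⟨f, s'⟩ l' →
          (unparts a B (nextCur a cur ⟨f, s⟩) l).1.2 =
            (unparts a B (nextCur a cur ⟨f, s'⟩) l').1.2 →
          (unparts a B (nextCur a cur ⟨f, s⟩) l).2 =
            (unparts a B (nextCur a cur ⟨f, s'⟩) l').2 →
          (⟨f, s⟩ :: l : List Piece) = ⟨f, s'⟩ :: l' := by
        intro f s s' h₁ h₂ h₃ h₄
        have hs : s = s' := by
          cases hc : closes l with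
          | true =>
            have hc' : closes l' = true := by
              by_contra hc'
              rw [Bool.not_eq_true] at hc'
              refine unparts_fst_ne hc' (h₃.symm.trans ?_)
              rw [unparts_fst hc]
            rw [unparts_fst hc, unparts_fst hc'] at h₁
            simpa using h₁
          | false =>
            have hc' : closes l' = false := by
              by_contra hc'
              rw [Bool.not_eq_false] at hc'
              refine unparts_fst_ne hc (h₃.trans ?_)
              rw [unparts_fst hc']
            simp only [partSize, hc, hc', Bool.and_false] at h₂
            exact (List.append_inj h₁ (by simpa using h₂)).1
        subst hs
        rw [ih (Prod.ext (Prod.ext (List.append_cancel_left h₁) h₃) h₄)]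
      obtain ⟨f, s⟩ := x
      obtain ⟨f', s'⟩ := y
      cases f with
      | none =>
        cases f' with
        | none =>
          simp only [unparts_cons_none, Prod.mk.injEq, List.cons.injEq] at h
          exact key _ _ _ h.1.1 h.1.2.1 h.1.2.2 h.2
        | some r => simp [unparts_cons_none, unparts_cons_some] at h
      | some r =>
        cases f' with
        | none => simp [unparts_cons_none, unparts_cons_some] at h
        | some r' =>
          simp only [unparts_cons_some, Prod.mk.injEq, List.cons.injEq, Block.mk.injEq,
            true_and] at h
          obtain ⟨⟨h₁, ⟨h₂, h₃⟩, rfl⟩, h₄⟩ := h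
          exact key _ _ _ h₁ h₂ h₃ h₄

/-- The word is cut after as many letters as each part prescribes; the last segment takes what is
left, which falls short of its part by the extra vertices, if any. -/
theorem exists_pieces {c : List ℕ} (hc : c ≠ []) {w : List ℕ} {f : Option ℕ} {m : Bool}
    (hpos : ∀ p ∈ c, 1 ≤ p) (hm : m = nextCur a cur ⟨f, w⟩)
    (hsum : c.sum = w.length + if m then B else 0) (hlast : m = true → B < c.getLastD 0)
    (hw : w.Nodup) (hwS : ∀ z ∈ w, z ∈ S) (hf : ∀ r, f = some r → 1 ≤ r ∧ r ≤ c.headD 0 ∧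
      ∀ z ∈ S, w.headD 0 ≤ z) (hl : closes l = true) (hg : Good a B m (S \ w.toFinset) l) :
    ∃ s l', Good a B cur S (⟨f, s⟩ :: l') ∧ unparts a B cur (⟨f, s⟩ :: l') =
      addBlock w c (unparts a B m l).2 f := by
  induction c generalizing w f cur S with
  | nil => exact absurd rfl hc
  | cons p c ih =>
    have hp : 1 ≤ p := hpos p (by simp)
    by_cases hc' : c = []
    · subst hc'
      have hwne : w ≠ [] := by
        rintro rfl
        cases m <;> simp at hsum hlast <;> omega
      have hsize : partSize a B cur ⟨f, w⟩ l = p := by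
        simpa [partSize, hl, ← hm] using hsum.symm
      refine ⟨w, l, ⟨hwne, hw, hwS, ?_, ?_⟩, ?_⟩
      · intro r hr
        rw [hsize]
        exact hf r hr
      · rw [← hm]
        exact hg
      · cases f with
        | none => simp [unparts_cons_none, hsize, ← hm, unparts_fst hl, addBlock]
        | some r => simp [unparts_cons_some, hsize, ← hm, unparts_fst hl, addBlock]
    · obtain ⟨q, c', rfl⟩ := List.exists_cons_of_ne_nil hc'
      have hlast' : m = true → B < (q :: c').getLastD 0 := by
        intro h
        simpa using hlast h
      have hq : 1 ≤ q := hpos q (by simp)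
      -- The last part alone exceeds the number of extra vertices, so letters remain after the first
      -- `p`.
      have hlt : p < w.length := by
        have h₁ : (q :: c').getLastD 0 ≤ (q :: c').sum := by
          rw [List.getLastD_eq_getLast?, List.getLast?_eq_some_getLast (by simp)]
          exact List.le_sum_of_mem (List.getLast_mem (by simp))
        rw [List.sum_cons] at hsum
        cases m with
        | true =>
          have := hlast' rfl
          simp only [if_true] at hsum
          omega
        | false =>
          simp only [Bool.false_eq_true, if_false, List.sum_cons] at hsum
          omega
      obtain ⟨u, v, rfl, hu⟩ : ∃ u v, w = u ++ v ∧ u.length = p :=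
        ⟨w.take p, w.drop p, (List.take_append_drop p w).symm, by simp; omega⟩
      rw [List.nodup_append] at hw
      have hS : (S \ u.toFinset) \ v.toFinset = S \ (u ++ v).toFinset := by
        ext z
        simp only [Finset.mem_sdiff, List.mem_toFinset, List.mem_append]
        tauto
      have hune : u ≠ [] := by
        rw [← List.length_pos_iff]
        omega
      have hm' : m = nextCur a (nextCur a cur ⟨f, u⟩) ⟨none, v⟩ := by
        rw [hm]
        simp only [nextCur, List.mem_append, Option.isNone_none, Bool.and_true]
        by_cases h : a ∈ u <;> by_cases h' : a ∈ v <;> simp [h, h']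
      have hsum' : (q :: c').sum = v.length + if m then B else 0 := by
        simp only [List.sum_cons, List.length_append] at hsum ⊢
        omega
      have hvS : ∀ z ∈ v, z ∈ S \ u.toFinset := by
        intro z hz
        rw [Finset.mem_sdiff, List.mem_toFinset]
        exact ⟨hwS z (by simp [hz]), fun h => hw.2.2 z h z hz rfl⟩
      obtain ⟨s, l', h₁, h₂⟩ := ih (by simp) (fun p hp => hpos p (List.mem_cons_of_mem _ hp)) hm'
        hsum' hlast' hw.2.1 hvS (by simp) (by rw [hS]; exact hg)
      rw [addBlock] at h₂
      have hsize : partSize a B cur ⟨f, u⟩ (⟨none, s⟩ :: l') = p := by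
        simp [partSize, closes, hu]
      refine ⟨u, ⟨none, s⟩ :: l', ⟨hune, hw.1, fun z hz => hwS z (by simp [hz]), ?_, h₁⟩, ?_⟩
      · intro r hr
        rw [hsize]
        have := hf r hr
        obtain ⟨y, u, rfl⟩ := List.exists_cons_of_ne_nil hune
        exact this
      · cases f with
        | none => rw [unparts_cons_none, hsize, h₂, addBlock]
        | some r => rw [unparts_cons_some, hsize, h₂, addBlock]

theorem exists_unparts_eq {L : List Block} (hL : ∀ C ∈ L, IsPart a B C)
    (hnd : (L.flatMap Block.word).Nodup) (hmem : ∀ z, z ∈ L.flatMap Block.word ↔ z ∈ S)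
    (hheads : L.Pairwise fun C D => C.word.headD 0 < D.word.headD 0) :
    ∃ l, closes l = true ∧ Good a B cur S l ∧ (unparts a B cur l).2 = L := by
  induction L generalizing S cur with
  | nil =>
    refine ⟨[], rfl, ?_, rfl⟩
    show S = ∅
    ext z
    simp [← hmem]
  | cons C L ih =>
    rw [List.flatMap_cons, List.nodup_append] at hnd
    rw [List.pairwise_cons] at hheads
    have hC := hL C (by simp)
    have hcne : C.comp ≠ [] := by
      intro h
      have h₁ := hC.r_le
      have h₂ := hC.one_le_r
      simp [h] at h₁
      omega
    have hmem' : ∀ z, z ∈ L.flatMap Block.word ↔ z ∈ S \ C.word.toFinset := by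
      intro z
      rw [Finset.mem_sdiff, ← hmem, List.flatMap_cons, List.mem_append, List.mem_toFinset]
      constructor
      · exact fun h => ⟨Or.inr h, fun h' => hnd.2.2 z h' z h rfl⟩
      · tauto
    obtain ⟨l, hl, hg, hu⟩ := ih (cur := nextCur a cur ⟨some C.r, C.word⟩)
      (fun D hD => hL D (by simp [hD])) hnd.2.1 hmem' hheads.2
    have hm : nextCur a cur ⟨some C.r, C.word⟩ = decide (a ∈ C.word) := by simp [nextCur]
    have hCS : ∀ z ∈ C.word, z ∈ S := by
      intro z hz
      rw [← hmem, List.flatMap_cons]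
      exact List.mem_append_left _ hz
    have hr : ∀ r, some C.r = some r → 1 ≤ r ∧ r ≤ C.comp.headD 0 ∧
        ∀ z ∈ S, C.word.headD 0 ≤ z := by
      intro r hr
      obtain rfl := Option.some.inj hr
      refine ⟨hC.one_le_r, hC.r_le, fun z hz => ?_⟩
      rw [← hmem, List.flatMap_cons, List.mem_append, List.mem_flatMap] at hz
      rcases hz with hz | ⟨D, hD, hz⟩
      · exact hC.head_le z hz
      · exact (hheads.1 D hD).le.trans ((hL D (by simp [hD])).head_le z hz)
    obtain ⟨s, l', h₁, h₂⟩ := exists_pieces hcne hC.comp_pos rfl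
      (by rw [hC.comp_sum, hm]; simp) (by rw [hm]; simpa using hC.lt_last) hnd.1 hCS hr hl hg
    refine ⟨_, rfl, h₁, ?_⟩
    rw [h₂, addBlock, hu]

end unparts

/-! ### Tree words and inversions in the almost complete graph -/

section almostComplete

variable {a ε B : ℕ} {ha : 1 ≤ a}

theorem LabelledGraph.almostComplete_adj {x y : ℕ} :
    (LabelledGraph.almostComplete a ε ha).graph.Adj x y ↔ x ≠ y ∧ x ∈ Set.Icc 1 a ∧
      y ∈ Set.Icc 1 a ∧ ¬ (ε = 1 ∧ ((x = 1 ∧ y = a) ∨ (x = a ∧ y = 1))) := Iff.rfl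

/-- The only edge that can be missing is `{1, a}`. The letter `1` can only come first, so this edge
is used only if `a` hangs from `1`, which requires that nothing larger than `1` was read before `a`.
-/
theorem isTreeWord_almostComplete_iff {w : List ℕ} :
    IsTreeWord (LabelledGraph.almostComplete a ε ha) w ↔ w ≠ [] ∧ w.Nodup ∧
      (∀ x ∈ w, x ∈ Set.Icc 1 a) ∧ (∀ x ∈ w, w.headD 0 ≤ x) ∧
      (ε = 1 → w.headD 0 = 1 → w.tail.head? ≠ some a) := by
  constructor
  · intro h
    refine ⟨h.ne_nil, h.nodup, h.mem_Icc, h.head_le, fun hε h1 h2 => ?_⟩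
    obtain ⟨x, w, rfl⟩ := List.exists_cons_of_ne_nil h.ne_nil
    obtain rfl : x = 1 := h1
    obtain ⟨w, rfl⟩ : ∃ w', w = a :: w' := by
      cases w with
      | nil => simp at h2
      | cons y w =>
        obtain rfl : y = a := by simpa using h2
        exact ⟨w, rfl⟩
    have h1a : 1 ≠ a := by
      have := h.nodup
      simp at this
      tauto
    have hp : IsParent [1] a 1 := Or.inr ⟨by simp, by omega, by simp⟩
    have := h.adj [1] a w 1 rfl hp
    exact (LabelledGraph.almostComplete_adj.1 this).2.2.2 ⟨hε, Or.inr ⟨rfl, rfl⟩⟩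
  · rintro ⟨h₁, h₂, h₃, h₄, h₅⟩
    refine ⟨h₁, h₂, h₃, h₄, ?_⟩
    rintro u x v y rfl hp
    have hyu := hp.mem
    rw [LabelledGraph.almostComplete_adj]
    refine ⟨hp.ne, h₃ x (by simp), h₃ y (by simp [hyu]), ?_⟩
    rintro ⟨hε, ⟨rfl, rfl⟩ | ⟨rfl, rfl⟩⟩
    · obtain ⟨z, u, rfl⟩ := List.exists_cons_of_ne_nil (List.ne_nil_of_mem hyu)
      have h := h₄ 1 (by simp)
      have h' := (h₃ z (by simp)).1
      simp only [List.cons_append, List.headD_cons] at h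
      obtain rfl : z = 1 := by omega
      simp at h₂
    · obtain ⟨z, u, rfl⟩ := List.exists_cons_of_ne_nil (List.ne_nil_of_mem hyu)
      have h := h₄ 1 (List.mem_append_left _ hyu)
      have h' := (h₃ z (by simp)).1
      simp only [List.cons_append, List.headD_cons] at h
      obtain rfl : z = 1 := by omega
      have hu : u = [] := by
        rw [List.eq_nil_iff_forall_not_mem]
        intro t ht
        have htx := (h₃ t (by simp [ht])).2
        have h1t : 1 ≤ t := (h₃ t (by simp [ht])).1
        have h1x : x ∈ Set.Icc 1 x := h₃ x (by simp)
        simp only [List.cons_append, List.nodup_cons, List.mem_append, List.mem_cons,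
          List.nodup_append] at h₂
        rcases hp with ⟨s, t', -, h, -⟩ | ⟨-, -, h⟩
        · have := h1x.1
          omega
        · have := h t (by simp [ht])
          obtain rfl : t = 1 := by omega
          exact h₂.1 (Or.inl ht)
      subst hu
      exact h₅ hε rfl rfl

theorem isLeft_almostComplete_iff {L : List Block} :
    IsLeft (LabelledGraph.almostComplete a ε ha) B L ↔ (∀ C ∈ L, IsPart a B C) ∧
      (L.flatMap Block.word).Nodup ∧ (∀ v, v ∈ L.flatMap Block.word ↔ v ∈ Finset.Icc 1 a) ∧
      (L.Pairwise fun C D => C.word.headD 0 < D.word.headD 0) ∧ SimpleBlocks L ∧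
      (ε = 1 → ∀ C ∈ L.head?, C.word.tail.head? ≠ some a) := by
  constructor
  · intro h
    refine ⟨fun C hC => ?_, h.nodup, fun v => (h.mem_iff v).trans Finset.mem_Icc.symm, h.heads, h.simple,
      fun hε C hC => ?_⟩
    · have h' := h.isLeftBlock C hC
      exact ⟨h'.isTreeWord.ne_nil, h'.isTreeWord.head_le, h'.comp_pos, h'.comp_sum, h'.lt_last,
        h'.one_le_r, h'.r_le⟩
    · obtain ⟨L, rfl⟩ : ∃ L', L = C :: L' := by
        cases L with
        | nil => simp at hC
        | cons D L => exact ⟨L, by simpa using hC⟩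
      have h' := isTreeWord_almostComplete_iff.1 (h.isLeftBlock C (by simp)).isTreeWord
      refine h'.2.2.2.2 hε ?_
      have h1 := (h.mem_iff 1).2 ⟨le_rfl, ha⟩
      rw [List.flatMap_cons, List.mem_append, List.mem_flatMap] at h1
      obtain ⟨z, w, hw⟩ := List.exists_cons_of_ne_nil h'.1
      have hz : 1 ≤ C.word.headD 0 := (h'.2.2.1 _ (by simp [hw])).1
      rcases h1 with h1 | ⟨D, hD, h1⟩
      · have := h'.2.2.2.1 1 h1
        omega
      · have := (List.pairwise_cons.1 h.heads).1 D hD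
        have := (h.isLeftBlock D (by simp [hD])).isTreeWord.head_le 1 h1
        omega
  · rintro ⟨h₁, h₂, h₃, h₄, h₅, h₆⟩
    refine ⟨fun C hC => ?_, h₂, fun v => (h₃ v).trans Finset.mem_Icc, h₄, h₅⟩
    have hC' := h₁ C hC
    refine ⟨isTreeWord_almostComplete_iff.2 ⟨hC'.ne_nil, ?_, ?_, hC'.head_le, fun hε h1 => ?_⟩,
      hC'.comp_pos, hC'.comp_sum, hC'.lt_last, hC'.one_le_r, hC'.r_le⟩
    · exact (List.nodup_flatMap.1 h₂).1 C hC
    · intro x hx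
      simpa using (h₃ x).1 (List.mem_flatMap.2 ⟨C, hC, hx⟩)
    · cases L with
      | nil => simp at hC
      | cons D L =>
        rcases List.mem_cons.1 hC with rfl | hC
        · exact h₆ hε C rfl
        · have h := (List.pairwise_cons.1 h₄).1 C hC
          obtain ⟨z, w, hw⟩ := List.exists_cons_of_ne_nil (h₁ D (by simp)).ne_nil
          have hz := (h₃ z).1 (List.mem_flatMap.2 ⟨D, by simp, by simp [hw]⟩)
          rw [Finset.mem_Icc] at hz
          rw [hw, List.headD_cons] at h
          omega

/-- As `1` comes first, it takes part in no inversion, so the missing edge `{1, a}` does not matter.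
-/
theorem invCount_almostComplete {l : List ℕ} (hl : ∀ x ∈ 1 :: l, x ∈ Set.Icc 1 a)
    (hnd : (1 :: l).Nodup) :
    (LabelledGraph.almostComplete a ε ha).invCount (1 :: l) = invs (1 :: l) := by
  have h₁ : ∀ l : List ℕ, (∀ x ∈ l, x ∈ Set.Icc 1 a) → (∀ x ∈ l, x ≠ 1) →
      (LabelledGraph.almostComplete a ε ha).invCount l = invs l := by
    intro l
    induction l with
    | nil => intros; rfl
    | cons x l ih =>
      intro h h'
      rw [LabelledGraph.invCount, invs, ih (fun y hy => h y (by simp [hy]))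
        (fun y hy => h' y (by simp [hy]))]
      congr 1
      refine List.countP_congr fun y hy => ?_
      simp only [decide_eq_true_eq, LabelledGraph.almostComplete_adj]
      have h₁ := h x (by simp)
      have h₂ := h y (by simp [hy])
      have h₃ := h' x (by simp)
      have h₄ := h' y (by simp [hy])
      constructor
      · exact fun h => h.1
      · exact fun h => ⟨h, h.ne, h₂, h₁, fun h => by omega⟩
  rw [List.nodup_cons] at hnd
  rw [LabelledGraph.invCount, invs, h₁ l (fun x hx => hl x (by simp [hx]))
    (fun x hx h => hnd.1 (h ▸ hx))]
  congr 1
  refine List.countP_congr fun y hy => ?_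
  have := (hl y (by simp [hy])).1
  simp only [decide_eq_true_eq]
  omega

end almostComplete

/-! ### The involution on left parts -/

section transport

variable {a ε B : ℕ} {ha : 1 ≤ a} {cur : Bool} {S : Finset ℕ} {l : List Piece}

theorem unparts_excess (cur : Bool) (l : List Piece) :
    (unparts a B cur l).1.2.length + excess (unparts a B cur l).2 =
      l.countP fun x => x.flag.isNone := by
  induction l generalizing cur with
  | nil => rfl
  | cons x l ih =>
    rw [List.countP_cons]
    obtain ⟨_ | r, s⟩ := x
    · have := ih (nextCur a cur ⟨none, s⟩)
      rw [unparts_cons_none]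
      simp only [List.length_cons, Option.isNone_none, if_true]
      omega
    · have := ih (nextCur a cur ⟨some r, s⟩)
      rw [unparts_cons_some]
      simpa [excess] using this

theorem excess_eq_zero_iff {L : List Block} :
    excess L = 0 ↔ ∀ C ∈ L, C.comp.length ≤ 1 := by
  rw [excess, List.sum_eq_zero_iff]
  simp only [List.mem_map, forall_exists_index, and_imp, forall_apply_eq_imp_iff₂]
  exact forall₂_congr fun C _ => by omega

/-- The first two letters of the tree word of the first block. -/
theorem Good.head?_tail_ne_iff {x : Piece} (h : Good a B cur S (x :: l)) (b : ℕ) :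
    (x.seg ++ (unparts a B (nextCur a cur x) l).1.1).tail.head? ≠ some b ↔
      x.seg.tail.head? ≠ some b ∧
        (x.seg.tail = [] → ∀ y ∈ l.head?, y.flag = none → y.seg.head? ≠ some b) := by
  obtain ⟨hne, -, -, -, hl⟩ := h
  obtain ⟨z, s, hs⟩ := List.exists_cons_of_ne_nil hne
  rw [hs, List.cons_append, List.tail_cons, List.tail_cons]
  cases s with
  | cons t s => simp
  | nil =>
    rw [List.nil_append]
    cases l with
    | nil => simp [unparts]
    | cons y l =>
      obtain ⟨_ | r, s⟩ := y
      · rw [unparts_cons_none]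
        obtain ⟨t, s', rfl⟩ := List.exists_cons_of_ne_nil hl.1
        simp
      · rw [unparts_cons_some]
        simp

theorem isLeft_unparts (hl : l ∈ topSet a ε B) :
    IsLeft (LabelledGraph.almostComplete a ε ha) B (unparts a B false l).2 := by
  obtain ⟨hg, x, l', rfl, hx, hε⟩ := hl
  have hw := mem_words.1 hg.mem_words
  have hword := unparts_word (a := a) (B := B) false (x :: l')
  rw [unparts_fst (by simp [closes, hx]), List.nil_append] at hword
  rw [← hword] at hw
  refine isLeft_almostComplete_iff.2 ⟨hg.isPart, hw.1, hw.2, hg.heads, ?_, fun h => ?_⟩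
  · obtain ⟨f, s⟩ := x
    obtain rfl : f = some 1 := hx
    rw [unparts_cons_some]
    intro C hC
    obtain rfl := Option.some.inj hC
    rfl
  · have := (hg.head?_tail_ne_iff a).2 (hε h)
    obtain ⟨f, s⟩ := x
    obtain rfl : f = some 1 := hx
    rw [unparts_cons_some]
    intro C hC
    obtain rfl := Option.some.inj hC
    exact this

theorem exists_mem_topSet {L : List Block}
    (hL : IsLeft (LabelledGraph.almostComplete a ε ha) B L) :
    ∃ l ∈ topSet a ε B, (unparts a B false l).2 = L := by
  obtain ⟨h₁, h₂, h₃, h₄, h₅, h₆⟩ := isLeft_almostComplete_iff.1 hL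
  obtain ⟨l, hc, hg, rfl⟩ := exists_unparts_eq (cur := false) h₁ h₂ h₃ h₄
  refine ⟨l, ⟨hg, ?_⟩, rfl⟩
  cases l with
  | nil =>
    have := (h₃ 1).2 (by simpa using ha)
    simp [unparts] at this
  | cons x l =>
    have hε := hg.head?_tail_ne_iff a
    obtain ⟨_ | r, s⟩ := x
    · simp [closes] at hc
    · rw [unparts_cons_some] at h₅ h₆
      obtain rfl : r = 1 := h₅ _ rfl
      exact ⟨_, l, rfl, rfl, fun h => hε.1 (h₆ h _ rfl)⟩

/-- The condition for fixed points, for the part of a forest triple that lies in the almost complete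
graph. -/
def LeftFixed (a ε B : ℕ) (L : List Block) : Prop :=
  (∀ C ∈ L, C.comp.length ≤ 1) ∧ (L.map fun C => C.comp.length).sum ≤ 2 ∧
    ∀ C ∈ L, a ∈ C.word → (1 ∉ C.word → a - ε ≤ C.r) ∧ (1 ∈ C.word → a ≤ C.word.length + B)

theorem closes_of_mem_topSet (hl : l ∈ topSet a ε B) : closes l = true := by
  obtain ⟨-, x, l', rfl, hx, -⟩ := hl
  simp [closes, hx]

theorem comp_unparts (hl : l ∈ topSet a ε B) :
    (unparts a B false l).2.flatMap Block.comp = sizes a B false l := by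
  rw [← unparts_comp, unparts_fst (closes_of_mem_topSet hl), List.nil_append]

theorem leftFixed_unparts_iff (ha : 1 ≤ a) (hl : l ∈ topSet a ε B) :
    LeftFixed a ε B (unparts a B false l).2 ↔ TopFixed a ε B l := by
  have hsome : (∀ C ∈ (unparts a B false l).2, C.comp.length ≤ 1) ↔ ∀ x ∈ l, x.flag.isSome := by
    have h := unparts_excess (a := a) (B := B) false l
    rw [unparts_fst (closes_of_mem_topSet hl), List.length_nil, zero_add] at h
    rw [← excess_eq_zero_iff, h, List.countP_eq_zero]
    exact forall₂_congr fun x _ => by cases x.flag <;> simp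
  have hlen := congrArg List.length (comp_unparts hl)
  rw [length_sizes, List.length_flatMap] at hlen
  rw [LeftFixed, TopFixed, hsome, hlen]
  refine and_congr_right fun h₁ => and_congr_right fun h₂ => ?_
  have hw := mem_words.1 hl.1.mem_words
  have hcard := length_of_mem_words hl.1.mem_words
  obtain ⟨hg, ⟨f, s⟩, l', rfl, hx, -⟩ := hl
  obtain rfl : f = some 1 := hx
  have h1s : 1 ∈ s := by
    obtain ⟨z, s, rfl⟩ := List.exists_cons_of_ne_nil hg.1
    have h₁ := (hg.2.2.2.1 1 rfl).2.2 1 (by simpa using ha)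
    have h₂ := hg.2.2.1 z (by simp)
    simp only [List.headD_cons, Finset.mem_Icc] at h₁ h₂
    simp
    omega
  cases l' with
  | nil =>
    -- With one part there is a single tree on all `a` vertices, so both sides hold.
    simp only [List.flatMap_cons, List.flatMap_nil, List.append_nil, Nat.card_Icc,
      add_tsub_cancel_right] at hcard
    simp [unparts, addBlock, h1s, hcard]
  | cons y l' =>
    obtain rfl : l' = [] := by simpa using h₂
    obtain ⟨f, t⟩ := y
    obtain ⟨r, rfl⟩ := Option.isSome_iff_exists.1 (h₁ ⟨f, t⟩ (by simp))
    have h1t : 1 ∉ t := by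
      simp only [List.flatMap_cons, List.flatMap_nil, List.append_nil, List.nodup_append] at hw
      exact fun h => hw.1.2.2 1 h1s 1 h rfl
    simp [unparts, addBlock, h1s, h1t]
    tauto

/-- The cancellation of lists of parts is carried over by `unparts`. A list in `topSet` begins with
a flagged part, so nothing is pending and only the second component of `unparts` matters. -/
theorem cancels_isLeft (hε : ε = 0 ∨ ε = 1) :
    Cancels {L | IsLeft (LabelledGraph.almostComplete a ε ha) B L ∧ ¬ LeftFixed a ε B L}
      (fun L => ((↑(L.flatMap Block.comp) : Multiset ℕ),
        blockWeight (LabelledGraph.almostComplete a ε ha) L, firstPartOf L))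
      (fun L => (-1) ^ excess L) := by
  refine (cancels_topSet (B := B) ha hε).transport (fun l => (unparts a B false l).2) ?_ ?_ ?_ ?_ ?_
  · rintro l ⟨hl, hf⟩
    exact ⟨isLeft_unparts hl, fun h => hf ((leftFixed_unparts_iff ha hl).1 h)⟩
  · rintro l ⟨hl, -⟩ l' ⟨hl', -⟩ h
    refine unparts_injective (Prod.ext ?_ h)
    rw [unparts_fst (closes_of_mem_topSet hl), unparts_fst (closes_of_mem_topSet hl')]
  · rintro L ⟨hL, hf⟩
    obtain ⟨l, hl, rfl⟩ := exists_mem_topSet hL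
    exact ⟨l, ⟨hl, fun h => hf ((leftFixed_unparts_iff ha hl).2 h)⟩, rfl⟩
  · have hkey : ∀ l ∈ topSet a ε B,
        ((↑((unparts a B false l).2.flatMap Block.comp) : Multiset ℕ),
          blockWeight (LabelledGraph.almostComplete a ε ha) (unparts a B false l).2,
          firstPartOf (unparts a B false l).2) =
        ((topKey a B l).1, (topKey a B l).2.1, (topKey a B l).2.2.getD 0) := by
      intro l hl
      have hw := mem_words.1 hl.1.mem_words
      rw [comp_unparts hl, blockWeight, unparts_rank]
      have hword := unparts_word (a := a) (B := B) false l
      rw [unparts_fst (closes_of_mem_topSet hl), List.nil_append] at hword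
      rw [hword]
      obtain ⟨hg, ⟨f, s⟩, l', rfl, hx, -⟩ := hl
      obtain rfl : f = some 1 := hx
      obtain ⟨z, s, rfl⟩ := List.exists_cons_of_ne_nil hg.1
      obtain rfl : z = 1 := by
        have h₁ := (hg.2.2.2.1 1 rfl).2.2 1 (by simpa using ha)
        have h₂ := hg.2.2.1 z (by simp)
        simp only [List.headD_cons, Finset.mem_Icc] at h₁ h₂
        omega
      rw [List.flatMap_cons, List.cons_append] at hw ⊢
      rw [invCount_almostComplete _ hw.1]
      · simp only [topKey, partWeight, List.flatMap_cons, List.cons_append, sizes, List.head?_cons,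
          Option.getD_some, unparts_cons_some, firstPartOf, Option.map_some, List.headD_cons]
      · intro x hx
        simpa using (hw.2 x).1 hx
    rintro l ⟨hl, -⟩ l' ⟨hl', -⟩ h
    simp only [hkey l hl, hkey l' hl', h]
  · rintro l ⟨hl, -⟩ l' ⟨hl', -⟩ - h
    have hs : ∀ l ∈ topSet a ε B, (-1 : ℤ) ^ excess (unparts a B false l).2 = partSign l := by
      intro l hl
      rw [← unparts_sign (a := a) (B := B) false l, unparts_fst (closes_of_mem_topSet hl)]
      simp
    rw [hs l hl, hs l' hl', h]

end transport

/-! ### The involution for the sum -/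

section sum

variable {a ε : ℕ} {ha : 1 ≤ a} {G' : LabelledGraph}

theorem exists_blocks_eq_combine {G₁ G₂ : LabelledGraph} (F : SimpleForestTriple (G₁.sum G₂)) :
    ∃ L, ∃ F' : SimpleForestTriple G₂, IsLeft G₁ (F'.1.firstPart - 1) L ∧
      F.1.blocks = combine G₁.n L F'.1.blocks := by
  obtain ⟨L, R, hR, hs, hL, h⟩ := exists_combine F.1.isForest_blocks ((F.1.isSimple_iff).1 F.2)
  obtain ⟨F', rfl⟩ := ForestTriple.exists_blocks_eq hR
  exact ⟨L, ⟨F', (F'.isSimple_iff).2 hs⟩, by rwa [F'.firstPart_eq], h.symm⟩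

theorem exists_combine_eq_blocks {G₁ G₂ : LabelledGraph} {L : List Block}
    {F' : SimpleForestTriple G₂} (hL : IsLeft G₁ (F'.1.firstPart - 1) L) :
    ∃ F : SimpleForestTriple (G₁.sum G₂), F.1.blocks = combine G₁.n L F'.1.blocks := by
  rw [F'.1.firstPart_eq] at hL
  have h := F'.1.isForest_blocks
  obtain ⟨F, hF⟩ := ForestTriple.exists_blocks_eq
    (isForest_combine h ((F'.1.isSimple_iff).1 F'.2) hL)
  exact ⟨⟨F, (F.isSimple_iff).2 (hF ▸ simpleBlocks_combine hL h)⟩, hF⟩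

/-- The condition for fixed points of the involution for the sum of graphs. -/
def SumFixed (a ε : ℕ) (ha : 1 ≤ a) (φ' : SimpleForestTriple G' → SimpleForestTriple G')
    (F : SimpleForestTriple ((LabelledGraph.almostComplete a ε ha).sum G')) : Prop :=
  F.1.IsAtom ∧ (∃ F', IsRestriction F F' ∧ φ' F' = F') ∧ F.1.seg a ≤ 2 ∧
    ∀ S ∈ F.1.triples, a ∈ S.verts →
      (1 ∉ S.verts → a - ε ≤ S.r) ∧ (1 ∈ S.verts → a ≤ S.verts.ncard)

/-- If the restriction is fixed by `φ'`, it is an atom. So being an atom is decided by the left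
part, and the first tree of the restriction has `B` vertices besides the glueing vertex; the tree
through `a` therefore has `B` vertices more than its left piece. -/
theorem sumFixed_iff {φ' : SimpleForestTriple G' → SimpleForestTriple G'}
    (hφ' : IsNiceInvolution φ')
    {F : SimpleForestTriple ((LabelledGraph.almostComplete a ε ha).sum G')}
    {F' : SimpleForestTriple G'} {L : List Block}
    (hL : IsLeft (LabelledGraph.almostComplete a ε ha) (F'.1.firstPart - 1) L)
    (hF : F.1.blocks = combine a L F'.1.blocks) :
    SumFixed a ε ha φ' F ↔ φ' F' = F' ∧ LeftFixed a ε (F'.1.firstPart - 1) L := by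
  have hres := isRestriction_of_combine hL hF
  have hres' : (∃ F', IsRestriction F F' ∧ φ' F' = F') ↔ φ' F' = F' := by
    constructor
    · rintro ⟨F₁, h₁, h₂⟩
      obtain rfl := isRestriction_unique h₁ hres
      exact h₂
    · exact fun h => ⟨F', hres, h⟩
  rw [SumFixed, hres', and_left_comm]
  refine and_congr_right fun hfix => ?_
  have hatom' := (F'.1.isAtom_iff).1 (hφ'.isAtom F' hfix)
  have hR := F'.1.isForest_blocks
  have hexc := excess_combine hL hR
  rw [excess_eq_zero_iff.2 hatom', add_zero] at hexc
  have hatom : F.1.IsAtom ↔ ∀ C ∈ L, C.comp.length ≤ 1 := by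
    rw [F.1.isAtom_iff, ← excess_eq_zero_iff, hF, ← excess_eq_zero_iff, ← hexc]
    rfl
  have hseg : F.1.seg a = (L.map fun C => C.comp.length).sum := seg_of_combine hR hL hF
  rw [hatom, hseg, LeftFixed]
  refine and_congr_right fun _ => and_congr_right fun _ => ?_
  obtain ⟨D, R, hDR, hD, hc, hb, hf⟩ := hR.exists_cons
  obtain ⟨L₁, C, L₂, rfl, hC, hL₁, hL₂⟩ := hL.exists_split
  rw [hDR] at hR hF hatom' hf
  obtain ⟨T₁, S, T₂, T₃, hT, hT₁, hT₂, hT₃, hSw, hSc, hSr, hnum, hseg, hp₁, hpS, hSn, hp₂, hp₃⟩ :=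
    exists_triple_of_combine hR hL hD hC hL₁ hL₂ hF
  have htwo := (hR.two_le hD).1
  -- The composition of `D` has only one part, so the size of its tree is the first part of `F'`.
  have hDlen : D.word.tail.length = F'.1.firstPart - 1 := by
    have h₁ := hatom' D (by simp)
    have h₂ := (hR.isValid D (by simp)).comp_sum
    have h₃ : D.comp.tail = [] := by
      rw [← List.length_eq_zero_iff, List.length_tail]
      omega
    rw [hc, h₃, List.sum_cons, List.sum_nil, add_zero] at h₂
    rw [List.length_tail, F'.1.firstPart_eq, hDR, hf, h₂]
  have hncard : S.verts.ncard = C.word.length + (F'.1.firstPart - 1) := by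
    rw [← hDlen, ← List.length_map (as := D.word.tail)
      (· + ((LabelledGraph.almostComplete a ε ha).n - 1)), ← List.length_append, ← hSw]
    exact S.isDecreasing.length_treeList.symm
  have h1 : 1 ∈ S.verts ↔ 1 ∈ C.word := by
    rw [← S.mem_list, hSw, List.mem_append, or_iff_left]
    intro h
    obtain ⟨z, hz, hz'⟩ := List.mem_map.1 h
    have := htwo z hz
    omega
  have hS : ∀ T ∈ F.1.triples, a ∈ T.verts → T = S := by
    intro T hT' haT
    refine (F.1.cover a ⟨ha, ?_⟩).unique ⟨hT', haT⟩ ⟨by simp [hT], hSn⟩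
    have := G'.pos
    have : ((LabelledGraph.almostComplete a ε ha).sum G').n = a + G'.n - 1 := rfl
    omega
  have hC' : ∀ E ∈ L₁ ++ C :: L₂, a ∈ E.word → E = C := by
    intro E hE haE
    rcases List.mem_append.1 hE with h | h
    · exact absurd haE (hL₁ E h)
    · rcases List.mem_cons.1 h with h | h
      · exact h
      · exact absurd haE (hL₂ E h)
  constructor
  · rintro h E hE haE
    obtain rfl := hC' E hE haE
    have := h S (by simp [hT]) hSn
    rwa [h1, hncard, hSr] at this
  · rintro h T hT' haT
    obtain rfl := hS T hT' haT
    have := h C (by simp) hC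
    rwa [h1, hncard, hSr]

theorem ForestTriple.sign_cases {G : LabelledGraph} (F : ForestTriple G) :
    F.sign = 1 ∨ F.sign = -1 := neg_one_pow_eq_or ℤ _

/-- The statistics of a pair of forest triples of the two graphs. -/
noncomputable def pairKey (G₁ : LabelledGraph) (y : List Block × SimpleForestTriple G') :
    (Multiset ℕ × ℕ × ℕ) × Multiset ℕ × ℕ × ℕ :=
  ((↑(y.1.flatMap Block.comp), blockWeight G₁ y.1, firstPartOf y.1),
    (y.2.1.type, y.2.1.weight, y.2.1.firstPart))

/-- The sign of a pair of forest triples of the two graphs. -/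
def pairSign (y : List Block × SimpleForestTriple G') : ℤ := (-1) ^ excess y.1 * y.2.1.sign

/-- If `φ'` moves the right factor, apply it there; the left factor stays admissible because the
first part, hence `B`, is preserved. If the right factor is fixed, use `cancels_isLeft` for its
value of `B`. -/
theorem cancels_left_right (hε : ε = 0 ∨ ε = 1)
    {φ' : SimpleForestTriple G' → SimpleForestTriple G'} (hφ' : IsNiceInvolution φ') :
    Cancels {y : List Block × SimpleForestTriple G' |
        IsLeft (LabelledGraph.almostComplete a ε ha) (y.2.1.firstPart - 1) y.1 ∧
          ¬ (φ' y.2 = y.2 ∧ LeftFixed a ε (y.2.1.firstPart - 1) y.1)}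
      (pairKey (LabelledGraph.almostComplete a ε ha)) pairSign := by
  refine Cancels.of_fibers (fun y => φ' y.2 = y.2) fun p => ?_
  by_cases hp : p
  · refine Cancels.of_fibers Prod.snd fun F' => ?_
    by_cases hF' : φ' F' = F'
    · refine (cancels_isLeft (B := F'.1.firstPart - 1) (ha := ha) hε).transport (fun L => (L, F'))
        ?_ ?_ ?_ ?_ ?_
      · rintro L ⟨hL, hLf⟩
        exact ⟨⟨⟨hL, fun h => hLf h.2⟩, by simp [hF', hp]⟩, rfl⟩
      · rintro L - L' - h
        exact congrArg Prod.fst h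
      · rintro ⟨L, F₁⟩ ⟨⟨⟨hL, hLf⟩, -⟩, rfl⟩
        exact ⟨L, ⟨hL, fun h => hLf ⟨hF', h⟩⟩, rfl⟩
      · rintro L - L' - h
        exact congrArg (·, _) h
      · rintro L - L' - - h
        simp only [pairSign, h, neg_mul]
    · refine Cancels.of_forall_notMem ?_
      rintro ⟨L, F₁⟩ ⟨⟨-, h⟩, rfl⟩
      exact hF' (by simpa [hp] using h)
  · refine ⟨fun y => (y.1, φ' y.2), ?_⟩
    rintro ⟨L, F'⟩ ⟨⟨hL, hLf⟩, h⟩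
    have hne : φ' F' ≠ F' := by simpa [hp] using h
    have hne' : φ' (φ' F') ≠ φ' F' := by
      rw [hφ'.involutive F']
      exact hne.symm
    refine ⟨⟨⟨?_, fun h => hne' h.1⟩, by simp [hp, hne']⟩, ?_, ?_, ?_⟩
    · show IsLeft _ ((φ' F').1.firstPart - 1) L
      rwa [hφ'.firstPart_eq]
    · show (L, φ' (φ' F')) = (L, F')
      rw [hφ'.involutive F']
    · simp only [pairKey, hφ'.type_eq, hφ'.weight_eq, hφ'.firstPart_eq]
    · simp only [pairSign, hφ'.sign_eq F' hne, mul_neg]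

/-- Glueing is a bijection from pairs to forest triples. It is injective because the right factor is
recovered as the restriction, after which the left factor can be cancelled. -/
theorem cancels_not_sumFixed (hε : ε = 0 ∨ ε = 1)
    {φ' : SimpleForestTriple G' → SimpleForestTriple G'} (hφ' : IsNiceInvolution φ') :
    Cancels {F : SimpleForestTriple ((LabelledGraph.almostComplete a ε ha).sum G') |
        ¬ SumFixed a ε ha φ' F}
      (fun F => (F.1.type, F.1.weight, F.1.firstPart)) (fun F => F.1.sign) := by
  rcases isEmpty_or_nonempty
    (SimpleForestTriple ((LabelledGraph.almostComplete a ε ha).sum G')) with hE | hE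
  · exact Cancels.of_forall_notMem fun F => (hE.false F).elim
  have hg : ∀ y : List Block × SimpleForestTriple G',
      IsLeft (LabelledGraph.almostComplete a ε ha) (y.2.1.firstPart - 1) y.1 →
        ∃ F : SimpleForestTriple ((LabelledGraph.almostComplete a ε ha).sum G'),
          F.1.blocks = combine a y.1 y.2.1.blocks := fun y hy => exists_combine_eq_blocks hy
  choose! g hg using hg
  refine (cancels_left_right (ha := ha) hε hφ').transport g ?_ ?_ ?_ ?_ ?_
  · rintro y ⟨hy, hf⟩ h
    exact hf ((sumFixed_iff hφ' hy (hg y hy)).1 h)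
  · rintro y ⟨hy, -⟩ z ⟨hz, -⟩ h
    have h₁ := hg y hy
    rw [h] at h₁
    have h₂ : y.2 = z.2 := isRestriction_unique (isRestriction_of_combine hy h₁)
      (isRestriction_of_combine hz (hg z hz))
    rw [hg z hz, h₂] at h₁
    exact Prod.ext (combine_left_cancel (G₁ := LabelledGraph.almostComplete a ε ha)
      z.2.1.isForest_blocks h₁.symm) h₂
  · intro F hF
    obtain ⟨L, F', hL, h⟩ := exists_blocks_eq_combine F
    refine ⟨(L, F'), ⟨hL, fun h' => hF ((sumFixed_iff hφ' hL h).2 h')⟩, ?_⟩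
    exact Subtype.ext (ForestTriple.blocks_injective ((hg (L, F') hL).trans h.symm))
  · rintro y ⟨hy, -⟩ z ⟨hz, -⟩ h
    simp only [pairKey, Prod.mk.injEq] at h
    obtain ⟨⟨h₁, h₂, h₃⟩, h₄, h₅, h₆⟩ := h
    have ty := type_combine hy y.2.1.isForest_blocks
    have tz := type_combine hz z.2.1.isForest_blocks
    have wy := blockWeight_combine hy y.2.1.isForest_blocks ((y.2.1.isSimple_iff).1 y.2.2)
    have wz := blockWeight_combine hz z.2.1.isForest_blocks ((z.2.1.isSimple_iff).1 z.2.2)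
    have fy := firstPartOf_combine hy y.2.1.isForest_blocks
    have fz := firstPartOf_combine hz z.2.1.isForest_blocks
    rw [← ForestTriple.type_eq, ← ForestTriple.firstPart_eq] at ty tz
    rw [← ForestTriple.weight_eq] at wy wz
    simp only [Prod.mk.injEq, ForestTriple.type_eq (g _).1, ForestTriple.weight_eq (g _).1,
      ForestTriple.firstPart_eq (g _).1, hg y hy, hg z hz]
    refine ⟨?_, ?_, ?_⟩
    -- The types agree because the same part, the first part of the right factor, is removed on both
    -- sides.
    · rw [h₁, h₄, h₆, ← tz] at ty
      exact add_right_cancel ty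
    · exact wy.trans (by rw [h₂, h₅]; exact wz.symm)
    · exact fy.trans (h₃.trans fz.symm)
  · rintro y ⟨hy, -⟩ z ⟨hz, -⟩ - h
    have hs : ∀ y : List Block × SimpleForestTriple G',
        IsLeft (LabelledGraph.almostComplete a ε ha) (y.2.1.firstPart - 1) y.1 →
          (g y).1.sign = pairSign y := by
      intro y hy
      rw [ForestTriple.sign_eq, hg y hy, pairSign, ForestTriple.sign_eq, ← pow_add]
      congr 1
      exact excess_combine hy y.2.1.isForest_blocks
    rw [hs y hy, hs z hz, h]

end sum

theorem theorem4p7 (a ε : ℕ) (ha : 1 ≤ a) (hε : ε = 0 ∨ ε = 1)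
    (G' : LabelledGraph) (hG' : G'.IsNaturalUnitInterval)
    (φ' : SimpleForestTriple G' → SimpleForestTriple G') (hφ' : IsNiceInvolution φ') :
    ∃ φ : SimpleForestTriple ((LabelledGraph.almostComplete a ε ha).sum G') →
        SimpleForestTriple ((LabelledGraph.almostComplete a ε ha).sum G'),
      IsNiceInvolution φ ∧
      ∀ F, φ F = F ↔
        F.1.IsAtom ∧
        (∃ F', IsRestriction F F' ∧ φ' F' = F') ∧
        F.1.seg a ≤ 2 ∧
        ∀ S ∈ F.1.triples, a ∈ S.verts →
          (1 ∉ S.verts → a - ε ≤ S.r) ∧ (1 ∈ S.verts → a ≤ S.verts.ncard) := by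
  classical
  obtain ⟨ψ, hψ⟩ := cancels_not_sumFixed (ha := ha) hε hφ'
  -- Reversing a nonzero sign excludes further fixed points.
  have hfix : ∀ F, (if SumFixed a ε ha φ' F then F else ψ F) = F ↔ SumFixed a ε ha φ' F := by
    intro F
    by_cases h : SumFixed a ε ha φ' F
    · simp [h]
    · simp only [h, if_false, iff_false]
      intro h'
      have hs : (ψ F).1.sign = -F.1.sign := (hψ F h).2.2.2
      rw [h'] at hs
      rcases F.1.sign_cases with h₁ | h₁ <;> rw [h₁] at hs <;> norm_num at hs
  have hkey : ∀ F, ((if SumFixed a ε ha φ' F then F else ψ F).1.type,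
      (if SumFixed a ε ha φ' F then F else ψ F).1.weight,
      (if SumFixed a ε ha φ' F then F else ψ F).1.firstPart) =
        (F.1.type, F.1.weight, F.1.firstPart) := by
    intro F
    by_cases h : SumFixed a ε ha φ' F
    · simp only [h, if_true]
    · simp only [h, if_false]
      exact (hψ F h).2.2.1
  refine ⟨fun F => if SumFixed a ε ha φ' F then F else ψ F, ⟨?_, ?_, ?_, ?_, ?_, ?_⟩, hfix⟩
  · intro F
    by_cases h : SumFixed a ε ha φ' F
    · simp [h]
    · have h₁ : ¬ SumFixed a ε ha φ' (ψ F) := (hψ F h).1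
      simp [h, h₁, (hψ F h).2.1]
  · exact fun F => congrArg Prod.fst (hkey F)
  · exact fun F => congrArg (fun k => k.2.1) (hkey F)
  · exact fun F => congrArg (fun k => k.2.2) (hkey F)
  · exact fun F h => ((hfix F).1 h).1
  · intro F h
    have h' : ¬ SumFixed a ε ha φ' F := fun h' => h ((hfix F).2 h')
    simp only [h', if_false]
    exact (hψ F h').2.2.2
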